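/- Let $d\ge 2$, let $\Omega\subseteq\mathbb R^d$ be a bounded Lipschitz domain that possesses triangulations into $d$-simplices, let $0<T<\infty$, $I=(0,T)$, $Q_T=I\times\Omega$. Write $\rho_{r}(u)=\int|u|^{r(\cdot)}$ for the modular of a variable exponent $r$, $\|\cdot\|_{r(\cdot)}$ for the Luxembourg norm, $\mathbf D_x$ for the (weak) symmetric gradient and $(\cdot,\cdot)_\Omega$ for the $L^2(\Omega)$ inner product. For exponents $q,p$ on $\Omega$ let $E_0^{q(\cdot),p(\cdot)}$ be the closure of $C_c^\infty(\Omega;\mathbb R^d)$ in $\{\mathbf u\in L^{q(\cdot)}(\Omega;\mathbb R^d)\mid \mathbf D_x\mathbf u\in L^{p(\cdot)}(\Omega;\mathbb R^{d\times d}_{\rm sym})\}$ with respect to the norm $\|\mathbf u\|_{q(\cdot)}+\|\mathbf D_x\mathbf u\|_{p(\cdot)}$. *Exponents.* Let $p$ be a bounded measurable exponent on $Q_T$ with $p^-:=\operatorname{ess\,inf}p\ge 2$, let $\varepsilon\in(0,\tfrac2d p^-]$, and for $n\in\mathbb N$ let $p_n$ be a bounded measurable exponent on $Q_T$ with $p_n\ge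 p^-$ a.e.; put $q_n:=\tfrac{d+2}{d}p_n-\varepsilon$. Set $U_n(t):=E_0^{q_n(t,\cdot),p_n(t,\cdot)}$ for a.e. $t\in I$ and $U_{n,+}:=E_0^{q_n^+,p_n^+}$, where $q_n^+,p_n^+$ are the essential suprema over $Q_T$. Let $\mathcal U_n$ be the space of all $\boldsymbol u\in L^{q_n(\cdot,\cdot)}(Q_T;\mathbb R^d)$ with $\mathbf D_x\boldsymbol u\in L^{p_n(\cdot,\cdot)}(Q_T;\mathbb R^{d\times d}_{\rm sym})$ and $\boldsymbol u(t)\in U_n(t)$ for a.e. $t\in I$. *Finite elements.* Let $m\ge1$, $\ell\ge0$. For $n\in\mathbb N$ let $\mathcal T_n$ be a (finite, conforming) triangulation of $\Omega$, let $V_n$ be a linear space of vector fields that are continuous on $\overline\Omega$ and whose components are polynomials of degree at most $m$ on each simplex of $\mathcal T_n$, and let $Q_n$ be a linear space of functions that are polynomials of degree at most $\ell$ on each simplex of $\mathcal T_n$. Let $$\mathring V_{n,0}:=\{\mathbf z\in V_n\cap W^{1,1}_0(\Omega;\mathbb R^d)\mid (\operatorname{div}\mathbf z,\eta)_\Omega=0\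 \text{ for all }\eta\in Q_n\}.$$ *Data.* Let $\mathbf v_n^0\in\mathring V_{n,0}$, $\boldsymbol f_n\in L^{(p^-)'}(Q_T;\mathbb R^d)$ and $\boldsymbol F_n\in L^{p_n'(\cdot,\cdot)}(Q_T;\mathbb R^{d\times d}_{\rm sym})$ for $n\in\mathbb N$, where $r'=\frac r{r-1}$. *Operators.* For $n\in\mathbb N$ let $A_n(t)\colon U_n(t)\to U_n(t)^*$, $t\in I$, be a family of operators such that 1. $A_n(t)$ is demi-continuous for a.e. $t\in I$; 2. $t\mapsto\langle A_n(t)(\boldsymbol u(t)),\boldsymbol z(t)\rangle$ is Lebesgue measurable on $I$ for all $\boldsymbol u,\boldsymbol z\in\mathcal U_n$; 3. for a non-decreasing function $\mathbb B\colon\mathbb R_{\ge0}\to\mathbb R_{\ge0}$ independent of $n$, for a.e. $t\in I$ and all $\mathbf u,\mathbf z\in U_n(t)$, $$|\langle A_n(t)\mathbf u,\mathbf z\rangle|\le\mathbb B(\|\mathbf u\|_2)\big(1+\rho_{q_n(t,\cdot)}(\mathbf u)+\rho_{p_n(t,\cdot)}(\mathbf D_x\mathbf u)+\rho_{q_n(t,\cdot)}(\mathbf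 z)+\rho_{p_n(t,\cdot)}(\mathbf D_x\mathbf z)\big);$$ 4. for constants $c_0>0$, $c_1,c_2\ge0$ independent of $n$, for a.e. $t\in I$ and all $\mathbf u\in U_n(t)$, $$\langle A_n(t)\mathbf u,\mathbf u\rangle\ge c_0\,\rho_{p_n(t,\cdot)}(\mathbf D_x\mathbf u)-c_1\|\mathbf u\|_2^2-c_2.$$ Then for all $K,n\in\mathbb N$, $K\ge1$, for which $\tau:=T/K$ satisfies $\tau<\frac1{4c_1}$ (no condition if $c_1=0$), one has $\mathring V_{n,0}\subseteq U_{n,+}$ and there exist $\mathbf v_n^1,\dots,\mathbf v_n^K\in\mathring V_{n,0}$ such that for every $k=1,\dots,K$ and every $\mathbf z\in\mathring V_{n,0}$, with $I_k=((k-1)\tau,k\tau]$, $$\tfrac1\tau(\mathbf v_n^k-\mathbf v_n^{k-1},\mathbf z)_\Omega+\frac1\tau\int_{I_k}\langle A_n(t)\mathbf v_n^k,\mathbf z\rangle\,dt=\frac1\tau\int_{I_k}\big[(\boldsymbol f_n(t),\mathbf z)_\Omega+(\boldsymbol F_n(t),\mathbf D_x\mathbf z)_\Omega\big]\,dt,$$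 where both integrands in $t$ are integrable on $I_k$. -/

import Mathlib

open MeasureTheory Set Filter Topology
open scoped ENNReal NNReal ContDiff

noncomputable section

namespace RotheGalerkin

/-- Points and vectors of `ℝ^d`, with the Euclidean norm. -/
abbrev Pt (d : ℕ) := EuclideanSpace ℝ (Fin d)

/-- Real `d × d` matrices, with the Frobenius norm and the Frobenius inner product. -/
abbrev Mat (d : ℕ) := EuclideanSpace ℝ (Fin d × Fin d)

/-- The `j`-th unit vector. -/
def unitVec {d : ℕ} (j : Fin d) : Pt d := EuclideanSpace.single j (1 : ℝ)

/-! ### Domains and triangulations -/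

/-- Bounded Lipschitz domains: bounded, open, connected and nonempty sets which, near each boundary
point, are the strict epigraph, in some direction `e`, of a Lipschitz function of the coordinates
orthogonal to `e`. -/
structure IsBoundedLipschitzDomain {d : ℕ} (Ω : Set (Pt d)) : Prop where
  isOpen : IsOpen Ω
  isConnected : IsConnected Ω
  isBounded : Bornology.IsBounded Ω
  lipschitz_boundary : ∀ x ∈ frontier Ω, ∃ (e : Pt d) (γ : Pt d → ℝ) (L : ℝ≥0) (r : ℝ),
    ‖e‖ = 1 ∧ LipschitzWith L γ ∧ (∀ (y : Pt d) (s : ℝ), γ (y + s • e) = γ y) ∧ 0 < r ∧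
      ∀ y ∈ Metric.ball x r, y ∈ Ω ↔ γ y < inner ℝ e y

/-- A (conforming) triangulation of `Ω`: a finite simplicial complex, all of whose faces are faces
of `d`-dimensional simplices of the complex, which covers the closure of `Ω`. -/
structure IsTriangulation {d : ℕ} (Ω : Set (Pt d)) (𝒯 : Geometry.SimplicialComplex ℝ (Pt d)) :
    Prop where
  finite : 𝒯.faces.Finite
  pure : ∀ s ∈ 𝒯.faces, ∃ t ∈ 𝒯.faces, s ⊆ t ∧ t.card = d + 1
  space_eq : 𝒯.space = closure Ω

/-! ### Variable Lebesgue spaces -/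

section VariableLebesgue

variable {α F : Type*} [MeasurableSpace α] [NormedAddCommGroup F] [NormedSpace ℝ F]

/-- Bounded variable exponents. -/
structure IsBoundedExponent (μ : Measure α) (p : α → ℝ) : Prop where
  aemeasurable : AEMeasurable p μ
  one_le : ∀ᵐ x ∂μ, 1 ≤ p x
  bounded : ∃ C : ℝ, ∀ᵐ x ∂μ, p x ≤ C

/-- The modular `∫ |u(x)|^{p(x)} dx`. -/
def modular (μ : Measure α) (p : α → ℝ) (u : α → F) : ℝ≥0∞ :=
  ∫⁻ x, ENNReal.ofReal (‖u x‖ ^ p x) ∂μ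

/-- Membership in the variable Lebesgue space `L^{p(·)}`. -/
def MemVarLp (μ : Measure α) (p : α → ℝ) (u : α → F) : Prop :=
  AEStronglyMeasurable u μ ∧ modular μ p u < ⊤

/-- The Luxembourg norm `inf {λ > 0 | ρ_p(u / λ) ≤ 1}` (with the value `∞` if there is no such
`λ`). -/
def luxNorm (μ : Measure α) (p : α → ℝ) (u : α → F) : ℝ≥0∞ :=
  ⨅ (lam : ℝ) (_ : 0 < lam ∧ modular μ p (fun x => lam⁻¹ • u x) ≤ 1), ENNReal.ofReal lam

end VariableLebesgue

/-! ### Fields on `Ω`, weak derivatives, Sobolev spaces -/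

section Space

variable {d : ℕ} (Ω : Set (Pt d))

/-- Vector fields on `Ω` up to equality almost everywhere. -/
abbrev VF := Pt d →ₘ[volume.restrict Ω] Pt d

/-- Matrix fields on `Ω` up to equality almost everywhere. -/
abbrev MF := Pt d →ₘ[volume.restrict Ω] Mat d

/-- Scalar functions on `Ω` up to equality almost everywhere. -/
abbrev SF := Pt d →ₘ[volume.restrict Ω] ℝ

variable {Ω}

/-- `G` is the weak gradient `(∂_j u_i)_{ij}` of `u` in `Ω`. -/
def HasWeakGrad (u : VF Ω) (G : MF Ω) : Prop :=
  LocallyIntegrableOn u Ω ∧ LocallyIntegrableOn G Ω ∧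
    ∀ φ : Pt d → ℝ, ContDiff ℝ ∞ φ → HasCompactSupport φ → tsupport φ ⊆ Ω → ∀ i j : Fin d,
      ∫ x in Ω, G x (i, j) * φ x = - ∫ x in Ω, u x i * fderiv ℝ φ x (unitVec j)

/-- `G` is the weak symmetric gradient `D_x u = (½ (∂_j u_i + ∂_i u_j))_{ij}` of `u` in `Ω`. -/
def HasWeakSymGrad (u : VF Ω) (G : MF Ω) : Prop :=
  LocallyIntegrableOn u Ω ∧ LocallyIntegrableOn G Ω ∧
    ∀ φ : Pt d → ℝ, ContDiff ℝ ∞ φ → HasCompactSupport φ → tsupport φ ⊆ Ω → ∀ i j : Fin d,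
      ∫ x in Ω, G x (i, j) * φ x =
        - (1 / 2 : ℝ) * ∫ x in Ω,
          (u x i * fderiv ℝ φ x (unitVec j) + u x j * fderiv ℝ φ x (unitVec i))

open Classical in
/-- The weak symmetric gradient `D_x u` (zero if there is none). It is unique. -/
def symGrad (u : VF Ω) : MF Ω :=
  if h : ∃ G, HasWeakSymGrad u G then h.choose else 0

/-- The divergence of a field that has a weak symmetric gradient: the trace of the latter. -/
def divergence (u : VF Ω) (x : Pt d) : ℝ := ∑ i : Fin d, symGrad u x (i, i)

/-- `φ ∈ C_c^∞(Ω; ℝ^d)`. -/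
def IsTestField (Ω : Set (Pt d)) (φ : Pt d → Pt d) : Prop :=
  ContDiff ℝ ∞ φ ∧ HasCompactSupport φ ∧ tsupport φ ⊆ Ω

/-- The classical gradient `(∂_j φ_i)_{ij}`. -/
def classicalGrad (φ : Pt d → Pt d) (x : Pt d) : Mat d :=
  WithLp.toLp 2 fun ij : Fin d × Fin d => fderiv ℝ φ x (unitVec ij.2) ij.1

/-- `u ∈ W^{1,1}_0(Ω; ℝ^d)`: `u` has an integrable weak gradient and is a limit of test fields in
`W^{1,1}(Ω; ℝ^d)`. -/
def MemW110 (u : VF Ω) : Prop :=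
  MemLp u 1 (volume.restrict Ω) ∧ ∃ G : MF Ω, HasWeakGrad u G ∧ MemLp G 1 (volume.restrict Ω) ∧
    ∀ δ : ℝ≥0∞, 0 < δ → ∃ φ : Pt d → Pt d, IsTestField Ω φ ∧
      eLpNorm (fun x => u x - φ x) 1 (volume.restrict Ω) +
        eLpNorm (fun x => G x - classicalGrad φ x) 1 (volume.restrict Ω) < δ

/-- The symmetric variable Sobolev norm `‖u‖_{q(·)} + ‖D_x u‖_{p(·)}`. -/
def sobNorm (q p : Pt d → ℝ) (u : VF Ω) : ℝ≥0∞ :=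
  luxNorm (volume.restrict Ω) q u + luxNorm (volume.restrict Ω) p (symGrad u)

/-- The symmetric variable Sobolev space `E^{q(·),p(·)}`. -/
def symSobolev (Ω : Set (Pt d)) (q p : Pt d → ℝ) : Set (VF Ω) :=
  {u | MemVarLp (volume.restrict Ω) q u ∧ (∃ G, HasWeakSymGrad u G) ∧
    MemVarLp (volume.restrict Ω) p (symGrad u)}

/-- `E^{q(·),p(·)}_0`, the closure of `C_c^∞(Ω; ℝ^d)` in `E^{q(·),p(·)}`. -/
def symSobolev₀ (Ω : Set (Pt d)) (q p : Pt d → ℝ) : Set (VF Ω) :=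
  {u | u ∈ symSobolev Ω q p ∧ ∀ δ : ℝ≥0∞, 0 < δ →
    ∃ w : VF Ω, (∃ φ, IsTestField Ω φ ∧ w =ᵐ[volume.restrict Ω] φ) ∧ sobNorm q p (u - w) < δ}

/-- The `L²(Ω)` norm. -/
def l2Norm (u : VF Ω) : ℝ≥0 := (eLpNorm u 2 (volume.restrict Ω)).toNNReal

/-- The `L²(Ω)` inner product. -/
def l2Inner (u z : VF Ω) : ℝ := ∫ x in Ω, inner ℝ (u x) (z x)

/-! ### Finite element spaces -/

/-- Membership in `ℙ^l(𝒯)`: possibly discontinuous functions which are polynomials of degree at most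
`l` on each `d`-dimensional simplex. -/
def IsPwPoly (𝒯 : Geometry.SimplicialComplex ℝ (Pt d)) (l : ℕ) (f : SF Ω) : Prop :=
  ∀ s ∈ 𝒯.faces, s.card = d + 1 → ∃ P : MvPolynomial (Fin d) ℝ, P.totalDegree ≤ l ∧
    ∀ᵐ x ∂volume.restrict Ω, x ∈ convexHull ℝ (s : Set (Pt d)) →
      f x = MvPolynomial.eval (fun i => x i) P

/-- Membership in `(ℙ^m_c(𝒯))^d`: fields that are continuous on the closure of `Ω` and whose
components are polynomials of degree at most `m` on each `d`-dimensional simplex. -/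
def IsContPwPoly (𝒯 : Geometry.SimplicialComplex ℝ (Pt d)) (m : ℕ) (v : VF Ω) : Prop :=
  ∃ g : Pt d → Pt d, ContinuousOn g (closure Ω) ∧ v =ᵐ[volume.restrict Ω] g ∧
    ∀ s ∈ 𝒯.faces, s.card = d + 1 → ∀ i : Fin d, ∃ P : MvPolynomial (Fin d) ℝ,
      P.totalDegree ≤ m ∧
        ∀ x ∈ convexHull ℝ (s : Set (Pt d)), g x i = MvPolynomial.eval (fun i => x i) P

/-- The discretely divergence-free fields: the `z ∈ V ∩ W^{1,1}_0(Ω; ℝ^d)` with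
`(div z, η)_Ω = 0` for all `η ∈ Q`. -/
def discDivFree (V : Submodule ℝ (VF Ω)) (Q : Submodule ℝ (SF Ω)) : Set (VF Ω) :=
  {z | z ∈ V ∧ MemW110 z ∧ ∀ η ∈ Q, ∫ x in Ω, divergence z x * η x = 0}

end Space

/-! ### Time-dependent objects -/

section Time

variable {d : ℕ}

/-- The time-space cylinder `Q_T = (0, T) × Ω`. -/
def cylinder (T : ℝ) (Ω : Set (Pt d)) : Set (ℝ × Pt d) := Ioo 0 T ×ˢ Ω

/-- The time slice space `U(t) = E_0^{q(t,·),p(t,·)}`. -/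
def sliceSpace (Ω : Set (Pt d)) (q p : ℝ × Pt d → ℝ) (t : ℝ) : Set (VF Ω) :=
  symSobolev₀ Ω (fun x => q (t, x)) (fun x => p (t, x))

/-- The norm of the time slice space. -/
def sliceNorm {Ω : Set (Pt d)} (q p : ℝ × Pt d → ℝ) (t : ℝ) (u : VF Ω) : ℝ≥0∞ :=
  sobNorm (fun x => q (t, x)) (fun x => p (t, x)) u

/-- The space `U_+ = E_0^{q⁺,p⁺}`, where `q⁺`, `p⁺` are the essential suprema over `Q_T`. -/
def uPlus (T : ℝ) (Ω : Set (Pt d)) (q p : ℝ × Pt d → ℝ) : Set (VF Ω) :=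
  symSobolev₀ Ω (fun _ => essSup q (volume.restrict (cylinder T Ω)))
    (fun _ => essSup p (volume.restrict (cylinder T Ω)))

open Classical in
/-- The slice `u(t)` of a time-dependent vector field, as a field on `Ω` (zero for the times `t` at
which the slice is not measurable). -/
def slice (Ω : Set (Pt d)) (u : ℝ × Pt d → Pt d) (t : ℝ) : VF Ω :=
  if h : AEStronglyMeasurable (fun x => u (t, x)) (volume.restrict Ω) then
    AEEqFun.mk (fun x => u (t, x)) h
  else 0

/-- The variable Bochner--Lebesgue space: `u ∈ L^{q(·,·)}(Q_T)` with weak symmetric spatial gradient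
`D_x u ∈ L^{p(·,·)}(Q_T)` and `u(t) ∈ U(t)` for almost every `t`. -/
def bochnerSpace (T : ℝ) (Ω : Set (Pt d)) (q p : ℝ × Pt d → ℝ) : Set (ℝ × Pt d → Pt d) :=
  {u | MemVarLp (volume.restrict (cylinder T Ω)) q u ∧
    (∃ G : ℝ × Pt d → Mat d, MemVarLp (volume.restrict (cylinder T Ω)) p G ∧
      ∀ φ : ℝ × Pt d → ℝ, ContDiff ℝ ∞ φ → HasCompactSupport φ → tsupport φ ⊆ cylinder T Ω →
        ∀ i j : Fin d,
          ∫ y in cylinder T Ω, G y (i, j) * φ y =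
            - (1 / 2 : ℝ) * ∫ y in cylinder T Ω,
              (u y i * fderiv ℝ φ y (0, unitVec j) + u y j * fderiv ℝ φ y (0, unitVec i))) ∧
    ∀ᵐ t ∂volume.restrict (Ioo 0 T), slice Ω u t ∈ sliceSpace Ω q p t}

/-- `ℓ` restricts to an element of the dual of the space `S` with norm `N`, i.e. it is linear and
bounded on `S`. -/
structure IsDualElement {Ω : Set (Pt d)} (S : Set (VF Ω)) (N : VF Ω → ℝ≥0∞) (ℓ : VF Ω → ℝ) :
    Prop where
  map_add : ∀ z ∈ S, ∀ w ∈ S, ℓ (z + w) = ℓ z + ℓ w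
  map_smul : ∀ (a : ℝ), ∀ z ∈ S, ℓ (a • z) = a * ℓ z
  bounded : ∃ C : ℝ≥0, ∀ z ∈ S, ENNReal.ofReal |ℓ z| ≤ C * N z

/-! An operator family `A(t) : U(t) → U(t)^*` is given by the numbers `A t u z = ⟨A(t) u, z⟩`. Only
the values at `u, z ∈ U(t)` matter. -/

/-- For almost every `t`, `A(t)` maps `U(t)` into its dual space. -/
def IsOperatorFamily (T : ℝ) (Ω : Set (Pt d)) (q p : ℝ × Pt d → ℝ)
    (A : ℝ → VF Ω → VF Ω → ℝ) : Prop :=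
  ∀ᵐ t ∂volume.restrict (Ioo 0 T), ∀ u ∈ sliceSpace Ω q p t,
    IsDualElement (sliceSpace Ω q p t) (sliceNorm q p t) (A t u)

/-- For almost every `t`, `A(t)` is demi-continuous: if `u_j → u` in `U(t)`, then `A(t) u_j`
converges weakly to `A(t) u` in the dual of the reflexive space `U(t)`. -/
def IsDemicontinuous (T : ℝ) (Ω : Set (Pt d)) (q p : ℝ × Pt d → ℝ)
    (A : ℝ → VF Ω → VF Ω → ℝ) : Prop :=
  ∀ᵐ t ∂volume.restrict (Ioo 0 T), ∀ (uj : ℕ → VF Ω), ∀ u ∈ sliceSpace Ω q p t,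
    (∀ j, uj j ∈ sliceSpace Ω q p t) →
    Tendsto (fun j => sliceNorm q p t (uj j - u)) atTop (𝓝 0) →
      ∀ z ∈ sliceSpace Ω q p t, Tendsto (fun j => A t (uj j) z) atTop (𝓝 (A t u z))

/-- `t ↦ ⟨A(t)(u(t)), z(t)⟩` is Lebesgue measurable for all `u`, `z` in the variable
Bochner--Lebesgue space. -/
def IsMeasurableFamily (T : ℝ) (Ω : Set (Pt d)) (q p : ℝ × Pt d → ℝ)
    (A : ℝ → VF Ω → VF Ω → ℝ) : Prop :=
  ∀ u ∈ bochnerSpace T Ω q p, ∀ z ∈ bochnerSpace T Ω q p,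
    AEMeasurable (fun t => A t (slice Ω u t) (slice Ω z t)) (volume.restrict (Ioo 0 T))

/-- `|⟨A(t) u, z⟩| ≤ 𝔹(‖u‖₂) (1 + ρ_q(u) + ρ_p(D_x u) + ρ_q(z) + ρ_p(D_x z))`. -/
def HasGrowth (T : ℝ) (Ω : Set (Pt d)) (q p : ℝ × Pt d → ℝ)
    (A : ℝ → VF Ω → VF Ω → ℝ) (𝔹 : ℝ≥0 → ℝ≥0) : Prop :=
  ∀ᵐ t ∂volume.restrict (Ioo 0 T), ∀ u ∈ sliceSpace Ω q p t, ∀ z ∈ sliceSpace Ω q p t,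
    |A t u z| ≤ 𝔹 (l2Norm u) *
      (1 + (modular (volume.restrict Ω) (fun x => q (t, x)) u).toReal
        + (modular (volume.restrict Ω) (fun x => p (t, x)) (symGrad u)).toReal
        + (modular (volume.restrict Ω) (fun x => q (t, x)) z).toReal
        + (modular (volume.restrict Ω) (fun x => p (t, x)) (symGrad z)).toReal)

/-- `⟨A(t) u, u⟩ ≥ c₀ ρ_p(D_x u) - c₁ ‖u‖₂² - c₂`. -/
def IsSemicoercive (T : ℝ) (Ω : Set (Pt d)) (q p : ℝ × Pt d → ℝ)
    (A : ℝ → VF Ω → VF Ω → ℝ) (c₀ c₁ c₂ : ℝ) : Prop :=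
  ∀ᵐ t ∂volume.restrict (Ioo 0 T), ∀ u ∈ sliceSpace Ω q p t,
    c₀ * (modular (volume.restrict Ω) (fun x => p (t, x)) (symGrad u)).toReal
      - c₁ * (l2Norm u : ℝ) ^ 2 - c₂ ≤ A t u u

/-- The value at time `t` of the functional `J(f, F) : u ↦ (f, u)_{Q_T} + (F, D_x u)_{Q_T}`, applied
to a field `z` on `Ω`. -/
def rhsPairing {Ω : Set (Pt d)} (f : ℝ × Pt d → Pt d) (F : ℝ × Pt d → Mat d) (t : ℝ)
    (z : VF Ω) : ℝ :=
  (∫ x in Ω, inner ℝ (f (t, x)) (z x)) + ∫ x in Ω, inner ℝ (F (t, x)) (symGrad z x)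

/-- The step size `τ = T / K`. -/
def stepSize (T : ℝ) (K : ℕ) : ℝ := T / K

/-- The time interval `I_k = ((k - 1) τ, k τ]`. -/
def timeInterval (T : ℝ) (K k : ℕ) : Set ℝ :=
  Ioc (((k : ℝ) - 1) * stepSize T K) ((k : ℝ) * stepSize T K)

/-- The iterates `v 0, …, v K` solve the implicit scheme: for all `k = 1, …, K` and `z ∈ W`,
`(d_τ v^k, z)_Ω + ⟨⟨A⟩_k v^k, z⟩ = ⟨⟨J(f, F)⟩_k, z⟩`, where `d_τ v^k = τ⁻¹ (v^k - v^{k-1})` and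
`⟨·⟩_k` is the temporal mean over `I_k`, taken of the integrable functions `t ↦ ⟨A(t) v^k, z⟩` and
`t ↦ (f(t), z)_Ω + (F(t), D_x z)_Ω`. -/
def SolvesScheme (T : ℝ) {Ω : Set (Pt d)} (K : ℕ) (W : Set (VF Ω)) (A : ℝ → VF Ω → VF Ω → ℝ)
    (f : ℝ × Pt d → Pt d) (F : ℝ × Pt d → Mat d) (v : ℕ → VF Ω) : Prop :=
  ∀ k : ℕ, 1 ≤ k → k ≤ K → ∀ z ∈ W,
    IntegrableOn (fun t => A t (v k) z) (timeInterval T K k) ∧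
    IntegrableOn (fun t => rhsPairing f F t z) (timeInterval T K k) ∧
    l2Inner ((stepSize T K)⁻¹ • (v k - v (k - 1))) z + (⨍ t in timeInterval T K k, A t (v k) z) =
      ⨍ t in timeInterval T K k, rhsPairing f F t z

end Time

end RotheGalerkin

end

open RotheGalerkin

/-! Each time step is a nonlinear equation in a finite dimensional space, solved by Brouwer's
theorem. Testing the averaged operator with the unknown and using semi-coercivity leaves `(τ⁻¹ -
c₁)‖u‖²` up to terms of order at most one in `‖u‖`. Since `c₁ τ < 1`, the resulting vector field
points outwards on a large sphere and therefore has a zero (`exists_zero_of_inner_pos`,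
`exists_solution_of_semicoercive`). Brouwer's theorem enters as the absence of a `C¹` retraction
onto the sphere (`not_retraction`): the volume of the image of the ball under `id + t g` is a
polynomial in `t`, constant for small `t > 0`, hence constant up to `t = 1`, where the derivative of
a retraction is singular.

The analytic difficulty is that the exponents are merely measurable, so smooth fields need not be
dense in the variable Sobolev spaces and membership in `E_0` is not automatic. It is saved by
boundedness: finite element fields are bounded and have bounded weak gradients
(`isTame_of_isContPwPoly`). Membership in `W^{1,1}_0` says that integration by parts holds for the
extension by zero, with no boundary term (`MemW110.hasZeroExtGrad`). After localization, mollifying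
this extension with kernels shifted into the Lipschitz domain yields test fields that are uniformly
bounded together with their gradients and converge almost everywhere
(`HasZeroExtGrad.exists_approx`). Dominated convergence in the modular then gives convergence in
every Luxembourg norm with bounded exponent (`HasZeroExtGrad.mem_symSobolev₀`). This covers the
slice spaces `U_n(t)` at almost every time as well as `U_{n,+}`.

Bounded fields also make the averaged operator well defined and continuous on the finite dimensional
space. Convergence of coefficients is uniform convergence of fields and symmetric gradients, hence
convergence in `U_n(t)` for almost every `t`. Demi-continuity applies at each such time, and the
growth condition supplies a constant majorant for the integral over `I_k`
(`exists_scheme_step_of_linearMap`). The iterates follow by recursion on `k`. -/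

namespace RotheGalerkin

/-! ### Zeros of continuous maps in finite dimension -/

section Zeros

variable {E : Type*} [NormedAddCommGroup E] [NormedSpace ℝ E] [FiniteDimensional ℝ E]

/-- `t ↦ det (1 + t A)` is a polynomial of degree at most `dim E`; its value at `1` is obtained by
interpolation, with weights that do not depend on `A`. -/
theorem exists_weights_det_one_add (δ : ℝ) (hδ : 0 < δ) :
    ∃ (N : ℕ) (t w : Fin N → ℝ), (∀ i, 0 < t i ∧ t i < δ) ∧ ∑ i, w i = 1 ∧
      ∀ A : E →L[ℝ] E, (1 + A).det = ∑ i, w i * (1 + t i • A).det := by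
  classical
  set n := Module.finrank ℝ E
  let b := Module.finBasis ℝ E
  -- There are `n + 1` distinct nodes in `(0, δ)`, enough to determine a polynomial of degree at
  -- most `n`. The weights are the Lagrange basis polynomials evaluated at `1`; they sum to `1`
  -- because the basis polynomials do.
  let t : Fin (n + 1) → ℝ := fun i => δ * ((i : ℝ) + 1) / (n + 2)
  have ht : Function.Injective t := by
    intro i j hij
    have : (0 : ℝ) < n + 2 := by positivity
    simp only [t] at hij
    field_simp at hij
    exact Fin.ext (by exact_mod_cast add_right_cancel hij)
  refine ⟨n + 1, t, fun i => (Lagrange.basis Finset.univ t i).eval 1, fun i => ⟨by positivity, ?_⟩,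
    ?_, fun A => ?_⟩
  · have hi : (i : ℝ) + 1 < n + 2 := by
      have : (i : ℕ) + 1 < n + 2 := by omega
      exact_mod_cast this
    simp only [t]
    rw [div_lt_iff₀ (by positivity)]
    exact mul_lt_mul_of_pos_left hi hδ
  · rw [← Polynomial.eval_finsetSum, Lagrange.sum_basis ht.injOn ⟨0, Finset.mem_univ _⟩]
    simp
  · let M : Matrix (Fin n) (Fin n) ℝ := LinearMap.toMatrix b b (A : E →ₗ[ℝ] E)
    let P : Polynomial ℝ :=
      ((Polynomial.X : Polynomial ℝ) • M.map Polynomial.C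
        + (1 : Matrix (Fin n) (Fin n) ℝ).map Polynomial.C).det
    have hP : ∀ s : ℝ, (1 + s • A).det = P.eval s := by
      intro s
      rw [ContinuousLinearMap.det, ← LinearMap.det_toMatrix b]
      change _ = Polynomial.evalRingHom s P
      rw [RingHom.map_det]
      congr 1
      ext i j
      simp [M, LinearMap.toMatrix_apply, Matrix.one_apply, Finsupp.single_apply, eq_comm, add_comm]
      split_ifs <;> simp [mul_comm]
    have hdeg : P.degree < (Finset.univ : Finset (Fin (n + 1))).card := by
      have h := Polynomial.natDegree_det_X_add_C_le M 1
      rw [Finset.card_fin]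
      refine lt_of_le_of_lt Polynomial.degree_le_natDegree ?_
      simp only [Fintype.card_fin] at h
      exact_mod_cast Nat.lt_succ_of_le h
    have h1 := hP 1
    rw [one_smul] at h1
    rw [h1]
    conv_lhs => rw [Lagrange.eq_interpolate ht.injOn hdeg]
    rw [Lagrange.interpolate_apply, Polynomial.eval_finsetSum]
    refine Finset.sum_congr rfl fun i _ => ?_
    rw [hP (t i)]
    simp [mul_comm]

/-- A perturbation of the identity by a map with small Lipschitz constant is bijective. -/
theorem bijective_add_smul {g : E → E} {C : ℝ≥0} (hg : LipschitzWith C g) {t : ℝ} (ht : 0 ≤ t)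
    (htC : t * C < 1) : Function.Bijective fun x => x + t • g x := by
  -- Solutions of `x + t g(x) = y` are exactly the fixed points of `x ↦ y - t g(x)`, so Banach's
  -- theorem gives both injectivity and surjectivity.
  have hC : ∀ y, ContractingWith (t.toNNReal * C) fun x => y - t • g x := by
    intro y
    refine ⟨?_, LipschitzWith.of_dist_le_mul fun x x' => ?_⟩
    · rw [← NNReal.coe_lt_coe]
      simpa [ht] using htC
    · rw [dist_sub_left, dist_smul₀, NNReal.coe_mul, Real.coe_toNNReal _ ht, Real.norm_of_nonneg ht,
        mul_assoc]
      exact mul_le_mul_of_nonneg_left (hg.dist_le_mul x x') ht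
  refine ⟨fun x x' h => ?_, fun y => ?_⟩
  · have h' : x + t • g x = x' + t • g x' := h
    have hx : Function.IsFixedPt (fun z => (x + t • g x) - t • g z) x := by
      simp [Function.IsFixedPt]
    have hx' : Function.IsFixedPt (fun z => (x + t • g x) - t • g z) x' := by
      simp [Function.IsFixedPt, h']
    exact (hC (x + t • g x)).fixedPoint_unique' hx hx'
  · have : Nonempty E := ⟨0⟩
    refine ⟨(hC y).fixedPoint, ?_⟩
    have h := (hC y).fixedPoint_isFixedPt
    have h' : y - t • g (hC y).fixedPoint = (hC y).fixedPoint := h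
    change (hC y).fixedPoint + t • g (hC y).fixedPoint = y
    rw [← h']
    nth_rewrite 2 [h']
    simp

omit [FiniteDimensional ℝ E] in
/-- A map that vanishes on the sphere and is Lipschitz on the ball is Lipschitz when it is extended
by zero. -/
theorem lipschitzWith_indicator_closedBall {g : E → E} {C : ℝ≥0} {R : ℝ}
    (hg : LipschitzOnWith C g (Metric.closedBall 0 R)) (h0 : ∀ x, ‖x‖ = R → g x = 0) :
    LipschitzWith C (indicator (Metric.closedBall 0 R) g) := by
  -- The segment from a point inside to a point outside crosses the sphere, where `g` vanishes; the
  -- crossing point is no farther from `x` than `y` is.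
  have key : ∀ x y, ‖x‖ ≤ R → R < ‖y‖ → dist (g x) 0 ≤ C * dist x y := by
    intro x y hx hy
    have hcont : ContinuousOn (fun s : ℝ => ‖x + s • (y - x)‖) (Icc 0 1) := by fun_prop
    obtain ⟨s, hs, hsR⟩ := intermediate_value_Icc (zero_le_one) hcont
      (show R ∈ Icc _ _ from ⟨by simpa using hx, by simpa using hy.le⟩)
    rw [← h0 _ hsR]
    refine (hg.dist_le_mul x (by simpa using hx) _ (by simpa using hsR.le)).trans ?_
    gcongr
    rw [dist_self_add_right, norm_smul, Real.norm_of_nonneg hs.1, dist_eq_norm', norm_sub_rev]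
    rw [norm_sub_rev]
    exact mul_le_of_le_one_left (norm_nonneg _) hs.2
  refine LipschitzWith.of_dist_le_mul fun x y => ?_
  by_cases hx : x ∈ Metric.closedBall (0 : E) R <;> by_cases hy : y ∈ Metric.closedBall (0 : E) R
  · rw [indicator_of_mem hx, indicator_of_mem hy]
    exact hg.dist_le_mul x hx y hy
  · rw [indicator_of_mem hx, indicator_of_notMem hy]
    exact key x y (by simpa using hx) (by simpa using hy)
  · rw [indicator_of_notMem hx, indicator_of_mem hy, dist_comm, dist_comm x]
    exact key y x (by simpa using hy) (by simpa using hx)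
  · rw [indicator_of_notMem hx, indicator_of_notMem hy, dist_self]
    positivity

end Zeros

/-! ### The no-retraction theorem and zeros of outward pointing fields -/

section Inner

variable {E : Type*} [NormedAddCommGroup E] [InnerProductSpace ℝ E] [FiniteDimensional ℝ E]

/-- There is no `C¹` retraction of the ball onto the sphere. -/
theorem not_retraction {f : E → E} (hf : ContDiff ℝ 1 f) {R : ℝ} (hR : 0 < R)
    (hfR : ∀ x, ‖f x‖ = R) (hid : ∀ x, ‖x‖ = R → f x = x) : False := by
  let _ : MeasurableSpace E := borel E
  have : BorelSpace E := ⟨rfl⟩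
  set g : E → E := fun x => f x - x with hgdef
  have hg : ContDiff ℝ 1 g := hf.sub contDiff_id
  set B := Metric.closedBall (0 : E) R
  have hB : IsCompact B := isCompact_closedBall 0 R
  have hDg : Continuous (fderiv ℝ g) := hg.continuous_fderiv one_ne_zero
  obtain ⟨C, hC⟩ := hB.exists_bound_of_continuousOn hDg.continuousOn
  have hC0 : 0 ≤ C := (norm_nonneg _).trans (hC 0 (by simp [B, hR.le]))
  lift C to ℝ≥0 using hC0
  have hlip : LipschitzOnWith C g B :=
    (convex_closedBall 0 R).lipschitzOnWith_of_nnnorm_fderiv_le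
      (fun x _ => hg.differentiable one_ne_zero x) fun x hx => by exact_mod_cast hC x hx
  -- On the sphere `f` is the identity, so `g` vanishes there. The extension by zero is globally
  -- Lipschitz, and for small `t` the map `x + t g(x)` is a bijection of the whole space.
  have hlip' := lipschitzWith_indicator_closedBall hlip fun x hx => by simp [hgdef, hid x hx]
  have hdet : Continuous fun A : E →L[ℝ] E => A.det := ContinuousLinearMap.continuous_det
  have hdet1 : (1 : E →L[ℝ] E).det = 1 := by
    simp [ContinuousLinearMap.det]
  obtain ⟨η, hη, hηdet⟩ : ∃ η > 0, ∀ A : E →L[ℝ] E, ‖A‖ < η → 0 < (1 + A).det := by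
    have h : ∀ᶠ A in 𝓝 (0 : E →L[ℝ] E), 0 < (1 + A).det := by
      have hc : Continuous fun A : E →L[ℝ] E => (1 + A).det :=
        hdet.comp (continuous_const.add continuous_id)
      exact hc.continuousAt.eventually (lt_mem_nhds (by simp [hdet1]))
    obtain ⟨η, hη, h⟩ := Metric.eventually_nhds_iff.1 h
    exact ⟨η, hη, fun A hA => h (by simpa using hA)⟩
  obtain ⟨δ, hδ, hδ1⟩ : ∃ δ : ℝ, 0 < δ ∧ ∀ t : ℝ, 0 < t → t < δ → t * C < 1 ∧ t * C < η := by
    refine ⟨min 1 η / (C + 1), by positivity, fun t ht htδ => ?_⟩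
    rw [lt_div_iff₀ (by positivity)] at htδ
    have : t * C < min 1 η := by nlinarith
    exact ⟨this.trans_le (min_le_left _ _), this.trans_le (min_le_right _ _)⟩
  set U := Metric.ball (0 : E) R
  have hUB : U ⊆ B := Metric.ball_subset_closedBall
  let μ : Measure E := Measure.addHaar
  have hint : ∀ t : ℝ, IntegrableOn (fun x => (1 + t • fderiv ℝ g x).det) U μ := by
    intro t
    have hc : Continuous fun x => (1 + t • fderiv ℝ g x).det :=
      hdet.comp (continuous_const.add (hDg.const_smul t))
    exact (hc.continuousOn.integrableOn_compact hB).mono_set hUB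
  -- For small `t` the determinant is positive and the map is a bijection of the open ball onto
  -- itself, so the change of variables formula evaluates the integral.
  have hsmall : ∀ t, 0 < t → t < δ → ∫ x in U, (1 + t • fderiv ℝ g x).det ∂μ = μ.real U := by
    intro t ht htδ
    obtain ⟨h1, h2⟩ := hδ1 t ht htδ
    have hbij := bijective_add_smul hlip' ht.le h1
    -- Points outside the open ball are fixed. By injectivity no inner point is sent out, and by
    -- surjectivity every inner point is attained from inside.
    have himage : (fun x => x + t • indicator B g x) '' U = U := by
      have hout : ∀ x ∉ U, x + t • indicator B g x = x := by
        intro x hx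
        by_cases hxB : x ∈ B
        · have : ‖x‖ = R := le_antisymm (by simpa [B] using hxB) (by simpa [U] using hx)
          simp [hgdef, indicator_of_mem hxB, hid x this]
        · simp [indicator_of_notMem hxB]
      apply Subset.antisymm
      · rintro _ ⟨x, hx, rfl⟩
        by_contra hxU
        have h := hbij.1 (hout _ hxU)
        have h' : x + t • indicator B g x = x := h
        exact hxU (by simpa only [h'] using hx)
      · intro y hy
        obtain ⟨x, hx⟩ := hbij.2 y
        refine ⟨x, ?_, hx⟩
        by_contra hxU
        have hx' : x + t • indicator B g x = y := hx
        rw [hout x hxU] at hx'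
        exact hxU (hx' ▸ hy)
    have hderiv : ∀ x ∈ U, HasFDerivWithinAt (fun x => x + t • indicator B g x)
        (1 + t • fderiv ℝ g x) U x := by
      intro x hx
      have h : HasFDerivAt (fun x => x + t • g x) (1 + t • fderiv ℝ g x) x :=
        (hasFDerivAt_id x).add ((hg.differentiable one_ne_zero x).hasFDerivAt.const_smul t)
      refine h.hasFDerivWithinAt.congr (fun y hy => ?_) ?_
      · rw [indicator_of_mem (hUB hy)]
      · rw [indicator_of_mem (hUB hx)]
    have hcv := lintegral_abs_det_fderiv_eq_addHaar_image μ Metric.isOpen_ball.measurableSet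
      hderiv hbij.1.injOn
    rw [himage] at hcv
    have hpos : ∀ x ∈ U, 0 ≤ (1 + t • fderiv ℝ g x).det := by
      intro x hx
      refine (hηdet _ ?_).le
      rw [norm_smul, Real.norm_of_nonneg ht.le]
      exact (mul_le_mul_of_nonneg_left (hC x (hUB hx)) ht.le).trans_lt h2
    rw [Measure.real, ← hcv, integral_eq_lintegral_of_nonneg_ae]
    · congr 1
      refine setLIntegral_congr_fun Metric.isOpen_ball.measurableSet fun x hx => ?_
      simp only [abs_of_nonneg (hpos x hx)]
    · exact (ae_restrict_iff' Metric.isOpen_ball.measurableSet).2 (.of_forall hpos)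
    · exact (hint t).aestronglyMeasurable
  obtain ⟨N, t, w, ht, hw, hdetw⟩ := exists_weights_det_one_add (E := E) δ hδ
  -- The weights are independent of the linear map, so interpolation from small parameters to `t =
  -- 1` holds under the integral sign.
  have hone : ∫ x in U, (1 + fderiv ℝ g x).det ∂μ = μ.real U := by
    rw [integral_congr_ae (ae_of_all _ fun x => hdetw (fderiv ℝ g x)), integral_finsetSum _ fun i _ => (hint (t i)).const_mul _]
    simp_rw [integral_const_mul]
    rw [Finset.sum_congr rfl fun i _ => by rw [hsmall (t i) (ht i).1 (ht i).2], ← Finset.sum_mul,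
      hw, one_mul]
  have hzero : ∀ x, (1 + fderiv ℝ g x).det = 0 := by
    intro x
    have hDf : 1 + fderiv ℝ g x = fderiv ℝ f x := by
      have h : fderiv ℝ g x = fderiv ℝ f x - ContinuousLinearMap.id ℝ E :=
        ((hf.differentiable one_ne_zero x).hasFDerivAt.sub (hasFDerivAt_id x)).fderiv
      rw [h]
      exact add_sub_cancel _ _
    rw [hDf]
    by_contra hne
    -- As `‖f‖` is constant, `f(x)` is orthogonal to the range of the derivative. An invertible
    -- derivative would have `f(x)` in its range, forcing `f(x) = 0`.
    have horth : ∀ v, inner ℝ (f x) (fderiv ℝ f x v) = 0 := by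
      intro v
      have h1 : HasFDerivAt (fun y => inner ℝ (f y) (f y)) _ x :=
        (hf.differentiable one_ne_zero x).hasFDerivAt.inner ℝ
          (hf.differentiable one_ne_zero x).hasFDerivAt
      have h2 : (fun y => inner ℝ (f y) (f y)) = fun _ => R ^ 2 := by
        funext y
        rw [real_inner_self_eq_norm_sq, hfR]
      rw [h2] at h1
      have h3 := h1.unique (hasFDerivAt_const (R ^ 2) x)
      have h4 := congrArg (fun L : E →L[ℝ] ℝ => L v) h3
      simp only [ContinuousLinearMap.comp_apply, fderivInnerCLM_apply,
        ContinuousLinearMap.prod_apply, _root_.zero_apply] at h4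
      rw [real_inner_comm (f x)] at h4
      linarith [real_inner_comm (f x) (fderiv ℝ f x v)]
    have hunit : IsUnit (LinearMap.det (fderiv ℝ f x : E →ₗ[ℝ] E)) := isUnit_iff_ne_zero.2 hne
    have hsurj := (LinearMap.equivOfIsUnitDet hunit).surjective
    obtain ⟨v, hv⟩ := hsurj (f x)
    have hv' : fderiv ℝ f x v = f x := by
      rwa [LinearMap.equivOfIsUnitDet_apply] at hv
    have h := horth v
    rw [hv', real_inner_self_eq_norm_sq, hfR] at h
    exact hR.ne' (by simpa using h)
  simp_rw [hzero] at hone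
  rw [integral_zero] at hone
  have : 0 < μ.real U := ENNReal.toReal_pos (Metric.measure_ball_pos μ 0 hR).ne'
    Metric.isBounded_ball.measure_lt_top.ne
  exact this.ne hone

/-- A continuous map that is the identity outside of a ball has a zero. -/
theorem exists_zero_of_eq_id {K : E → E} (hK : Continuous K) {ρ : ℝ} (hρ : 0 < ρ)
    (hid : ∀ x, ρ ≤ ‖x‖ → K x = x) : ∃ x, K x = 0 := by
  by_contra! hne
  have hS : IsClosed {x : E | ρ + 1 ≤ ‖x‖} := isClosed_le continuous_const continuous_norm
  have hUo : IsOpen {x : E | ρ < ‖x‖} := isOpen_lt continuous_const continuous_norm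
  have hU : {x : E | ρ < ‖x‖} ∈ 𝓝ˢ {x : E | ρ + 1 ≤ ‖x‖} :=
    hUo.mem_nhdsSet.2 fun x (hx : ρ + 1 ≤ ‖x‖) => show ρ < ‖x‖ by linarith
  -- The tolerance `‖K x‖` keeps the smooth approximation away from zero, while agreement with `K`
  -- far out makes the normalized map the identity on the sphere of radius `ρ + 1`.
  obtain ⟨F, hF, hFK, hFS, -⟩ := hK.exists_contDiff_approx_and_eqOn 1 (ε := fun x => ‖K x‖)
    hK.norm (fun x => norm_pos_iff.2 (hne x)) hS hU
    (contDiffOn_id.congr fun x (hx : ρ < ‖x‖) => hid x hx.le)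
  have hF0 : ∀ x, F x ≠ 0 := by
    intro x hx
    have := hFK x
    rw [hx, dist_zero_left] at this
    exact lt_irrefl _ this
  have hR : 0 < ρ + 1 := by linarith
  refine not_retraction (f := fun x => ((ρ + 1) * ‖F x‖⁻¹) • F x) ?_ hR (fun x => ?_) fun x hx => ?_
  · have hF1 : ContDiff ℝ 1 F := by exact_mod_cast hF
    exact (contDiff_const.mul ((hF1.norm ℝ hF0).inv fun x => norm_ne_zero_iff.2 (hF0 x))).smul hF1
  · rw [norm_smul, norm_mul, norm_inv, norm_norm, Real.norm_of_nonneg hR.le, mul_assoc,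
      inv_mul_cancel₀ (norm_ne_zero_iff.2 (hF0 x)), mul_one]
  · have hFx : F x = x := by rw [hFS hx.ge, hid x (by linarith)]
    simp only [hFx]
    rw [hx, mul_inv_cancel₀ hR.ne', one_smul]

/-- A continuous map that points outwards on a sphere has a zero. -/
theorem exists_zero_of_inner_pos {H : E → E} (hH : Continuous H) {R : ℝ} (hR : 0 < R)
    (hpos : ∀ x, ‖x‖ = R → 0 < inner ℝ (H x) x) : ∃ x, H x = 0 := by
  have hmax : ∀ x : E, 0 < max R ‖x‖ := fun x => hR.trans_le (le_max_left _ _)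
  let π : E → E := fun x => (R * (max R ‖x‖)⁻¹) • x
  have hπ : Continuous π := by
    have : Continuous fun x : E => (max R ‖x‖)⁻¹ :=
      (continuous_const.max continuous_norm).inv₀ fun x => (hmax x).ne'
    fun_prop
  -- The cutoff `θ` is `0` on the ball of radius `R` and `1` outside the ball of radius `2R`, and
  -- `π` is the radial projection onto the ball. Blending `H ∘ π` with the identity creates no zero
  -- outside the ball, because both pair positively with `x` there.
  let θ : E → ℝ := fun x => max 0 (min 1 ((‖x‖ - R) / R))
  have hθ : Continuous θ := by fun_prop
  have hθ0 : ∀ x, 0 ≤ θ x := fun x => le_max_left _ _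
  have hθ1 : ∀ x, θ x ≤ 1 := fun x => max_le zero_le_one (min_le_left _ _)
  obtain ⟨x, hx⟩ := exists_zero_of_eq_id
    (K := fun x => (1 - θ x) • H (π x) + θ x • x) (ρ := 2 * R) (by fun_prop) (by linarith)
    fun x hx => by
      have : θ x = 1 := by
        have h1 : 1 ≤ (‖x‖ - R) / R := by
          rw [le_div_iff₀ hR]; linarith
        simp [θ, min_eq_left h1]
      simp [this]
  rcases le_or_gt ‖x‖ R with h | h
  · have hθx : θ x = 0 := by
      have : (‖x‖ - R) / R ≤ 0 := div_nonpos_of_nonpos_of_nonneg (by linarith) hR.le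
      simp only [θ]
      exact max_eq_left ((min_le_right _ _).trans this)
    have hπx : π x = x := by
      simp only [π]
      rw [max_eq_left h, mul_inv_cancel₀ hR.ne', one_smul]
    refine ⟨x, ?_⟩
    simpa [hθx, hπx] using hx
  · exfalso
    have hπx : π x = (R * ‖x‖⁻¹) • x := by
      simp only [π]
      rw [max_eq_right h.le]
    have hx0 : 0 < ‖x‖ := hR.trans h
    have hs : 0 < R * ‖x‖⁻¹ := by positivity
    have hn : ‖π x‖ = R := by
      rw [hπx, norm_smul, Real.norm_of_nonneg hs.le, mul_assoc, inv_mul_cancel₀ hx0.ne', mul_one]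
    have h1 := hpos (π x) hn
    have h2 : 0 < inner ℝ (H (π x)) x := by
      rw [hπx, inner_smul_right, ← hπx] at h1
      exact pos_of_mul_pos_right h1 hs.le
    have h3 : (1 - θ x) * inner ℝ (H (π x)) x + θ x * ‖x‖ ^ 2 = 0 := by
      have := congrArg (fun y => inner ℝ y x) hx
      simpa [inner_add_left, inner_smul_left] using this
    have hθx := hθ0 x
    rcases eq_or_lt_of_le (hθ1 x) with h4 | h4
    · rw [h4] at h3
      nlinarith [sq_pos_of_pos hx0]
    · nlinarith [mul_pos (sub_pos.2 h4) h2, mul_nonneg hθx (sq_nonneg ‖x‖)]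

/-- Solvability of coercive variational equations in finite dimension. -/
theorem exists_forall_eq_zero (Φ : E → E →ₗ[ℝ] ℝ) (hΦ : ∀ z, Continuous fun u => Φ u z) {R : ℝ}
    (hR : 0 < R) (hpos : ∀ u, ‖u‖ = R → 0 < Φ u u) : ∃ u, ∀ z, Φ u z = 0 := by
  let b := stdOrthonormalBasis ℝ E
  -- `H u` is the Riesz representative of the functional `Φ u`.
  let H : E → E := fun u => ∑ i, Φ u (b i) • b i
  have hinner : ∀ u z, inner ℝ (H u) z = Φ u z := by
    intro u z
    conv_rhs => rw [← b.sum_repr' z]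
    simp only [H, sum_inner, inner_smul_left, map_sum, map_smul, smul_eq_mul]
    exact Finset.sum_congr rfl fun i _ => by simp [mul_comm]
  obtain ⟨u, hu⟩ := exists_zero_of_inner_pos (H := H)
    (continuous_finsetSum _ fun i _ => (hΦ (b i)).smul continuous_const) hR
    fun u hu => by rw [hinner]; exact hpos u hu
  exact ⟨u, fun z => by rw [← hinner, hu, inner_zero_left]⟩

end Inner

/-! ### Bounded functions in variable Lebesgue spaces -/

section VariableLebesgue

variable {α F : Type*} [MeasurableSpace α] [NormedAddCommGroup F] [NormedSpace ℝ F]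
  {μ : Measure α} {p : α → ℝ} {u v : α → F}

omit [NormedSpace ℝ F] in
theorem modular_congr_ae (h : u =ᵐ[μ] v) : modular μ p u = modular μ p v :=
  lintegral_congr_ae (h.mono fun x hx => by simp only [hx])

theorem luxNorm_congr_ae (h : u =ᵐ[μ] v) : luxNorm μ p u = luxNorm μ p v := by
  have : ∀ lam : ℝ, modular μ p (fun x => lam⁻¹ • u x) = modular μ p (fun x => lam⁻¹ • v x) :=
    fun lam => modular_congr_ae (h.mono fun x hx => by simp only [hx])
  simp only [luxNorm, this]

-- Replacing the bound by `max 1 M` makes powers increasing in the exponent. The result depends on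
-- the exponent only through `C`, which later makes the bounds uniform in time.
omit [NormedSpace ℝ F] in
theorem modular_le_of_bound {C M : ℝ} (hp : ∀ᵐ x ∂μ, 1 ≤ p x ∧ p x ≤ C)
    (hu : ∀ᵐ x ∂μ, ‖u x‖ ≤ M) :
    modular μ p u ≤ ENNReal.ofReal (max 1 M ^ C) * μ univ := by
  rw [← lintegral_const]
  refine lintegral_mono_ae ?_
  filter_upwards [hp, hu] with x hpx hux
  refine ENNReal.ofReal_le_ofReal ?_
  exact (Real.rpow_le_rpow (norm_nonneg _) (hux.trans (le_max_right _ _))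
    (zero_le_one.trans hpx.1)).trans (Real.rpow_le_rpow_of_exponent_le (le_max_left _ _) hpx.2)

omit [NormedSpace ℝ F] in
theorem modular_toReal_le_of_bound [IsFiniteMeasure μ] {C M : ℝ}
    (hp : ∀ᵐ x ∂μ, 1 ≤ p x ∧ p x ≤ C) (hu : ∀ᵐ x ∂μ, ‖u x‖ ≤ M) :
    (modular μ p u).toReal ≤ max 1 M ^ C * μ.real univ := by
  have h := ENNReal.toReal_mono
    (ENNReal.mul_ne_top ENNReal.ofReal_ne_top (measure_ne_top μ univ)) (modular_le_of_bound hp hu)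
  rwa [ENNReal.toReal_mul, ENNReal.toReal_ofReal (by positivity)] at h

omit [NormedSpace ℝ F] in
theorem IsBoundedExponent.memVarLp [IsFiniteMeasure μ] (hp : IsBoundedExponent μ p) {M : ℝ}
    (hum : AEStronglyMeasurable u μ) (hu : ∀ᵐ x ∂μ, ‖u x‖ ≤ M) : MemVarLp μ p u := by
  obtain ⟨C, hC⟩ := hp.bounded
  refine ⟨hum, (modular_le_of_bound (hp.one_le.and hC) hu).trans_lt ?_⟩
  exact ENNReal.mul_lt_top ENNReal.ofReal_lt_top (measure_lt_top μ univ)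

/-- Bounded convergence in the Luxembourg norm. -/
theorem IsBoundedExponent.tendsto_luxNorm [IsFiniteMeasure μ] (hp : IsBoundedExponent μ p)
    {h : ℕ → α → F} {M : ℝ} (hm : ∀ k, AEStronglyMeasurable (h k) μ)
    (hM : ∀ k, ∀ᵐ x ∂μ, ‖h k x‖ ≤ M) (h0 : ∀ᵐ x ∂μ, Tendsto (fun k => h k x) atTop (𝓝 0)) :
    Tendsto (fun k => luxNorm μ p (h k)) atTop (𝓝 0) := by
  -- The norm is at most `lam` as soon as the modular of `h k / lam` is at most `1`, and for fixed
  -- `lam` that modular tends to zero by dominated convergence. Boundedness of the exponent provides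
  -- the majorant; no continuity of it is involved.
  have key : ∀ lam : ℝ, 0 < lam → ∀ᶠ k in atTop, luxNorm μ p (h k) ≤ ENNReal.ofReal lam := by
    intro lam hlam
    obtain ⟨C, hC⟩ := hp.bounded
    have hlim : Tendsto (fun k => modular μ p (fun x => lam⁻¹ • h k x)) atTop (𝓝 0) := by
      have : (0 : ℝ≥0∞) = ∫⁻ _, 0 ∂μ := by simp
      rw [this]
      refine tendsto_lintegral_of_dominated_convergence'
        (fun _ => ENNReal.ofReal (max 1 (lam⁻¹ * M) ^ C)) (fun k => ?_) (fun k => ?_) ?_ ?_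
      · exact (((hm k).const_smul lam⁻¹).norm.aemeasurable.pow hp.aemeasurable).ennreal_ofReal
      · filter_upwards [hp.one_le, hC, hM k] with x h1 h2 h3
        refine ENNReal.ofReal_le_ofReal ?_
        have h4 : ‖lam⁻¹ • h k x‖ ≤ max 1 (lam⁻¹ * M) := by
          rw [norm_smul, Real.norm_of_nonneg (by positivity)]
          exact le_max_of_le_right (by gcongr)
        exact (Real.rpow_le_rpow (norm_nonneg _) h4 (zero_le_one.trans h1)).trans
          (Real.rpow_le_rpow_of_exponent_le (le_max_left _ _) h2)
      · rw [lintegral_const]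
        exact ENNReal.mul_ne_top ENNReal.ofReal_ne_top (measure_ne_top μ univ)
      · filter_upwards [hp.one_le, h0] with x h1 h2
        have h3 : Tendsto (fun k => ‖lam⁻¹ • h k x‖ ^ p x) atTop (𝓝 0) := by
          have h4 := ((h2.const_smul lam⁻¹).norm).rpow_const
            (p := p x) (Or.inr (zero_le_one.trans h1))
          rwa [smul_zero, norm_zero, Real.zero_rpow (by linarith)] at h4
        simpa using ENNReal.tendsto_ofReal h3
    filter_upwards [hlim.eventually (Iic_mem_nhds zero_lt_one)] with k hk
    exact iInf₂_le lam ⟨hlam, hk⟩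
  rw [ENNReal.tendsto_nhds_zero]
  intro ε hε
  obtain ⟨r, hr0, hr⟩ := ENNReal.lt_iff_exists_nnreal_btwn.1 hε
  filter_upwards [key r (by exact_mod_cast hr0)] with k hk
  exact hk.trans (by simpa using hr.le)

/-- Uniform convergence in the Luxembourg norm. -/
theorem IsBoundedExponent.tendsto_luxNorm_of_bound [IsFiniteMeasure μ]
    (hp : IsBoundedExponent μ p) {h : ℕ → α → F} {a : ℕ → ℝ} (ha : Tendsto a atTop (𝓝 0))
    (hm : ∀ k, AEStronglyMeasurable (h k) μ) (hM : ∀ k, ∀ᵐ x ∂μ, ‖h k x‖ ≤ a k) :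
    Tendsto (fun k => luxNorm μ p (h k)) atTop (𝓝 0) := by
  obtain ⟨M, hM'⟩ := ha.bddAbove_range
  refine hp.tendsto_luxNorm (M := M) hm
    (fun k => (hM k).mono fun x hx => hx.trans (hM' (mem_range_self k))) ?_
  filter_upwards [ae_all_iff.2 hM] with x hx
  exact squeeze_zero_norm hx ha

theorem isBoundedExponent_const (c : ℝ) (hc : 1 ≤ c) : IsBoundedExponent μ fun _ => c :=
  ⟨aemeasurable_const, ae_of_all _ fun _ => hc, c, ae_of_all _ fun _ => le_rfl⟩

end VariableLebesgue

/-! ### Weak gradients -/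

section WeakGradients

variable {d : ℕ} {Ω : Set (Pt d)}

/-- Two functions that have the same integrals against test functions coincide. -/
theorem ae_eq_of_forall_test {U : Set (Pt d)} (hU : IsOpen U) {f g : Pt d → ℝ}
    (hf : LocallyIntegrableOn f U) (hg : LocallyIntegrableOn g U)
    (h : ∀ φ : Pt d → ℝ, ContDiff ℝ ∞ φ → HasCompactSupport φ → tsupport φ ⊆ U →
      ∫ x, (f x - g x) * φ x = 0) :
    ∀ᵐ x, x ∈ U → f x = g x := by
  have := hU.ae_eq_zero_of_integral_contDiff_smul_eq_zero (hf.sub hg) fun φ h1 h2 h3 => by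
    rw [← h φ h1 h2 h3]
    exact integral_congr_ae (ae_of_all _ fun x => by simp [mul_comm])
  filter_upwards [this] with x hx hxU
  simpa [sub_eq_zero] using hx hxU

theorem LocallyIntegrableOn.apply {ι : Type*} [Fintype ι] {f : Pt d → EuclideanSpace ℝ ι}
    {U : Set (Pt d)} (hf : LocallyIntegrableOn f U) (i : ι) :
    LocallyIntegrableOn (fun x => f x i) U := by
  intro x hx
  obtain ⟨s, hs, hfs⟩ := hf x hx
  exact ⟨s, hs, (EuclideanSpace.proj (𝕜 := ℝ) i).integrable_comp hfs⟩

theorem Integrable.euclidean_apply {α ι : Type*} [MeasurableSpace α] {μ : Measure α} [Fintype ι]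
    {f : α → EuclideanSpace ℝ ι} (hf : Integrable f μ) (i : ι) : Integrable (fun x => f x i) μ :=
  (EuclideanSpace.proj (𝕜 := ℝ) i).integrable_comp hf

/-- The product of an integrable function and a continuous function with compact support. -/
theorem Integrable.mul_test {μ : Measure (Pt d)} {f φ : Pt d → ℝ} (hf : Integrable f μ)
    (hφ : Continuous φ) (hφc : HasCompactSupport φ) : Integrable (fun x => f x * φ x) μ := by
  obtain ⟨C, hC⟩ := hφ.bounded_above_of_compact_support hφc
  exact hf.mul_bdd hφ.aestronglyMeasurable (ae_of_all _ hC)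

theorem continuous_fderiv_apply {φ : Pt d → ℝ} (hφ : ContDiff ℝ ∞ φ) (v : Pt d) :
    Continuous fun x => fderiv ℝ φ x v :=
  (hφ.continuous_fderiv (by simp)).clm_apply continuous_const

theorem hasCompactSupport_fderiv_apply {φ : Pt d → ℝ} (hφ : HasCompactSupport φ) (v : Pt d) :
    HasCompactSupport fun x => fderiv ℝ φ x v :=
  hφ.fderiv_apply ℝ v

/-- An integral over `Ω` against a function supported in `Ω` is an integral over the space. -/
theorem setIntegral_mul_test {f φ : Pt d → ℝ} (hφ : tsupport φ ⊆ Ω) :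
    ∫ x in Ω, f x * φ x = ∫ x, f x * φ x :=
  setIntegral_eq_integral_of_forall_compl_eq_zero fun x hx => by
    rw [image_eq_zero_of_notMem_tsupport fun h => hx (hφ h), mul_zero]

theorem HasWeakSymGrad.unique (hΩ : IsOpen Ω) {u : VF Ω} {G H : MF Ω} (hG : HasWeakSymGrad u G)
    (hH : HasWeakSymGrad u H) : G = H := by
  refine AEEqFun.ext ?_
  have key : ∀ ij : Fin d × Fin d, ∀ᵐ x ∂volume.restrict Ω, G x ij = H x ij := by
    rintro ⟨i, j⟩
    rw [ae_restrict_iff' hΩ.measurableSet]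
    refine ae_eq_of_forall_test hΩ (LocallyIntegrableOn.apply hG.2.1 _)
      (LocallyIntegrableOn.apply hH.2.1 _) fun φ h1 h2 h3 => ?_
    have hint : ∀ {K : MF Ω}, LocallyIntegrableOn K Ω → Integrable fun x => K x (i, j) * φ x := by
      intro K hK
      have h4 : IntegrableOn (fun x => K x (i, j)) (tsupport φ) :=
        ((LocallyIntegrableOn.apply hK (i, j)).integrableOn_compact_subset h3 h2)
      obtain ⟨C, hC⟩ := h1.continuous.bounded_above_of_compact_support h2
      have h5 := h4.mul_bdd h1.continuous.aestronglyMeasurable (ae_of_all _ hC)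
      refine (integrableOn_iff_integrable_of_support_subset ?_).1 h5
      intro x hx
      exact subset_tsupport φ (right_ne_zero_of_mul hx)
    simp_rw [sub_mul]
    rw [integral_sub (hint hG.2.1) (hint hH.2.1), ← setIntegral_mul_test h3,
      ← setIntegral_mul_test h3, hG.2.2 φ h1 h2 h3, hH.2.2 φ h1 h2 h3, sub_self]
  filter_upwards [ae_all_iff.2 key] with x hx
  ext ij
  exact hx ij

/-- `symGrad` is an arbitrary choice among the weak symmetric gradients; uniqueness allows it to be
computed from any of them. -/
theorem HasWeakSymGrad.symGrad_eq (hΩ : IsOpen Ω) {u : VF Ω} {G : MF Ω}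
    (hG : HasWeakSymGrad u G) : symGrad u = G := by
  have h : ∃ G, HasWeakSymGrad u G := ⟨G, hG⟩
  rw [symGrad, dif_pos h]
  exact h.choose_spec.unique hΩ hG

/-- The symmetric part of a matrix. -/
noncomputable def symPart (d : ℕ) : Mat d →L[ℝ] Mat d :=
  LinearMap.toContinuousLinearMap
    { toFun := fun A => WithLp.toLp 2 fun ij => (1 / 2 : ℝ) * (A (ij.1, ij.2) + A (ij.2, ij.1))
      map_add' := fun A B => by ext ij; simp; ring
      map_smul' := fun c A => by ext ij; simp; ring }

@[simp]
theorem symPart_apply (A : Mat d) (i j : Fin d) :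
    symPart d A (i, j) = (1 / 2 : ℝ) * (A (i, j) + A (j, i)) := rfl

/-- The symmetric part of a matrix field. -/
noncomputable def symField (G : MF Ω) : MF Ω := AEEqFun.comp _ (symPart d).continuous G

theorem coeFn_symField (G : MF Ω) :
    symField G =ᵐ[volume.restrict Ω] fun x => symPart d (G x) :=
  AEEqFun.coeFn_comp _ _ _

/-- `G` is the weak gradient, and the extensions by zero of `u` and `G` satisfy the integration by
parts formula on the whole space. -/
def HasZeroExtGrad (u : VF Ω) (G : MF Ω) : Prop :=
  Integrable u (volume.restrict Ω) ∧ Integrable G (volume.restrict Ω) ∧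
    ∀ φ : Pt d → ℝ, ContDiff ℝ ∞ φ → HasCompactSupport φ → ∀ i j : Fin d,
      ∫ x in Ω, G x (i, j) * φ x = - ∫ x in Ω, u x i * fderiv ℝ φ x (unitVec j)

theorem HasZeroExtGrad.integrable_grad_mul {u : VF Ω} {G : MF Ω} (h : HasZeroExtGrad u G)
    {φ : Pt d → ℝ} (hφ : ContDiff ℝ ∞ φ) (hφc : HasCompactSupport φ) (ij : Fin d × Fin d) :
    IntegrableOn (fun x => G x ij * φ x) Ω :=
  Integrable.mul_test (Integrable.euclidean_apply h.2.1 ij) hφ.continuous hφc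

theorem HasZeroExtGrad.integrable_mul_fderiv {u : VF Ω} {G : MF Ω} (h : HasZeroExtGrad u G)
    {φ : Pt d → ℝ} (hφ : ContDiff ℝ ∞ φ) (hφc : HasCompactSupport φ) (i j : Fin d) :
    IntegrableOn (fun x => u x i * fderiv ℝ φ x (unitVec j)) Ω :=
  Integrable.mul_test (Integrable.euclidean_apply h.1 i) (continuous_fderiv_apply hφ _)
    (hasCompactSupport_fderiv_apply hφc _)

theorem HasZeroExtGrad.add {u v : VF Ω} {G H : MF Ω} (hu : HasZeroExtGrad u G)
    (hv : HasZeroExtGrad v H) : HasZeroExtGrad (u + v) (G + H) := by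
  refine ⟨(hu.1.add hv.1).congr (AEEqFun.coeFn_add u v).symm,
    (hu.2.1.add hv.2.1).congr (AEEqFun.coeFn_add G H).symm, fun φ h1 h2 i j => ?_⟩
  have e1 : ∫ x in Ω, (G + H) x (i, j) * φ x
      = ∫ x in Ω, (G x (i, j) * φ x + H x (i, j) * φ x) :=
    integral_congr_ae ((AEEqFun.coeFn_add G H).mono fun x hx => by
      simp only [hx, Pi.add_apply, PiLp.add_apply, add_mul])
  have e2 : ∫ x in Ω, (u + v) x i * fderiv ℝ φ x (unitVec j)
      = ∫ x in Ω, (u x i * fderiv ℝ φ x (unitVec j) + v x i * fderiv ℝ φ x (unitVec j)) :=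
    integral_congr_ae ((AEEqFun.coeFn_add u v).mono fun x hx => by
      simp only [hx, Pi.add_apply, PiLp.add_apply, add_mul])
  rw [e1, e2, integral_add (hu.integrable_grad_mul h1 h2 _) (hv.integrable_grad_mul h1 h2 _),
    integral_add (hu.integrable_mul_fderiv h1 h2 _ _) (hv.integrable_mul_fderiv h1 h2 _ _),
    hu.2.2 φ h1 h2, hv.2.2 φ h1 h2, neg_add]

theorem HasZeroExtGrad.smul {u : VF Ω} {G : MF Ω} (hu : HasZeroExtGrad u G) (c : ℝ) :
    HasZeroExtGrad (c • u) (c • G) := by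
  refine ⟨(hu.1.smul c).congr (AEEqFun.coeFn_smul c u).symm,
    (hu.2.1.smul c).congr (AEEqFun.coeFn_smul c G).symm, fun φ h1 h2 i j => ?_⟩
  have e1 : ∫ x in Ω, (c • G) x (i, j) * φ x = ∫ x in Ω, c * (G x (i, j) * φ x) :=
    integral_congr_ae ((AEEqFun.coeFn_smul c G).mono fun x hx => by
      simp only [hx, Pi.smul_apply, PiLp.smul_apply, smul_eq_mul, mul_assoc])
  have e2 : ∫ x in Ω, (c • u) x i * fderiv ℝ φ x (unitVec j)
      = ∫ x in Ω, c * (u x i * fderiv ℝ φ x (unitVec j)) :=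
    integral_congr_ae ((AEEqFun.coeFn_smul c u).mono fun x hx => by
      simp only [hx, Pi.smul_apply, PiLp.smul_apply, smul_eq_mul, mul_assoc])
  rw [e1, e2, integral_const_mul, integral_const_mul, hu.2.2 φ h1 h2, mul_neg]

theorem HasZeroExtGrad.sub {u v : VF Ω} {G H : MF Ω} (hu : HasZeroExtGrad u G)
    (hv : HasZeroExtGrad v H) : HasZeroExtGrad (u - v) (G - H) := by
  have h := hu.add (hv.smul (-1))
  have e1 : u + (-1 : ℝ) • v = u - v := by module
  have e2 : G + (-1 : ℝ) • H = G - H := by module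
  rwa [e1, e2] at h

theorem HasZeroExtGrad.hasWeakSymGrad {u : VF Ω} {G : MF Ω} (h : HasZeroExtGrad u G) :
    HasWeakSymGrad u (symField G) := by
  have hs : Integrable (symField G) (volume.restrict Ω) :=
    ((symPart d).integrable_comp h.2.1).congr (coeFn_symField G).symm
  refine ⟨IntegrableOn.locallyIntegrableOn h.1, IntegrableOn.locallyIntegrableOn hs,
    fun φ h1 h2 _ i j => ?_⟩
  have e1 : ∫ x in Ω, symField G x (i, j) * φ x
      = ∫ x in Ω, (1 / 2 : ℝ) * (G x (i, j) * φ x + G x (j, i) * φ x) :=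
    integral_congr_ae ((coeFn_symField G).mono fun x hx => by
      simp only [hx, symPart_apply]; ring)
  rw [e1, integral_const_mul,
    integral_add (h.integrable_grad_mul h1 h2 _) (h.integrable_grad_mul h1 h2 _),
    integral_add (h.integrable_mul_fderiv h1 h2 _ _) (h.integrable_mul_fderiv h1 h2 _ _),
    h.2.2 φ h1 h2, h.2.2 φ h1 h2]
  ring

theorem HasZeroExtGrad.symGrad_eq (hΩ : IsOpen Ω) {u : VF Ω} {G : MF Ω}
    (h : HasZeroExtGrad u G) : symGrad u = symField G :=
  h.hasWeakSymGrad.symGrad_eq hΩ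

theorem HasZeroExtGrad.symGrad_ae_eq (hΩ : IsOpen Ω) {u : VF Ω} {G : MF Ω}
    (h : HasZeroExtGrad u G) : symGrad u =ᵐ[volume.restrict Ω] fun x => symPart d (G x) := by
  rw [h.symGrad_eq hΩ]
  exact coeFn_symField G

theorem HasZeroExtGrad.hasWeakGrad {u : VF Ω} {G : MF Ω} (h : HasZeroExtGrad u G) :
    HasWeakGrad u G :=
  ⟨IntegrableOn.locallyIntegrableOn h.1, IntegrableOn.locallyIntegrableOn h.2.1,
    fun φ h1 h2 _ i j => h.2.2 φ h1 h2 i j⟩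

/-! ### Test fields -/

theorem continuous_classicalGrad {φ : Pt d → Pt d} (hφ : ContDiff ℝ ∞ φ) :
    Continuous (classicalGrad φ) := by
  have h : ∀ ij : Fin d × Fin d, Continuous fun x => fderiv ℝ φ x (unitVec ij.2) ij.1 := by
    intro ij
    have h1 : Continuous fun x => fderiv ℝ φ x (unitVec ij.2) :=
      (hφ.continuous_fderiv (by simp)).clm_apply continuous_const
    exact (EuclideanSpace.proj (𝕜 := ℝ) ij.1).continuous.comp h1
  exact (PiLp.continuous_toLp 2 _).comp (continuous_pi h)

theorem classicalGrad_eq_zero {φ : Pt d → Pt d} {x : Pt d} (hx : x ∉ tsupport φ) :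
    classicalGrad φ x = 0 := by
  have h : fderiv ℝ φ x = 0 := by
    by_contra hne
    exact hx (support_fderiv_subset ℝ hne)
  ext ij
  simp [classicalGrad, h]

theorem fderiv_apply_coord {φ : Pt d → Pt d} {x : Pt d} (hφ : DifferentiableAt ℝ φ x)
    (v : Pt d) (i : Fin d) : fderiv ℝ (fun y => φ y i) x v = fderiv ℝ φ x v i := by
  have h := ((EuclideanSpace.proj (𝕜 := ℝ) i).hasFDerivAt.comp x hφ.hasFDerivAt).fderiv
  have h' : fderiv ℝ (fun y => φ y i) x = _ := h
  rw [h']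
  rfl

theorem hasCompactSupport_classicalGrad {φ : Pt d → Pt d} (hφ : HasCompactSupport φ) :
    HasCompactSupport (classicalGrad φ) :=
  HasCompactSupport.of_support_subset_isCompact hφ fun x hx => by
    by_contra h
    exact hx (classicalGrad_eq_zero h)

/-- A test field as a field on `Ω`. -/
noncomputable def testVF (Ω : Set (Pt d)) {φ : Pt d → Pt d} (hφ : IsTestField Ω φ) : VF Ω :=
  AEEqFun.mk φ hφ.1.continuous.aestronglyMeasurable

/-- The gradient of a test field as a field on `Ω`. -/
noncomputable def testMF (Ω : Set (Pt d)) {φ : Pt d → Pt d} (hφ : IsTestField Ω φ) : MF Ω :=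
  AEEqFun.mk (classicalGrad φ) (continuous_classicalGrad hφ.1).aestronglyMeasurable

theorem coeFn_testVF {φ : Pt d → Pt d} (hφ : IsTestField Ω φ) :
    testVF Ω hφ =ᵐ[volume.restrict Ω] φ := AEEqFun.coeFn_mk _ _

theorem coeFn_testMF {φ : Pt d → Pt d} (hφ : IsTestField Ω φ) :
    testMF Ω hφ =ᵐ[volume.restrict Ω] classicalGrad φ := AEEqFun.coeFn_mk _ _

/-- A test field and its gradient vanish off `Ω`, so the integrals over `Ω` are integrals over the
whole space, where integration by parts has no boundary term. -/
theorem IsTestField.hasZeroExtGrad {φ : Pt d → Pt d} (hφ : IsTestField Ω φ) :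
    HasZeroExtGrad (testVF Ω hφ) (testMF Ω hφ) := by
  refine ⟨((hφ.1.continuous.integrable_of_hasCompactSupport hφ.2.1).restrict).congr
    (coeFn_testVF hφ).symm, (((continuous_classicalGrad hφ.1).integrable_of_hasCompactSupport
    (hasCompactSupport_classicalGrad hφ.2.1)).restrict).congr (coeFn_testMF hφ).symm,
    fun ψ h1 h2 i j => ?_⟩
  have hd : ContDiff ℝ ∞ fun x => φ x i :=
    (EuclideanSpace.proj (𝕜 := ℝ) i).contDiff.comp hφ.1
  have hdc : HasCompactSupport fun x => φ x i :=
    hφ.2.1.comp_left (g := fun y : Pt d => y i) rfl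
  have e1 : ∫ x in Ω, testMF Ω hφ x (i, j) * ψ x
      = ∫ x, fderiv ℝ (fun y => φ y i) x (unitVec j) * ψ x := by
    refine Eq.trans ?_ (setIntegral_eq_integral_of_forall_compl_eq_zero (s := Ω) ?_)
    · exact integral_congr_ae ((coeFn_testMF hφ).mono fun x hx => by
        simp only [hx]
        rw [fderiv_apply_coord (hφ.1.differentiable (by simp) x)]
        rfl)
    · intro x hx
      rw [fderiv_apply_coord (hφ.1.differentiable (by simp) x)]
      have := classicalGrad_eq_zero fun h => hx (hφ.2.2 h)
      have h3 : classicalGrad φ x (i, j) = 0 := by rw [this]; rfl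
      have h4 : fderiv ℝ φ x (unitVec j) i = 0 := h3
      rw [h4, zero_mul]
  have e2 : ∫ x in Ω, testVF Ω hφ x i * fderiv ℝ ψ x (unitVec j)
      = ∫ x, φ x i * fderiv ℝ ψ x (unitVec j) := by
    refine Eq.trans ?_ (setIntegral_eq_integral_of_forall_compl_eq_zero (s := Ω) ?_)
    · exact integral_congr_ae ((coeFn_testVF hφ).mono fun x hx => by simp only [hx])
    · intro x hx
      rw [image_eq_zero_of_notMem_tsupport fun h => hx (hφ.2.2 h)]
      simp
  rw [e1, e2, integral_mul_fderiv_eq_neg_fderiv_mul_of_integrable, neg_neg]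
  · exact Integrable.mul_test ((continuous_fderiv_apply hd _).integrable_of_hasCompactSupport
      (hasCompactSupport_fderiv_apply hdc _)) h1.continuous h2
  · exact Integrable.mul_test (hd.continuous.integrable_of_hasCompactSupport hdc)
      (continuous_fderiv_apply h1 _) (hasCompactSupport_fderiv_apply h2 _)
  · exact Integrable.mul_test (hd.continuous.integrable_of_hasCompactSupport hdc) h1.continuous h2
  · exact fun x _ => hd.differentiable (by simp) x
  · exact fun x _ => h1.differentiable (by simp) x

/-! ### The space `W^{1,1}_0` -/

theorem enorm_integral_mul_le {α ι : Type*} [MeasurableSpace α] {μ : Measure α} [Fintype ι]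
    (h : α → EuclideanSpace ℝ ι) (i : ι) {φ : α → ℝ} {M : ℝ≥0} (hM : ∀ x, ‖φ x‖ ≤ M) :
    ‖∫ x, h x i * φ x ∂μ‖ₑ ≤ M * eLpNorm h 1 μ := by
  refine (enorm_integral_le_lintegral_enorm _).trans ?_
  rw [eLpNorm_one_eq_lintegral_enorm, ← lintegral_const_mul' _ _ ENNReal.coe_ne_top]
  refine lintegral_mono fun x => ?_
  rw [enorm_mul, mul_comm]
  refine mul_le_mul' ?_ ?_
  · exact ENNReal.coe_le_coe.2 (show ‖φ x‖₊ ≤ M from hM x)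
  · exact ENNReal.coe_le_coe.2 (show ‖h x i‖₊ ≤ ‖h x‖₊ from PiLp.norm_apply_le (h x) i)

/-- The formula without boundary term holds for test fields, and both of its sides are continuous
under `L¹` convergence of field and gradient because `ψ` and its derivatives are bounded. This is
how zero boundary values enter the argument. -/
theorem MemW110.hasZeroExtGrad {u : VF Ω} {G : MF Ω} (hu : MemLp u 1 (volume.restrict Ω))
    (hG : MemLp G 1 (volume.restrict Ω))
    (h : ∀ δ : ℝ≥0∞, 0 < δ → ∃ φ : Pt d → Pt d, IsTestField Ω φ ∧
      eLpNorm (fun x => u x - φ x) 1 (volume.restrict Ω) +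
        eLpNorm (fun x => G x - classicalGrad φ x) 1 (volume.restrict Ω) < δ) :
    HasZeroExtGrad u G := by
  rw [memLp_one_iff_integrable] at hu hG
  refine ⟨hu, hG, fun ψ h1 h2 i j => ?_⟩
  rw [← sub_eq_zero, sub_neg_eq_add, ← enorm_eq_zero]
  obtain ⟨M₁, hM₁⟩ := h1.continuous.bounded_above_of_compact_support h2
  obtain ⟨M₂, hM₂⟩ := (continuous_fderiv_apply h1 (unitVec j)).bounded_above_of_compact_support
    (hasCompactSupport_fderiv_apply h2 _)
  set M : ℝ≥0 := (max M₁ M₂).toNNReal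
  have hM₁' : ∀ x, ‖ψ x‖ ≤ M := fun x =>
    (hM₁ x).trans ((le_max_left _ _).trans (Real.le_coe_toNNReal _))
  have hM₂' : ∀ x, ‖fderiv ℝ ψ x (unitVec j)‖ ≤ M := fun x =>
    (hM₂ x).trans ((le_max_right _ _).trans (Real.le_coe_toNNReal _))
  have key : ∀ δ : ℝ≥0, 0 < δ → ‖(∫ x in Ω, G x (i, j) * ψ x)
      + ∫ x in Ω, u x i * fderiv ℝ ψ x (unitVec j)‖ₑ ≤ M * δ := by
    intro δ hδ
    obtain ⟨φ, hφ, hlt⟩ := h δ (by exact_mod_cast hδ)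
    have hφe := hφ.hasZeroExtGrad
    have hid := hφe.2.2 ψ h1 h2 i j
    have e1 : ∫ x in Ω, (G x - classicalGrad φ x) (i, j) * ψ x
        = (∫ x in Ω, G x (i, j) * ψ x) - ∫ x in Ω, testMF Ω hφ x (i, j) * ψ x := by
      rw [← integral_sub (Integrable.mul_test (Integrable.euclidean_apply hG _) h1.continuous h2)
        (hφe.integrable_grad_mul h1 h2 _)]
      exact integral_congr_ae ((coeFn_testMF hφ).mono fun x hx => by
        simp only [hx, PiLp.sub_apply, sub_mul])
    have e2 : ∫ x in Ω, (u x - φ x) i * fderiv ℝ ψ x (unitVec j)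
        = (∫ x in Ω, u x i * fderiv ℝ ψ x (unitVec j))
          - ∫ x in Ω, testVF Ω hφ x i * fderiv ℝ ψ x (unitVec j) := by
      rw [← integral_sub (Integrable.mul_test (Integrable.euclidean_apply hu _)
        (continuous_fderiv_apply h1 _) (hasCompactSupport_fderiv_apply h2 _))
        (hφe.integrable_mul_fderiv h1 h2 _ _)]
      exact integral_congr_ae ((coeFn_testVF hφ).mono fun x hx => by
        simp only [hx, PiLp.sub_apply, sub_mul])
    have e3 : (∫ x in Ω, G x (i, j) * ψ x) + ∫ x in Ω, u x i * fderiv ℝ ψ x (unitVec j)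
        = (∫ x in Ω, (G x - classicalGrad φ x) (i, j) * ψ x)
          + ∫ x in Ω, (u x - φ x) i * fderiv ℝ ψ x (unitVec j) := by
      rw [e1, e2, hid]; ring
    rw [e3]
    refine (enorm_add_le _ _).trans ((add_le_add (enorm_integral_mul_le _ _ hM₁')
      (enorm_integral_mul_le _ _ hM₂')).trans ?_)
    rw [← mul_add, add_comm]
    exact mul_le_mul_right hlt.le _
  refine le_antisymm (ENNReal.le_of_forall_pos_le_add fun ε hε _ => ?_) zero_le
  -- The summand `1` in the denominator covers `M = 0`.
  refine (key (ε / (M + 1)) (by positivity)).trans ?_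
  rw [zero_add]
  norm_cast
  rw [mul_div_assoc', div_le_iff₀ (by positivity), mul_comm]
  gcongr
  simp

theorem MemW110.exists_hasZeroExtGrad {u : VF Ω} (h : MemW110 u) : ∃ G, HasZeroExtGrad u G :=
  let ⟨hu, G, _, hG, happ⟩ := h
  ⟨G, MemW110.hasZeroExtGrad hu hG happ⟩

theorem MemW110.add {u v : VF Ω} (hu : MemW110 u) (hv : MemW110 v) : MemW110 (u + v) := by
  obtain ⟨hu1, G, -, hG, hGa⟩ := hu
  obtain ⟨hv1, H, -, hH, hHa⟩ := hv
  have hz := (MemW110.hasZeroExtGrad hu1 hG hGa).add (MemW110.hasZeroExtGrad hv1 hH hHa)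
  refine ⟨memLp_one_iff_integrable.2 hz.1, G + H, hz.hasWeakGrad, memLp_one_iff_integrable.2 hz.2.1,
    fun δ hδ => ?_⟩
  have hδ2 : 0 < δ / 2 := ENNReal.half_pos hδ.ne'
  obtain ⟨φ, hφ, h1⟩ := hGa _ hδ2
  obtain ⟨ψ, hψ, h2⟩ := hHa _ hδ2
  have hsupp : tsupport (φ + ψ) ⊆ tsupport φ ∪ tsupport ψ := tsupport_add φ ψ
  refine ⟨φ + ψ, ⟨hφ.1.add hψ.1, hφ.2.1.add hψ.2.1, hsupp.trans (union_subset hφ.2.2 hψ.2.2)⟩, ?_⟩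
  have e1 : (fun x => (u + v) x - (φ + ψ) x) =ᵐ[volume.restrict Ω]
      (fun x => u x - φ x) + fun x => v x - ψ x :=
    (AEEqFun.coeFn_add u v).mono fun x hx => by
      simp only [hx, Pi.add_apply]; abel
  have e2 : (fun x => (G + H) x - classicalGrad (φ + ψ) x) =ᵐ[volume.restrict Ω]
      (fun x => G x - classicalGrad φ x) + fun x => H x - classicalGrad ψ x :=
    (AEEqFun.coeFn_add G H).mono fun x hx => by
      have : classicalGrad (φ + ψ) x = classicalGrad φ x + classicalGrad ψ x := by
        ext ij
        simp only [classicalGrad, PiLp.add_apply]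
        rw [fderiv_add (hφ.1.differentiable (by simp) x) (hψ.1.differentiable (by simp) x)]
        rfl
      simp only [hx, Pi.add_apply, this]; abel
  rw [eLpNorm_congr_ae e1, eLpNorm_congr_ae e2]
  have m1 := hu1.1.sub (hφ.1.continuous.aestronglyMeasurable (μ := volume.restrict Ω))
  have m2 := hv1.1.sub (hψ.1.continuous.aestronglyMeasurable (μ := volume.restrict Ω))
  have m3 := hG.1.sub ((continuous_classicalGrad hφ.1).aestronglyMeasurable (μ := volume.restrict Ω))
  have m4 := hH.1.sub ((continuous_classicalGrad hψ.1).aestronglyMeasurable (μ := volume.restrict Ω))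
  calc _ ≤ _ := add_le_add (eLpNorm_add_le m1 m2 le_rfl) (eLpNorm_add_le m3 m4 le_rfl)
    _ = _ := add_add_add_comm _ _ _ _
    _ < δ / 2 + δ / 2 := ENNReal.add_lt_add h1 h2
    _ = δ := ENNReal.add_halves δ

theorem MemW110.smul {u : VF Ω} (hu : MemW110 u) (c : ℝ) : MemW110 (c • u) := by
  obtain ⟨hu1, G, -, hG, hGa⟩ := hu
  have hz := (MemW110.hasZeroExtGrad hu1 hG hGa).smul c
  refine ⟨memLp_one_iff_integrable.2 hz.1, c • G, hz.hasWeakGrad, memLp_one_iff_integrable.2 hz.2.1,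
    fun δ hδ => ?_⟩
  -- The summand `1` avoids division by zero when `c = 0`.
  obtain ⟨φ, hφ, h1⟩ := hGa (δ / (‖c‖ₑ + 1)) (ENNReal.div_pos hδ.ne' (by simp))
  refine ⟨c • φ, ⟨contDiff_const.smul hφ.1, hφ.2.1.smul_left (f := fun _ => c),
    (tsupport_smul_subset_right (fun _ => c) φ).trans hφ.2.2⟩, ?_⟩
  have e1 : (fun x => (c • u) x - (c • φ) x) =ᵐ[volume.restrict Ω]
      c • fun x => u x - φ x :=
    (AEEqFun.coeFn_smul c u).mono fun x hx => by
      simp only [hx, Pi.smul_apply, smul_sub]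
  have e2 : (fun x => (c • G) x - classicalGrad (c • φ) x) =ᵐ[volume.restrict Ω]
      c • fun x => G x - classicalGrad φ x :=
    (AEEqFun.coeFn_smul c G).mono fun x hx => by
      have : classicalGrad (c • φ) x = c • classicalGrad φ x := by
        ext ij
        simp only [classicalGrad, PiLp.smul_apply]
        rw [fderiv_const_smul (hφ.1.differentiable (by simp) x)]
        rfl
      simp only [hx, Pi.smul_apply, this, smul_sub]
  rw [eLpNorm_congr_ae e1, eLpNorm_congr_ae e2, eLpNorm_const_smul, eLpNorm_const_smul, ← mul_add]
  calc _ ≤ (‖c‖ₑ + 1) * _ := mul_le_mul_left le_self_add _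
    _ < (‖c‖ₑ + 1) * (δ / (‖c‖ₑ + 1)) :=
      (ENNReal.mul_lt_mul_iff_right (by simp) (by simp)).2 h1
    _ ≤ δ := ENNReal.mul_div_le

end WeakGradients

/-! ### Finite element fields -/

section FiniteElements

variable {d : ℕ} {Ω : Set (Pt d)} {𝒯 : Geometry.SimplicialComplex ℝ (Pt d)}

theorem contDiff_eval (P : MvPolynomial (Fin d) ℝ) :
    ContDiff ℝ ∞ fun x : Pt d => MvPolynomial.eval (fun i => x i) P := by
  induction P using MvPolynomial.induction_on with
  | C a => simpa using contDiff_const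
  | add p q hp hq => simpa using hp.add hq
  | mul_X p i hp =>
    simp only [map_mul, MvPolynomial.eval_X]
    exact hp.mul (EuclideanSpace.proj (𝕜 := ℝ) i).contDiff

theorem IsTriangulation.exists_mem_convexHull (h𝒯 : IsTriangulation Ω 𝒯) {x : Pt d} (hx : x ∈ Ω) :
    ∃ s ∈ 𝒯.faces, s.card = d + 1 ∧ x ∈ convexHull ℝ (s : Set (Pt d)) := by
  have h : x ∈ 𝒯.space := h𝒯.space_eq ▸ subset_closure hx
  obtain ⟨s, hs, hxs⟩ := Geometry.SimplicialComplex.mem_space_iff.1 h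
  obtain ⟨t, ht, hst, hcard⟩ := h𝒯.pure s hs
  exact ⟨t, ht, hcard, convexHull_mono (by exact_mod_cast hst) hxs⟩

theorem isCompact_convexHull_finset (s : Finset (Pt d)) :
    IsCompact (convexHull ℝ (s : Set (Pt d))) :=
  s.finite_toSet.isCompact_convexHull ℝ

/-- Almost every point of `Ω` lies in the interior of a simplex. -/
theorem IsTriangulation.ae_exists_mem_interior (h𝒯 : IsTriangulation Ω 𝒯) :
    ∀ᵐ x, x ∈ Ω → ∃ s ∈ 𝒯.faces, s.card = d + 1 ∧ x ∈ interior (convexHull ℝ (s : Set (Pt d))) := by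
  -- The frontier of a convex set is a null set, and there are finitely many simplices.
  have h : ∀ s ∈ 𝒯.faces, ∀ᵐ x, x ∉ frontier (convexHull ℝ (s : Set (Pt d))) := fun s _ =>
    measure_eq_zero_iff_ae_notMem.1 ((convex_convexHull ℝ _).addHaar_frontier volume)
  filter_upwards [(ae_ball_iff h𝒯.finite.countable).2 h] with x hx hxΩ
  obtain ⟨s, hs, hcard, hxs⟩ := h𝒯.exists_mem_convexHull hxΩ
  refine ⟨s, hs, hcard, ?_⟩
  by_contra hint
  exact hx s hs ⟨subset_closure hxs, hint⟩

/-- A function which is bounded on the simplices is bounded. -/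
theorem IsTriangulation.exists_ae_bound (h𝒯 : IsTriangulation Ω 𝒯) (hΩ : IsOpen Ω)
    {f : Pt d → ℝ} (h : ∀ s ∈ 𝒯.faces, s.card = d + 1 →
      ∃ M : ℝ, ∀ᵐ x, x ∈ Ω → x ∈ interior (convexHull ℝ (s : Set (Pt d))) → f x ≤ M) :
    ∃ M : ℝ, ∀ᵐ x ∂volume.restrict Ω, f x ≤ M := by
  have h' : ∀ s : Finset (Pt d), ∃ M : ℝ, s ∈ 𝒯.faces → s.card = d + 1 →
      ∀ᵐ x, x ∈ Ω → x ∈ interior (convexHull ℝ (s : Set (Pt d))) → f x ≤ M := by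
    intro s
    by_cases hs : s ∈ 𝒯.faces ∧ s.card = d + 1
    · obtain ⟨M, hM⟩ := h s hs.1 hs.2
      exact ⟨M, fun _ _ => hM⟩
    · exact ⟨0, fun h1 h2 => (hs ⟨h1, h2⟩).elim⟩
  choose M hM using h'
  obtain ⟨C, hC⟩ := (h𝒯.finite.image M).bddAbove
  refine ⟨C, (ae_restrict_iff' hΩ.measurableSet).2 ?_⟩
  have hall : ∀ᵐ x, ∀ s ∈ 𝒯.faces, s.card = d + 1 → x ∈ Ω →
      x ∈ interior (convexHull ℝ (s : Set (Pt d))) → f x ≤ M s := by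
    refine (ae_ball_iff h𝒯.finite.countable).2 fun s hs => ?_
    by_cases hcard : s.card = d + 1
    · exact (hM s hs hcard).mono fun x hx _ => hx
    · exact ae_of_all _ fun x h => (hcard h).elim
  filter_upwards [hall, h𝒯.ae_exists_mem_interior] with x hx1 hx2 hxΩ
  obtain ⟨s, hs, hcard, hxs⟩ := hx2 hxΩ
  exact (hx1 s hs hcard hxΩ hxs).trans (hC ⟨s, hs, rfl⟩)

theorem IsPwPoly.exists_ae_bound (h𝒯 : IsTriangulation Ω 𝒯) (hΩ : IsOpen Ω) {l : ℕ} {η : SF Ω}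
    (hη : IsPwPoly 𝒯 l η) : ∃ M : ℝ, ∀ᵐ x ∂volume.restrict Ω, ‖η x‖ ≤ M := by
  refine h𝒯.exists_ae_bound hΩ fun s hs hcard => ?_
  obtain ⟨P, -, hP⟩ := hη s hs hcard
  obtain ⟨M, hM⟩ := (isCompact_convexHull_finset s).exists_bound_of_continuousOn
    (contDiff_eval P).continuous.continuousOn
  refine ⟨M, ?_⟩
  filter_upwards [(ae_restrict_iff' hΩ.measurableSet).1 hP] with x hx hxΩ hxs
  rw [hx hxΩ (interior_subset hxs)]
  exact hM x (interior_subset hxs)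

theorem IsContPwPoly.exists_ae_bound (hΩb : Bornology.IsBounded Ω) (hΩ : IsOpen Ω) {m : ℕ}
    {v : VF Ω} (hv : IsContPwPoly 𝒯 m v) : ∃ M : ℝ, ∀ᵐ x ∂volume.restrict Ω, ‖v x‖ ≤ M := by
  obtain ⟨g, hg, hvg, -⟩ := hv
  obtain ⟨M, hM⟩ := hΩb.isCompact_closure.exists_bound_of_continuousOn hg
  refine ⟨M, ?_⟩
  filter_upwards [hvg, ae_restrict_mem hΩ.measurableSet] with x hx hxΩ
  rw [hx]
  exact hM x (subset_closure hxΩ)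

theorem euclidean_norm_le_of_forall {ι : Type*} [Fintype ι] (A : EuclideanSpace ℝ ι) :
    ‖A‖ ≤ ∑ i, ‖A i‖ := by
  classical
  have h := (EuclideanSpace.basisFun ι ℝ).sum_repr A
  calc ‖A‖ = ‖∑ i, (EuclideanSpace.basisFun ι ℝ).repr A i • EuclideanSpace.basisFun ι ℝ i‖ := by
        rw [h]
    _ ≤ ∑ i, ‖(EuclideanSpace.basisFun ι ℝ).repr A i • EuclideanSpace.basisFun ι ℝ i‖ :=
        norm_sum_le _ _
    _ = ∑ i, ‖A i‖ := by simp [norm_smul]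

/-- The weak gradient of a finite element field is bounded. -/
theorem IsContPwPoly.exists_ae_bound_grad (h𝒯 : IsTriangulation Ω 𝒯) (hΩ : IsOpen Ω) {m : ℕ}
    {v : VF Ω} (hv : IsContPwPoly 𝒯 m v) {G : MF Ω} (hG : HasWeakGrad v G) :
    ∃ M : ℝ, ∀ᵐ x ∂volume.restrict Ω, ‖G x‖ ≤ M := by
  obtain ⟨g, hg, hvg, hpoly⟩ := hv
  have hcomp : ∀ ij : Fin d × Fin d, ∃ M : ℝ, ∀ᵐ x ∂volume.restrict Ω, ‖G x ij‖ ≤ M := by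
    rintro ⟨i, j⟩
    refine h𝒯.exists_ae_bound hΩ fun s hs hcard => ?_
    obtain ⟨P, -, hP⟩ := hpoly s hs hcard i
    set p : Pt d → ℝ := fun x => MvPolynomial.eval (fun i => x i) P
    have hp : ContDiff ℝ ∞ p := contDiff_eval P
    have hpc := continuous_fderiv_apply hp (unitVec j)
    obtain ⟨M, hM⟩ := (isCompact_convexHull_finset s).exists_bound_of_continuousOn hpc.continuousOn
    refine ⟨M, ?_⟩
    set U := interior (convexHull ℝ (s : Set (Pt d))) ∩ Ω
    have hU : IsOpen U := isOpen_interior.inter hΩ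
    -- Inside a simplex the component is a polynomial, so by uniqueness of weak derivatives the
    -- given weak derivative is the classical one there, which is bounded on the compact simplex.
    -- Since the weak gradient is already a function, nothing has to be checked across faces.
    have h := ae_eq_of_forall_test hU (f := fun x => G x (i, j))
      (g := fun x => fderiv ℝ p x (unitVec j))
      ((LocallyIntegrableOn.apply hG.2.1 _).mono_set inter_subset_right)
      (hpc.locallyIntegrable.locallyIntegrableOn _) fun φ h1 h2 h3 => by
        have hφ := continuous_fderiv_apply h1 (unitVec j)
        have hφc := hasCompactSupport_fderiv_apply h2 (unitVec j)
        have h3Ω : tsupport φ ⊆ Ω := h3.trans inter_subset_right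
        have i1 : Integrable fun x => fderiv ℝ p x (unitVec j) * φ x :=
          (hpc.mul h1.continuous).integrable_of_hasCompactSupport h2.mul_left
        have i2 : Integrable fun x => p x * fderiv ℝ φ x (unitVec j) :=
          (hp.continuous.mul hφ).integrable_of_hasCompactSupport hφc.mul_left
        have i3 : Integrable fun x => p x * φ x :=
          (hp.continuous.mul h1.continuous).integrable_of_hasCompactSupport h2.mul_left
        have hGint : IntegrableOn (fun x => G x (i, j) * φ x) (tsupport φ) := by
          have h4 : IntegrableOn (fun x => G x (i, j)) (tsupport φ) :=
            (LocallyIntegrableOn.apply hG.2.1 (i, j)).integrableOn_compact_subset h3Ω h2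
          exact Integrable.mul_test h4 h1.continuous h2
        have i4 : Integrable fun x => G x (i, j) * φ x := by
          refine (integrableOn_iff_integrable_of_support_subset fun x hx => ?_).1 hGint
          exact subset_tsupport φ (right_ne_zero_of_mul hx)
        have e1 : ∫ x in Ω, v x i * fderiv ℝ φ x (unitVec j)
            = ∫ x, p x * fderiv ℝ φ x (unitVec j) := by
          refine Eq.trans ?_ (setIntegral_eq_integral_of_forall_compl_eq_zero (s := Ω) ?_)
          · refine integral_congr_ae (hvg.mono fun x hx => ?_)
            by_cases hxs : x ∈ tsupport φ
            · simp only [hx]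
              rw [hP x (interior_subset (h3 hxs).1)]
            · have : fderiv ℝ φ x = 0 := by
                by_contra hne
                exact hxs (support_fderiv_subset ℝ hne)
              simp [this]
          · intro x hx
            have : fderiv ℝ φ x = 0 := by
              by_contra hne
              exact hx (h3Ω (support_fderiv_subset ℝ hne))
            simp [this]
        simp_rw [sub_mul]
        rw [integral_sub i4 i1, ← setIntegral_mul_test h3Ω (f := fun x => G x (i, j)),
          hG.2.2 φ h1 h2 h3Ω, e1, integral_mul_fderiv_eq_neg_fderiv_mul_of_integrable i1 i2 i3
            (fun x _ => hp.differentiable (by simp) x)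
            (fun x _ => h1.differentiable (by simp) x)]
        ring
    filter_upwards [h] with x hx hxΩ hxs
    rw [hx ⟨hxs, hxΩ⟩]
    exact hM x (interior_subset hxs)
  choose M hM using hcomp
  refine ⟨∑ ij, M ij, ?_⟩
  filter_upwards [ae_all_iff.2 hM] with x hx
  exact (euclidean_norm_le_of_forall _).trans (Finset.sum_le_sum fun ij _ => hx ij)

/-- Finite element spaces are finite dimensional. -/
theorem finiteDimensional_of_isContPwPoly (h𝒯 : IsTriangulation Ω 𝒯) (hΩ : IsOpen Ω) {m : ℕ}
    {V : Submodule ℝ (VF Ω)} (hV : ∀ v ∈ V, IsContPwPoly 𝒯 m v) : FiniteDimensional ℝ V := by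
  classical
  let S := {s : Finset (Pt d) // s ∈ 𝒯.faces ∧ s.card = d + 1}
  have hSfin : Finite S := (h𝒯.finite.subset fun s (hs : s ∈ 𝒯.faces ∧ s.card = d + 1) => hs.1)
  let W := S → Fin d → MvPolynomial.restrictTotalDegree (Fin d) ℝ m
  -- At each point one simplex containing it is picked, independently of the polynomials, which
  -- keeps the gluing linear. For a finite element field the choice is immaterial, as all local
  -- polynomials agree with the same continuous representative.
  let Ψ : W →ₗ[ℝ] (Pt d → Pt d) :=
    { toFun := fun P x =>
        if h : ∃ s : S, x ∈ convexHull ℝ (s.1 : Set (Pt d)) then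
          WithLp.toLp 2 fun i => MvPolynomial.eval (fun i => x i) (P h.choose i : MvPolynomial _ _)
        else 0
      map_add' := fun P P' => by
        funext x
        by_cases h : ∃ s : S, x ∈ convexHull ℝ (s.1 : Set (Pt d))
        · simp only [dif_pos h, Pi.add_apply]
          ext i
          exact map_add (MvPolynomial.eval fun i => x i) _ _
        · simp only [dif_neg h, Pi.add_apply, add_zero]
      map_smul' := fun c P => by
        funext x
        by_cases h : ∃ s : S, x ∈ convexHull ℝ (s.1 : Set (Pt d))
        · simp only [dif_pos h, Pi.smul_apply, RingHom.id_apply]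
          ext i
          exact MvPolynomial.smul_eval _ _ _
        · simp only [dif_neg h, Pi.smul_apply, smul_zero, RingHom.id_apply] }
  -- Gluing by an arbitrary choice of simplex need not be measurable, so only the measurable results
  -- are passed to equivalence classes.
  let AM : Submodule ℝ (Pt d → Pt d) :=
    { carrier := {f | AEStronglyMeasurable f (volume.restrict Ω)}
      add_mem' := fun hf hg => AEStronglyMeasurable.add hf hg
      zero_mem' := aestronglyMeasurable_zero
      smul_mem' := fun c _ hf => AEStronglyMeasurable.const_smul hf c }
  let R : Submodule ℝ (Pt d → Pt d) := LinearMap.range Ψ ⊓ AM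
  let J : R →ₗ[ℝ] VF Ω :=
    { toFun := fun f => AEEqFun.mk f.1 f.2.2
      map_add' := fun f g => (AEEqFun.mk_add_mk _ _ _ _).symm
      map_smul' := fun c f => (AEEqFun.smul_mk c _ _).symm }
  have hR : FiniteDimensional ℝ R := Submodule.finiteDimensional_inf_left _ _
  refine Submodule.finiteDimensional_of_le (S₂ := LinearMap.range J) fun v hv => ?_
  obtain ⟨g, hg, hvg, hpoly⟩ := hV v hv
  have hpoly' : ∀ (s : S) (i : Fin d), ∃ P : MvPolynomial.restrictTotalDegree (Fin d) ℝ m,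
      ∀ x ∈ convexHull ℝ (s.1 : Set (Pt d)),
        g x i = MvPolynomial.eval (fun i => x i) (P : MvPolynomial (Fin d) ℝ) := by
    intro s i
    obtain ⟨P, hPm, hP⟩ := hpoly s.1 s.2.1 s.2.2 i
    exact ⟨⟨P, (MvPolynomial.mem_restrictTotalDegree _ _ _).2 hPm⟩, hP⟩
  choose P hP using hpoly'
  have hΨ : v =ᵐ[volume.restrict Ω] Ψ P := by
    filter_upwards [hvg, ae_restrict_mem hΩ.measurableSet] with x hx hxΩ
    obtain ⟨s, hs, hcard, hxs⟩ := h𝒯.exists_mem_convexHull hxΩ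
    have h : ∃ s : S, x ∈ convexHull ℝ (s.1 : Set (Pt d)) := ⟨⟨s, hs, hcard⟩, hxs⟩
    have h1 : Ψ P x = WithLp.toLp 2 fun i =>
        MvPolynomial.eval (fun i => x i) (P h.choose i : MvPolynomial _ _) := dif_pos h
    rw [hx, h1]
    ext i
    exact hP h.choose i x h.choose_spec
  have hm : AEStronglyMeasurable (Ψ P) (volume.restrict Ω) := v.aestronglyMeasurable.congr hΨ
  refine ⟨⟨Ψ P, ⟨P, rfl⟩, hm⟩, ?_⟩
  refine AEEqFun.ext ?_
  exact (AEEqFun.coeFn_mk (Ψ P) hm).trans hΨ.symm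

theorem divergence_ae_eq (hΩ : IsOpen Ω) {u : VF Ω} {G : MF Ω} (h : HasZeroExtGrad u G) :
    divergence u =ᵐ[volume.restrict Ω] fun x => ∑ i, G x (i, i) := by
  filter_upwards [h.symGrad_ae_eq hΩ] with x hx
  refine Finset.sum_congr rfl fun i _ => ?_
  rw [hx, symPart_apply]
  ring

/-- The discretely divergence-free fields form a linear space. -/
theorem exists_submodule_discDivFree (h𝒯 : IsTriangulation Ω 𝒯) (hΩ : IsOpen Ω) {l : ℕ}
    {V : Submodule ℝ (VF Ω)} {Q : Submodule ℝ (SF Ω)} (hQ : ∀ η ∈ Q, IsPwPoly 𝒯 l η)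
    (hne : (discDivFree V Q).Nonempty) :
    ∃ W : Submodule ℝ (VF Ω), (W : Set (VF Ω)) = discDivFree V Q := by
  -- Elements of `Q` are bounded, so the pairings with an integrable divergence converge and the
  -- constraint is additive.
  have hint : ∀ {G : MF Ω}, Integrable G (volume.restrict Ω) → ∀ η ∈ Q,
      Integrable (fun x => (∑ i, G x (i, i)) * η x) (volume.restrict Ω) := by
    intro G hG η hη
    obtain ⟨M, hM⟩ := (hQ η hη).exists_ae_bound h𝒯 hΩ
    exact (integrable_finsetSum _ fun i _ => Integrable.euclidean_apply hG (i, i)).mul_bdd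
      η.aestronglyMeasurable hM
  have hdiv : ∀ {u : VF Ω} {G : MF Ω}, HasZeroExtGrad u G → ∀ η : SF Ω,
      ∫ x in Ω, divergence u x * η x = ∫ x in Ω, (∑ i, G x (i, i)) * η x := by
    intro u G h η
    refine integral_congr_ae ((divergence_ae_eq hΩ h).mono fun x hx => ?_)
    simp only [hx]
  have hsmul : ∀ (c : ℝ) {u : VF Ω}, u ∈ discDivFree V Q → c • u ∈ discDivFree V Q := by
    intro c u hu
    refine ⟨V.smul_mem c hu.1, hu.2.1.smul c, fun η hη => ?_⟩
    obtain ⟨G, hG⟩ := hu.2.1.exists_hasZeroExtGrad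
    have h0 := hu.2.2 η hη
    rw [hdiv hG] at h0
    have e : ∫ x in Ω, (∑ i, (c • G) x (i, i)) * η x
        = ∫ x in Ω, c * ((∑ i, G x (i, i)) * η x) :=
      integral_congr_ae ((AEEqFun.coeFn_smul c G).mono fun x hx => by
        simp only [hx, Pi.smul_apply, PiLp.smul_apply, smul_eq_mul, ← Finset.mul_sum, mul_assoc])
    rw [hdiv (hG.smul c), e, integral_const_mul, h0, mul_zero]
  refine ⟨{ carrier := discDivFree V Q, add_mem' := ?_, zero_mem' := ?_, smul_mem' := ?_ }, rfl⟩
  · intro u v hu hv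
    refine ⟨V.add_mem hu.1 hv.1, hu.2.1.add hv.2.1, fun η hη => ?_⟩
    obtain ⟨G, hG⟩ := hu.2.1.exists_hasZeroExtGrad
    obtain ⟨H, hH⟩ := hv.2.1.exists_hasZeroExtGrad
    have h0 := hu.2.2 η hη
    have h0' := hv.2.2 η hη
    rw [hdiv hG] at h0
    rw [hdiv hH] at h0'
    have e : ∫ x in Ω, (∑ i, (G + H) x (i, i)) * η x
        = ∫ x in Ω, ((∑ i, G x (i, i)) * η x + (∑ i, H x (i, i)) * η x) :=
      integral_congr_ae ((AEEqFun.coeFn_add G H).mono fun x hx => by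
        simp only [hx, Pi.add_apply, PiLp.add_apply, Finset.sum_add_distrib, add_mul])
    rw [hdiv (hG.add hH), e, integral_add (hint hG.2.1 η hη) (hint hH.2.1 η hη), h0, h0', add_zero]
  -- The zero field is obtained as `0` times an element of the set, which is the role of
  -- nonemptiness.
  · obtain ⟨u, hu⟩ := hne
    have h0 : (0 : ℝ) • u = 0 := zero_smul ℝ u
    exact h0 ▸ hsmul 0 hu
  · exact fun c u hu => hsmul c hu

end FiniteElements

/-! ### Density of test fields -/

section Density

open scoped Manifold Pointwise Convolution

variable {d : ℕ} {Ω : Set (Pt d)}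

/-- Near each point of its closure, a Lipschitz domain contains small cones. -/
theorem IsBoundedLipschitzDomain.exists_cone (hΩ : IsBoundedLipschitzDomain Ω) {x : Pt d}
    (hx : x ∈ closure Ω) : ∃ (e : Pt d) (κ r : ℝ), 0 < κ ∧ 0 < r ∧
      ∀ y ∈ closure Ω, y ∈ Metric.ball x r → ∀ s, 0 < s → s < r →
        Metric.closedBall (y + s • e) (κ * s) ⊆ Ω := by
  by_cases hxΩ : x ∈ Ω
  · obtain ⟨ρ, hρ, hball⟩ := Metric.isOpen_iff.1 hΩ.isOpen x hxΩ
    refine ⟨0, 1, ρ / 2, one_pos, by positivity, fun y _ hy s _ hsr w hw => hball ?_⟩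
    rw [smul_zero, add_zero, one_mul] at hw
    rw [Metric.mem_ball] at hy ⊢
    rw [Metric.mem_closedBall] at hw
    linarith [dist_triangle w y x]
  · have hfr : x ∈ frontier Ω := ⟨hx, fun h => hxΩ (interior_subset h)⟩
    obtain ⟨e, γ, L, r₀, he, hγ, hγe, hr₀, hiff⟩ := hΩ.lipschitz_boundary x hfr
    -- Moving by `s` along `e` raises the height above the graph by `s`; a perturbation of size `κ
    -- s` costs at most `(L + 1) κ s`, which is less than `s` for `κ = 1 / (L + 2)`. Moreover `κ ≤ 1
    -- / 2`, so all points involved stay within `r₀` of `x` when `s < r₀ / 3`.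
    have hκ : (0 : ℝ) < (L + 2 : ℝ)⁻¹ := by positivity
    have hκ2 : (L + 2 : ℝ)⁻¹ ≤ 1 / 2 := by
      rw [one_div]
      exact inv_anti₀ two_pos (by linarith [L.coe_nonneg])
    have hκL : (L + 2 : ℝ) * (L + 2 : ℝ)⁻¹ = 1 := mul_inv_cancel₀ (by positivity)
    refine ⟨e, (L + 2 : ℝ)⁻¹, r₀ / 3, hκ, by positivity, fun y hyΩ hy s hs hsr w hw => ?_⟩
    set κ := (L + 2 : ℝ)⁻¹
    rw [Metric.mem_ball] at hy
    rw [Metric.mem_closedBall] at hw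
    -- For points of the closure the epigraph inequality is only weak; the displacement makes it
    -- strict.
    have hyγ : γ y ≤ inner ℝ e y := by
      have hcl : IsClosed {z : Pt d | γ z ≤ inner ℝ e z} :=
        isClosed_le hγ.continuous (continuous_const.inner continuous_id)
      have hsub : Ω ∩ Metric.ball x r₀ ⊆ {z : Pt d | γ z ≤ inner ℝ e z} := fun z hz =>
        ((hiff z hz.2).1 hz.1).le
      have hyc : y ∈ closure (Ω ∩ Metric.ball x r₀) :=
        mem_closure_iff_nhds.2 fun t ht => by
          have hb : Metric.ball x r₀ ∈ 𝓝 y :=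
            Metric.isOpen_ball.mem_nhds (by rw [Metric.mem_ball]; linarith)
          obtain ⟨z, hz⟩ := mem_closure_iff_nhds.1 hyΩ _ (inter_mem ht hb)
          exact ⟨z, hz.1.1, hz.2, hz.1.2⟩
      exact closure_minimal hsub hcl hyc
    have hse : dist (y + s • e) y = s := by
      rw [dist_self_add_left, norm_smul, he, Real.norm_of_nonneg hs.le, mul_one]
    have hκs : κ * s ≤ s / 2 := by nlinarith
    have hwx : w ∈ Metric.ball x r₀ := by
      rw [Metric.mem_ball]
      linarith [dist_triangle w (y + s • e) x, dist_triangle (y + s • e) y x]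
    rw [hiff w hwx]
    have h1 : γ w ≤ γ y + L * (κ * s) := by
      have h2 := (hγ.dist_le_mul w (y + s • e)).trans
        (mul_le_mul_of_nonneg_left hw L.coe_nonneg)
      rw [Real.dist_eq, hγe y s] at h2
      linarith [le_abs_self (γ w - γ y)]
    have h3 : inner ℝ e y + s - κ * s ≤ inner ℝ e w := by
      have h4 : inner ℝ e (y + s • e) = inner ℝ e y + s := by
        rw [inner_add_right, inner_smul_right, real_inner_self_eq_norm_sq, he]; ring
      have h5 : |inner ℝ e (w - (y + s • e))| ≤ κ * s := by
        refine (abs_real_inner_le_norm _ _).trans ?_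
        rw [he, one_mul, ← dist_eq_norm]
        exact hw
      rw [inner_sub_right, h4] at h5
      linarith [(abs_le.1 h5).1]
    nlinarith

/-- A smooth partition of unity subordinate to the cone neighbourhoods. -/
theorem IsBoundedLipschitzDomain.exists_partition (hΩ : IsBoundedLipschitzDomain Ω) :
    ∃ (ι : Type) (_ : Fintype ι) (ζ : ι → Pt d → ℝ),
      (∀ a, ContDiff ℝ ∞ (ζ a) ∧ HasCompactSupport (ζ a) ∧ ∃ (e : Pt d) (κ r : ℝ),
        0 < κ ∧ 0 < r ∧ ∀ y ∈ closure Ω, y ∈ tsupport (ζ a) → ∀ s, 0 < s → s < r →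
          Metric.closedBall (y + s • e) (κ * s) ⊆ Ω) ∧
      ∀ x ∈ closure Ω, ∑ a, ζ a x = 1 := by
  choose! e κ r hκ hr hcone using fun (x : Pt d) (hx : x ∈ closure Ω) => hΩ.exists_cone hx
  have hcomp : IsCompact (closure Ω) := hΩ.isBounded.isCompact_closure
  obtain ⟨t, htΩ, ht⟩ := hcomp.elim_nhds_subcover (fun x => Metric.ball x (r x))
    fun x hx => Metric.ball_mem_nhds x (hr x hx)
  have hcover : closure Ω ⊆ ⋃ a : t, Metric.ball (a : Pt d) (r a) := by
    intro x hx
    obtain ⟨a, ha, hxa⟩ := mem_iUnion₂.1 (ht hx)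
    exact mem_iUnion.2 ⟨⟨a, ha⟩, hxa⟩
  obtain ⟨ρ, hρ⟩ := SmoothPartitionOfUnity.exists_isSubordinate 𝓘(ℝ, Pt d) hcomp.isClosed
    (fun a : t => Metric.ball (a : Pt d) (r a)) (fun a => Metric.isOpen_ball) hcover
  refine ⟨t, inferInstance, fun a => ρ a, fun a => ⟨(ρ a).contMDiff.contDiff, ?_,
    e a, κ a, r a, hκ a (htΩ a a.2), hr a (htΩ a a.2), fun y hy hya =>
      hcone a (htΩ a a.2) y hy (hρ a hya)⟩, fun x hx => ?_⟩
  · exact HasCompactSupport.of_support_subset_isCompact (isCompact_closedBall (a : Pt d) (r a))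
      ((subset_tsupport _).trans ((hρ a).trans Metric.ball_subset_closedBall))
  · rw [← finsum_eq_sum_of_fintype]
    exact ρ.sum_eq_one hx

/-! ### Mollification with shifted kernels -/

/-- A smooth bump centred at `c`, supported in the ball of radius `ρ`. -/
noncomputable def bumpAt (c : Pt d) {ρ : ℝ} (hρ : 0 < ρ) : ContDiffBump c :=
  -- The fixed ratio `2` of the radii bounds the normalized bump by `2 ^ d` over the volume of its
  -- ball, uniformly in `ρ`.
  ⟨ρ / 2, ρ, by positivity, by linarith⟩

/-- The mollification of `f` by a bump centred at `c`. -/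
noncomputable def mollify (f : Pt d → ℝ) (c : Pt d) {ρ : ℝ} (hρ : 0 < ρ) : Pt d → ℝ :=
  -- The value at `x` averages `f` over the ball of radius `ρ` around `x - c`, so the support of `f`
  -- is moved by `c` and enlarged by `ρ`.
  f ⋆[ContinuousLinearMap.mul ℝ ℝ, volume] (bumpAt c hρ).normed volume

theorem mollify_apply (f : Pt d → ℝ) (c : Pt d) {ρ : ℝ} (hρ : 0 < ρ) (x : Pt d) :
    mollify f c hρ x = ∫ t, f t * (bumpAt c hρ).normed volume (x - t) := rfl

theorem contDiff_mollify {f : Pt d → ℝ} (hf : Integrable f) (c : Pt d) {ρ : ℝ} (hρ : 0 < ρ) :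
    ContDiff ℝ ∞ (mollify f c hρ) :=
  (bumpAt c hρ).hasCompactSupport_normed.contDiff_convolution_right _ hf.locallyIntegrable
    (bumpAt c hρ).contDiff_normed

theorem fderiv_mollify {f : Pt d → ℝ} (hf : Integrable f) (c : Pt d) {ρ : ℝ} (hρ : 0 < ρ)
    (x v : Pt d) : fderiv ℝ (mollify f c hρ) x v
      = ∫ t, f t * fderiv ℝ ((bumpAt c hρ).normed volume) (x - t) v := by
  have hb := (bumpAt c hρ).hasCompactSupport_normed (μ := volume)
  have hb1 : ContDiff ℝ 1 ((bumpAt c hρ).normed volume) := (bumpAt c hρ).contDiff_normed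
  have h := hb.hasFDerivAt_convolution_right (ContinuousLinearMap.mul ℝ ℝ)
    hf.locallyIntegrable hb1 x
  have h' : fderiv ℝ (mollify f c hρ) x = _ := h.fderiv
  rw [h', convolution_precompR_apply _ hf.locallyIntegrable (hb.fderiv ℝ)
    (hb1.continuous_fderiv one_ne_zero)]
  rfl

theorem support_mollify_subset (f : Pt d → ℝ) (c : Pt d) {ρ : ℝ} (hρ : 0 < ρ) :
    Function.support (mollify f c hρ) ⊆ Function.support f + Metric.ball c ρ := by
  refine (support_convolution_subset _).trans ?_
  rw [ContDiffBump.support_normed_eq]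
  rfl

theorem integrable_bump_comp (c : Pt d) {ρ : ℝ} (hρ : 0 < ρ) (x : Pt d) :
    Integrable fun t => (bumpAt c hρ).normed volume (x - t) :=
  ((bumpAt c hρ).integrable_normed).comp_sub_left x

theorem integral_bump_comp (c : Pt d) {ρ : ℝ} (hρ : 0 < ρ) (x : Pt d) :
    ∫ t, (bumpAt c hρ).normed volume (x - t) = 1 := by
  rw [integral_sub_left_eq_self (fun t => (bumpAt c hρ).normed volume t)]
  exact (bumpAt c hρ).integral_normed

theorem abs_mollify_le {f : Pt d → ℝ} {M : ℝ} (hM : ∀ᵐ x, |f x| ≤ M) (c : Pt d) {ρ : ℝ}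
    (hρ : 0 < ρ) (x : Pt d) : |mollify f c hρ x| ≤ M := by
  rw [mollify_apply, ← Real.norm_eq_abs]
  calc _ ≤ ∫ t, M * (bumpAt c hρ).normed volume (x - t) := by
        refine norm_integral_le_of_norm_le ((integrable_bump_comp c hρ x).const_mul M) ?_
        filter_upwards [hM] with t ht
        rw [norm_mul, Real.norm_eq_abs, Real.norm_of_nonneg ((bumpAt c hρ).nonneg_normed _)]
        exact mul_le_mul_of_nonneg_right ht ((bumpAt c hρ).nonneg_normed _)
    _ = M := by rw [integral_const_mul, integral_bump_comp, mul_one]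

/-- Lebesgue's differentiation theorem holds along balls whose centres `x - c k` are displaced by at
most a fixed multiple of the radius. The kernels have mass one and are bounded by a constant over
the volume of the ball, so the weighted averages converge as well. -/
theorem ae_tendsto_mollify {f : Pt d → ℝ} (hf : Integrable f) {c : ℕ → Pt d} {ρ : ℕ → ℝ}
    (hρ : ∀ k, 0 < ρ k) (hρ0 : Tendsto ρ atTop (𝓝 0)) {K : ℝ} (hc : ∀ k, ‖c k‖ ≤ K * ρ k) :
    ∀ᵐ x, Tendsto (fun k => mollify f (c k) (hρ k) x) atTop (𝓝 (f x)) := by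
  filter_upwards [IsUnifLocDoublingMeasure.ae_tendsto_average_norm_sub volume
    hf.locallyIntegrable K] with x hx
  have h1 := hx (fun k => x - c k) ρ
    (tendsto_nhdsWithin_iff.2 ⟨hρ0, Eventually.of_forall hρ⟩)
    (Eventually.of_forall fun k => by simpa [dist_eq_norm] using hc k)
  have h2 := tendsto_integral_smul_of_tendsto_average_norm_sub
    (g := fun k t => (bumpAt (c k) (hρ k)).normed volume (x - t))
    ((2 : ℝ) ^ Module.finrank ℝ (Pt d)) h1 ?_ ?_ ?_ ?_
  · refine h2.congr fun k => ?_
    rw [mollify_apply]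
    exact integral_congr_ae (ae_of_all _ fun t => by simp [mul_comm])
  · exact Eventually.of_forall fun k => hf.integrableOn
  · simp only [integral_bump_comp]
    exact tendsto_const_nhds
  · refine Eventually.of_forall fun k t ht => ?_
    have h3 : x - t ∈ Function.support ((bumpAt (c k) (hρ k)).normed volume) := ht
    rw [ContDiffBump.support_normed_eq] at h3
    have h4 : dist (x - t) (c k) < ρ k := h3
    rw [Metric.mem_closedBall, dist_comm, dist_eq_norm]
    rw [dist_eq_norm] at h4
    have : x - c k - t = x - t - c k := by abel
    rw [this]
    exact h4.le
  · refine Eventually.of_forall fun k t => ?_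
    rw [abs_of_nonneg ((bumpAt (c k) (hρ k)).nonneg_normed _), Measure.addHaar_real_closedBall_center]
    have h5 := (bumpAt (c k) (hρ k)).normed_le_div_measure_closedBall_rOut volume 2
      (by simp only [bumpAt]; linarith) (x - t)
    rwa [Measure.addHaar_real_closedBall_center] at h5

/-- Mollification commutes with weak differentiation, up to the derivative of the cutoff. -/
theorem HasZeroExtGrad.fderiv_mollify (hΩ : IsOpen Ω) {u : VF Ω} {G : MF Ω}
    (h : HasZeroExtGrad u G) {ζ : Pt d → ℝ} (hζ : ContDiff ℝ ∞ ζ) (hζc : HasCompactSupport ζ)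
    (c : Pt d) {ρ : ℝ} (hρ : 0 < ρ) (i j : Fin d) (x : Pt d) :
    fderiv ℝ (mollify (indicator Ω fun y => u y i * ζ y) c hρ) x (unitVec j)
      = mollify (indicator Ω fun y => G y (i, j) * ζ y + u y i * fderiv ℝ ζ y (unitVec j))
          c hρ x := by
  have hui : Integrable (fun y => u y i) (volume.restrict Ω) := Integrable.euclidean_apply h.1 i
  have hf : Integrable (indicator Ω fun y => u y i * ζ y) :=
    (integrable_indicator_iff hΩ.measurableSet).2 (Integrable.mul_test hui hζ.continuous hζc)
  rw [RotheGalerkin.fderiv_mollify hf, mollify_apply]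
  set ψ : Pt d → ℝ := (bumpAt c hρ).normed volume
  have hψ : ContDiff ℝ ∞ ψ := (bumpAt c hρ).contDiff_normed
  have hψc : HasCompactSupport ψ := (bumpAt c hρ).hasCompactSupport_normed
  have hψx : ContDiff ℝ ∞ fun t => ψ (x - t) := hψ.comp (contDiff_const.sub contDiff_id)
  have hψxd : ∀ t, fderiv ℝ (fun t => ψ (x - t)) t (unitVec j)
      = - fderiv ℝ ψ (x - t) (unitVec j) := by
    intro t
    have h1 : HasFDerivAt (fun t => ψ (x - t)) _ t :=
      (hψ.differentiable (by simp) (x - t)).hasFDerivAt.comp t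
        ((hasFDerivAt_const x t).sub (hasFDerivAt_id t))
    rw [h1.fderiv]
    simp
  -- The weak formula is tested with the cutoff times the reflected kernel. Its support may leave
  -- `Ω`, which is why the formula for the zero extension is needed.
  set χ : Pt d → ℝ := fun t => ζ t * ψ (x - t)
  have hχ : ContDiff ℝ ∞ χ := hζ.mul hψx
  have hχc : HasCompactSupport χ := hζc.mul_right
  have hχd : ∀ t, fderiv ℝ χ t (unitVec j) = fderiv ℝ ζ t (unitVec j) * ψ (x - t)
      - ζ t * fderiv ℝ ψ (x - t) (unitVec j) := by
    intro t
    have h1 : fderiv ℝ χ t = _ :=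
      ((hζ.differentiable (by simp) t).hasFDerivAt.mul
        (hψx.differentiable (by simp) t).hasFDerivAt).fderiv
    rw [h1]
    simp only [add_apply, smul_apply, smul_eq_mul, hψxd]
    ring
  have e : ∀ (a : Pt d → ℝ) (b : Pt d → ℝ),
      ∫ t, indicator Ω a t * b t = ∫ t in Ω, a t * b t := by
    intro a b
    rw [← integral_indicator hΩ.measurableSet]
    refine integral_congr_ae (ae_of_all _ fun t => ?_)
    by_cases ht : t ∈ Ω <;> simp [ht]
  have i1 := h.integrable_mul_fderiv hχ hχc i j
  have i2 := h.integrable_grad_mul hχ hχc (i, j)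
  have i3 : IntegrableOn (fun t => u t i * (fderiv ℝ ζ t (unitVec j) * ψ (x - t))) Ω :=
    Integrable.mul_test hui ((continuous_fderiv_apply hζ _).mul hψx.continuous)
      (hasCompactSupport_fderiv_apply hζc _).mul_right
  have e1 : ∫ t in Ω, u t i * ζ t * fderiv ℝ ψ (x - t) (unitVec j)
      = (∫ t in Ω, u t i * (fderiv ℝ ζ t (unitVec j) * ψ (x - t)))
        - ∫ t in Ω, u t i * fderiv ℝ χ t (unitVec j) := by
    rw [← integral_sub i3 i1]
    refine integral_congr_ae (ae_of_all _ fun t => ?_)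
    simp only [hχd]
    ring
  have e2 : ∫ t in Ω, (G t (i, j) * ζ t + u t i * fderiv ℝ ζ t (unitVec j)) * ψ (x - t)
      = (∫ t in Ω, G t (i, j) * χ t)
        + ∫ t in Ω, u t i * (fderiv ℝ ζ t (unitVec j) * ψ (x - t)) := by
    rw [← integral_add i2 i3]
    refine integral_congr_ae (ae_of_all _ fun t => ?_)
    simp only [χ]
    ring
  rw [e, e, e1, e2, h.2.2 χ hχ hχc]
  ring

/-- Approximation of a bounded field, localized by a cutoff function. -/
theorem HasZeroExtGrad.exists_local_approx (hΩ : IsOpen Ω) {u : VF Ω} {G : MF Ω}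
    (h : HasZeroExtGrad u G) {M : ℝ} (hu : ∀ᵐ x ∂volume.restrict Ω, ‖u x‖ ≤ M)
    (hG : ∀ᵐ x ∂volume.restrict Ω, ‖G x‖ ≤ M) {ζ : Pt d → ℝ} (hζ : ContDiff ℝ ∞ ζ)
    (hζc : HasCompactSupport ζ) {e : Pt d} {κ r : ℝ} (hκ : 0 < κ) (hr : 0 < r)
    (hcone : ∀ y ∈ closure Ω, y ∈ tsupport ζ → ∀ s, 0 < s → s < r →
      Metric.closedBall (y + s • e) (κ * s) ⊆ Ω) :
    ∃ (φ : ℕ → Pt d → Pt d) (C : ℝ), (∀ k, IsTestField Ω (φ k)) ∧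
      (∀ k x, (∀ i, |φ k x i| ≤ C) ∧ ∀ ij, |classicalGrad (φ k) x ij| ≤ C) ∧
      ∀ᵐ x ∂volume.restrict Ω, (∀ i, Tendsto (fun k => φ k x i) atTop (𝓝 (u x i * ζ x))) ∧
        ∀ i j, Tendsto (fun k => classicalGrad (φ k) x (i, j)) atTop
          (𝓝 (G x (i, j) * ζ x + u x i * fderiv ℝ ζ x (unitVec j))) := by
  set f : Fin d → Pt d → ℝ := fun i => indicator Ω fun y => u y i * ζ y with hfdef
  set g : Fin d → Fin d → Pt d → ℝ := fun i j =>
    indicator Ω fun y => G y (i, j) * ζ y + u y i * fderiv ℝ ζ y (unitVec j) with hgdef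
  have hui : ∀ i, Integrable (fun y => u y i) (volume.restrict Ω) :=
    fun i => Integrable.euclidean_apply h.1 i
  have hf : ∀ i, Integrable (f i) := fun i =>
    (integrable_indicator_iff hΩ.measurableSet).2 (Integrable.mul_test (hui i) hζ.continuous hζc)
  have hg : ∀ i j, Integrable (g i j) := fun i j =>
    (integrable_indicator_iff hΩ.measurableSet).2
      ((h.integrable_grad_mul hζ hζc (i, j)).add (h.integrable_mul_fderiv hζ hζc i j))
  obtain ⟨Z, hZ⟩ := hζ.continuous.bounded_above_of_compact_support hζc
  obtain ⟨Z', hZ'⟩ := (hζ.continuous_fderiv (by simp)).bounded_above_of_compact_support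
    (hζc.fderiv ℝ)
  have hZ'' : ∀ y (j : Fin d), |fderiv ℝ ζ y (unitVec j)| ≤ Z' := fun y j => by
    have h1 := (fderiv ℝ ζ y).le_opNorm (unitVec j)
    have h2 : ‖(unitVec j : Pt d)‖ = 1 := by simp [unitVec]
    rw [h2, mul_one] at h1
    exact h1.trans (hZ' y)
  have hbound : ∀ᵐ y, (∀ i, |f i y| ≤ |M| * Z + |M| * Z') ∧
      ∀ i j, |g i j y| ≤ |M| * Z + |M| * Z' := by
    have hZ0 : 0 ≤ Z := (norm_nonneg _).trans (hZ 0)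
    have hZ'0 : 0 ≤ Z' := (norm_nonneg _).trans (hZ' 0)
    filter_upwards [(ae_restrict_iff' hΩ.measurableSet).1 hu,
      (ae_restrict_iff' hΩ.measurableSet).1 hG] with y hy1 hy2
    by_cases hy : y ∈ Ω
    · have h1 : ∀ i, |u y i| ≤ |M| := fun i =>
        (PiLp.norm_apply_le (u y) i).trans ((hy1 hy).trans (le_abs_self M))
      have h2 : ∀ ij, |G y ij| ≤ |M| := fun ij =>
        (PiLp.norm_apply_le (G y) ij).trans ((hy2 hy).trans (le_abs_self M))
      have h3 : |ζ y| ≤ Z := hZ y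
      refine ⟨fun i => ?_, fun i j => ?_⟩
      · simp only [hfdef, indicator_of_mem hy, abs_mul]
        have := mul_le_mul (h1 i) h3 (abs_nonneg _) (abs_nonneg _)
        have : 0 ≤ |M| * Z' := by positivity
        linarith
      · simp only [hgdef, indicator_of_mem hy]
        refine (abs_add_le _ _).trans ?_
        rw [abs_mul, abs_mul]
        exact add_le_add (mul_le_mul (h2 _) h3 (abs_nonneg _) (abs_nonneg _))
          (mul_le_mul (h1 i) (hZ'' y j) (abs_nonneg _) (abs_nonneg _))
    · have : 0 ≤ |M| * Z + |M| * Z' := by positivity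
      simp [hfdef, hgdef, indicator_of_notMem hy, this]
  -- The denominator `k + 2` keeps the shift strictly below `r`, as the cone condition requires,
  -- already for `k = 0`.
  set s : ℕ → ℝ := fun k => r / (k + 2)
  have hs0 : ∀ k, 0 < s k := fun k => by positivity
  have hsr : ∀ k, s k < r := fun k => by
    have h1 : (0 : ℝ) ≤ k := k.cast_nonneg
    simp only [s]
    rw [div_lt_iff₀ (by positivity)]
    nlinarith
  have hρ : ∀ k, 0 < κ * s k := fun k => mul_pos hκ (hs0 k)
  have hslim : Tendsto s atTop (𝓝 0) := by
    have h1 : Tendsto (fun k : ℕ => (k : ℝ) + 2) atTop atTop :=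
      tendsto_atTop_add_const_right _ _ tendsto_natCast_atTop_atTop
    exact h1.const_div_atTop r
  have hρlim : Tendsto (fun k => κ * s k) atTop (𝓝 0) := by simpa using hslim.const_mul κ
  -- Shift and radius are proportional, with ratio `‖e‖ / κ`: this is the admissible eccentricity in
  -- the differentiation theorem.
  have hc : ∀ k, ‖s k • e‖ ≤ ‖e‖ / κ * (κ * s k) := fun k => by
    rw [norm_smul, Real.norm_of_nonneg (hs0 k).le]
    field_simp
    exact le_rfl
  let φ : ℕ → Pt d → Pt d := fun k x =>
    WithLp.toLp 2 fun i => mollify (f i) (s k • e) (hρ k) x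
  have hφ : ∀ k, ContDiff ℝ ∞ (φ k) := fun k =>
    contDiff_euclidean.2 fun i => contDiff_mollify (hf i) _ (hρ k)
  have hgrad : ∀ k x i j, classicalGrad (φ k) x (i, j) = mollify (g i j) (s k • e) (hρ k) x := by
    intro k x i j
    have h1 : classicalGrad (φ k) x (i, j) = fderiv ℝ (φ k) x (unitVec j) i := rfl
    rw [h1, ← fderiv_apply_coord ((hφ k).differentiable (by simp) x)]
    exact h.fderiv_mollify hΩ hζ hζc _ (hρ k) i j x
  have hsupp : ∀ k, Function.support (φ k) ⊆
      (closure Ω ∩ tsupport ζ) + Metric.closedBall (s k • e) (κ * s k) := by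
    intro k x hx
    have h1 : ∃ i, mollify (f i) (s k • e) (hρ k) x ≠ 0 := by
      by_contra! h0
      exact hx (by ext i; exact h0 i)
    obtain ⟨i, hi⟩ := h1
    refine (add_subset_add ?_ Metric.ball_subset_closedBall) (support_mollify_subset _ _ (hρ k) hi)
    intro y hy
    have hyΩ : y ∈ Ω := by
      by_contra hn
      exact hy (indicator_of_notMem hn _)
    refine ⟨subset_closure hyΩ, subset_tsupport ζ ?_⟩
    have : f i y = u y i * ζ y := indicator_of_mem hyΩ _
    rw [Function.mem_support, this] at hy
    exact right_ne_zero_of_mul hy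
  have hcompact : ∀ k,
      IsCompact ((closure Ω ∩ tsupport ζ) + Metric.closedBall (s k • e) (κ * s k)) := fun k =>
    (IsCompact.inter_left hζc isClosed_closure).add (isCompact_closedBall _ _)
  -- The kernel of radius `κ s` centred at `s e` fits into the cone, so the mollified field is
  -- supported inside `Ω`.
  have hsub : ∀ k, (closure Ω ∩ tsupport ζ) + Metric.closedBall (s k • e) (κ * s k) ⊆ Ω := by
    rintro k _ ⟨y, hy, z, hz, rfl⟩
    refine hcone y hy.1 hy.2 (s k) (hs0 k) (hsr k) ?_
    simp only [Metric.mem_closedBall, dist_add_left]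
    exact hz
  refine ⟨φ, |M| * Z + |M| * Z', fun k => ⟨hφ k,
    HasCompactSupport.of_support_subset_isCompact (hcompact k) (hsupp k),
    (closure_minimal (hsupp k) (hcompact k).isClosed).trans (hsub k)⟩, fun k x => ⟨fun i => ?_,
    fun ij => ?_⟩, ?_⟩
  · exact abs_mollify_le (hbound.mono fun y hy => hy.1 i) _ (hρ k) x
  · rw [hgrad k x ij.1 ij.2]
    exact abs_mollify_le (hbound.mono fun y hy => hy.2 ij.1 ij.2) _ (hρ k) x
  · rw [ae_restrict_iff' hΩ.measurableSet]
    have t1 := ae_all_iff.2 fun i => ae_tendsto_mollify (hf i) hρ hρlim hc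
    have t2 := ae_all_iff.2 fun i => ae_all_iff.2 fun j =>
      ae_tendsto_mollify (hg i j) hρ hρlim hc
    filter_upwards [t1, t2] with x hx1 hx2 hxΩ
    refine ⟨fun i => ?_, fun i j => ?_⟩
    · have h1 := hx1 i
      simp only [hfdef, indicator_of_mem hxΩ] at h1
      exact h1
    · have h1 := hx2 i j
      simp only [hgdef, indicator_of_mem hxΩ] at h1
      simp only [hgrad]
      exact h1

theorem tendsto_euclidean {ι : Type*} [Fintype ι] {f : ℕ → EuclideanSpace ℝ ι}
    {a : EuclideanSpace ℝ ι} (h : ∀ i, Tendsto (fun k => f k i) atTop (𝓝 (a i))) :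
    Tendsto f atTop (𝓝 a) := by
  have h1 : Tendsto (fun k => (f k).ofLp) atTop (𝓝 a.ofLp) := tendsto_pi_nhds.2 h
  exact ((PiLp.continuous_toLp 2 fun _ : ι => ℝ).tendsto a.ofLp).comp h1

theorem classicalGrad_sum {ι : Type*} (t : Finset ι) {φ : ι → Pt d → Pt d}
    (hφ : ∀ a, ContDiff ℝ ∞ (φ a)) (x : Pt d) :
    classicalGrad (fun y => ∑ a ∈ t, φ a y) x = ∑ a ∈ t, classicalGrad (φ a) x := by
  have h : fderiv ℝ (fun y => ∑ a ∈ t, φ a y) x = ∑ a ∈ t, fderiv ℝ (φ a) x :=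
    fderiv_fun_sum fun a _ => (hφ a).differentiable (by simp) x
  ext ij
  simp [classicalGrad, h]

/-- A bounded field with bounded weak gradient and zero trace is a limit of uniformly bounded test
fields with uniformly bounded gradients. -/
theorem HasZeroExtGrad.exists_approx (hΩ : IsBoundedLipschitzDomain Ω) {u : VF Ω} {G : MF Ω}
    (h : HasZeroExtGrad u G) {M : ℝ} (hu : ∀ᵐ x ∂volume.restrict Ω, ‖u x‖ ≤ M)
    (hG : ∀ᵐ x ∂volume.restrict Ω, ‖G x‖ ≤ M) :
    ∃ (φ : ℕ → Pt d → Pt d) (C : ℝ), (∀ k, IsTestField Ω (φ k)) ∧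
      (∀ k x, ‖φ k x‖ ≤ C ∧ ‖classicalGrad (φ k) x‖ ≤ C) ∧
      ∀ᵐ x ∂volume.restrict Ω, Tendsto (fun k => φ k x) atTop (𝓝 (u x)) ∧
        Tendsto (fun k => classicalGrad (φ k) x) atTop (𝓝 (G x)) := by
  obtain ⟨ι, _, ζ, hζ, hsum⟩ := hΩ.exists_partition
  choose hζ hζc e κ r hκ hr hcone using hζ
  choose φ C hφ hC hlim using fun a =>
    h.exists_local_approx hΩ.isOpen hu hG (hζ a) (hζc a) (hκ a) (hr a) (hcone a)
  have htest : ∀ (t : Finset ι) (k : ℕ), IsTestField Ω fun x => ∑ a ∈ t, φ a k x := by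
    intro t k
    classical
    induction t using Finset.induction_on with
    | empty =>
      simp only [Finset.sum_empty]
      exact ⟨contDiff_const, HasCompactSupport.zero, by simp [tsupport]⟩
    | insert a t ha ih =>
      simp only [Finset.sum_insert ha]
      exact ⟨(hφ a k).1.add ih.1, (hφ a k).2.1.add ih.2.1,
        (tsupport_add _ _).trans (union_subset (hφ a k).2.2 ih.2.2)⟩
  have hgs : ∀ k x, classicalGrad (fun y => ∑ a, φ a k y) x = ∑ a, classicalGrad (φ a k) x :=
    fun k x => classicalGrad_sum _ (fun a => (hφ a k).1) x
  have hn1 : ∀ a k x, ‖φ a k x‖ ≤ Fintype.card (Fin d) * |C a| := fun a k x =>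
    (euclidean_norm_le_of_forall _).trans <| (Finset.sum_le_card_nsmul _ _ _ fun i _ =>
      ((hC a k x).1 i).trans (le_abs_self _)).trans (by simp)
  have hn2 : ∀ a k x, ‖classicalGrad (φ a k) x‖ ≤ Fintype.card (Fin d × Fin d) * |C a| :=
    fun a k x => (euclidean_norm_le_of_forall _).trans <| (Finset.sum_le_card_nsmul _ _ _
      fun i _ => ((hC a k x).2 i).trans (le_abs_self _)).trans (by simp)
  refine ⟨fun k x => ∑ a, φ a k x,
    max (∑ a, Fintype.card (Fin d) * |C a|) (∑ a, Fintype.card (Fin d × Fin d) * |C a|),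
    htest Finset.univ, fun k x => ⟨?_, ?_⟩, ?_⟩
  · exact ((norm_sum_le _ _).trans (Finset.sum_le_sum fun a _ => hn1 a k x)).trans
      (le_max_left _ _)
  · rw [hgs]
    exact ((norm_sum_le _ _).trans (Finset.sum_le_sum fun a _ => hn2 a k x)).trans
      (le_max_right _ _)
  · filter_upwards [ae_all_iff.2 hlim, ae_restrict_mem hΩ.isOpen.measurableSet] with x hx hxΩ
    have hs1 : ∑ a, ζ a x = 1 := hsum x (subset_closure hxΩ)
    -- The cutoffs sum to one in a neighbourhood of `x`, so their derivatives cancel and the product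
    -- rule terms disappear from the limit of the gradients.
    have hs2 : ∀ v : Pt d, ∑ a, fderiv ℝ (ζ a) x v = 0 := by
      intro v
      have h1 : fderiv ℝ (fun y => ∑ a, ζ a y) x = ∑ a, fderiv ℝ (ζ a) x :=
        fderiv_fun_sum fun a _ => (hζ a).differentiable (by simp) x
      have h2 : (fun y => ∑ a, ζ a y) =ᶠ[𝓝 x] fun _ => 1 := by
        filter_upwards [hΩ.isOpen.mem_nhds hxΩ] with y hy using hsum y (subset_closure hy)
      have h3 : ∑ a, fderiv ℝ (ζ a) x = 0 := by rw [← h1, h2.fderiv_eq]; simp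
      have h4 := congrArg (fun L : Pt d →L[ℝ] ℝ => L v) h3
      simpa using h4
    refine ⟨tendsto_euclidean fun i => ?_, tendsto_euclidean fun ij => ?_⟩
    · have h1 := tendsto_finsetSum Finset.univ fun a _ => (hx a).1 i
      rw [← Finset.mul_sum, hs1, mul_one] at h1
      refine h1.congr fun k => by simp
    · have h1 := tendsto_finsetSum Finset.univ fun a _ => (hx a).2 ij.1 ij.2
      rw [Finset.sum_add_distrib, ← Finset.mul_sum, ← Finset.mul_sum, hs1, hs2, mul_one, mul_zero,
        add_zero] at h1
      refine h1.congr fun k => by rw [hgs]; simp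

/-- Such fields belong to the variable Sobolev spaces with zero boundary values. -/
theorem HasZeroExtGrad.mem_symSobolev₀ (hΩ : IsBoundedLipschitzDomain Ω) {u : VF Ω} {G : MF Ω}
    (h : HasZeroExtGrad u G) {M : ℝ} (hu : ∀ᵐ x ∂volume.restrict Ω, ‖u x‖ ≤ M)
    (hG : ∀ᵐ x ∂volume.restrict Ω, ‖G x‖ ≤ M) {q p : Pt d → ℝ}
    (hq : IsBoundedExponent (volume.restrict Ω) q) (hp : IsBoundedExponent (volume.restrict Ω) p) :
    u ∈ symSobolev₀ Ω q p := by
  have : IsFiniteMeasure (volume.restrict Ω) :=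
    ⟨by rw [Measure.restrict_apply_univ]; exact hΩ.isBounded.measure_lt_top⟩
  have hsym := h.symGrad_ae_eq hΩ.isOpen
  have hS : ∀ A : Mat d, ‖symPart d A‖ ≤ ‖symPart d‖ * ‖A‖ := (symPart d).le_opNorm
  refine ⟨⟨hq.memVarLp u.aestronglyMeasurable hu, ⟨_, h.hasWeakSymGrad⟩,
    hp.memVarLp (M := ‖symPart d‖ * M) (symGrad u).aestronglyMeasurable ?_⟩, fun δ hδ => ?_⟩
  · filter_upwards [hsym, hG] with x hx hGx
    rw [hx]
    exact (hS _).trans (mul_le_mul_of_nonneg_left hGx (norm_nonneg _))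
  -- Uniform bounds and almost everywhere convergence of fields and gradients suffice for both
  -- Luxembourg norms, for any bounded measurable exponents.
  obtain ⟨φ, C, hφ, hC, hlim⟩ := h.exists_approx hΩ hu hG
  have hd1 : ∀ k, ⇑(u - testVF Ω (hφ k)) =ᵐ[volume.restrict Ω] fun x => u x - φ k x := fun k => by
    filter_upwards [AEEqFun.coeFn_sub u (testVF Ω (hφ k)), coeFn_testVF (hφ k)] with x h1 h2
    rw [h1, Pi.sub_apply, h2]
  have hd2 : ∀ k, ⇑(symGrad (u - testVF Ω (hφ k))) =ᵐ[volume.restrict Ω]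
      fun x => symPart d (G x - classicalGrad (φ k) x) := fun k => by
    filter_upwards [(h.sub (hφ k).hasZeroExtGrad).symGrad_ae_eq hΩ.isOpen,
      AEEqFun.coeFn_sub G (testMF Ω (hφ k)), coeFn_testMF (hφ k)] with x h1 h2 h3
    rw [h1, h2, Pi.sub_apply, h3]
  have l1 : Tendsto (fun k => luxNorm (volume.restrict Ω) q fun x => u x - φ k x) atTop (𝓝 0) := by
    refine hq.tendsto_luxNorm (M := M + C) (fun k => u.aestronglyMeasurable.sub
      (hφ k).1.continuous.aestronglyMeasurable) (fun k => ?_) ?_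
    · filter_upwards [hu] with x hx
      exact (norm_sub_le _ _).trans (add_le_add hx (hC k x).1)
    · filter_upwards [hlim] with x hx
      simpa using hx.1.const_sub (u x)
  have l2 : Tendsto (fun k => luxNorm (volume.restrict Ω) p
      fun x => symPart d (G x - classicalGrad (φ k) x)) atTop (𝓝 0) := by
    refine hp.tendsto_luxNorm (M := ‖symPart d‖ * (M + C)) (fun k =>
      (symPart d).continuous.comp_aestronglyMeasurable (G.aestronglyMeasurable.sub
      (continuous_classicalGrad (hφ k).1).aestronglyMeasurable)) (fun k => ?_) ?_
    · filter_upwards [hG] with x hx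
      exact (hS _).trans (mul_le_mul_of_nonneg_left
        ((norm_sub_le _ _).trans (add_le_add hx (hC k x).2)) (norm_nonneg _))
    · filter_upwards [hlim] with x hx
      have h1 := ((symPart d).continuous.tendsto _).comp (hx.2.const_sub (G x))
      rw [sub_self, map_zero] at h1
      exact h1
  have l3 : Tendsto (fun k => sobNorm q p (u - testVF Ω (hφ k))) atTop (𝓝 0) := by
    have h1 := l1.add l2
    rw [add_zero] at h1
    refine h1.congr fun k => ?_
    rw [sobNorm, luxNorm_congr_ae (hd1 k), luxNorm_congr_ae (hd2 k)]
  obtain ⟨k, hk⟩ := (l3.eventually (gt_mem_nhds hδ)).exists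
  exact ⟨testVF Ω (hφ k), ⟨φ k, hφ k, coeFn_testVF (hφ k)⟩, hk⟩

end Density

/-! ### Bounded fields with bounded gradients and zero trace -/

section Tame

variable {d : ℕ} {Ω : Set (Pt d)}

/-- Bounded fields with zero trace and bounded weak gradient. -/
def IsTame (u : VF Ω) : Prop :=
  ∃ G : MF Ω, HasZeroExtGrad u G ∧ ∃ M : ℝ,
    (∀ᵐ x ∂volume.restrict Ω, ‖u x‖ ≤ M) ∧ ∀ᵐ x ∂volume.restrict Ω, ‖G x‖ ≤ M

theorem IsTame.mem_symSobolev₀ (hΩ : IsBoundedLipschitzDomain Ω) {u : VF Ω} (hu : IsTame u)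
    {q p : Pt d → ℝ} (hq : IsBoundedExponent (volume.restrict Ω) q)
    (hp : IsBoundedExponent (volume.restrict Ω) p) : u ∈ symSobolev₀ Ω q p :=
  let ⟨_, hG, _, h1, h2⟩ := hu
  hG.mem_symSobolev₀ hΩ h1 h2 hq hp

theorem IsTame.exists_bound {u : VF Ω} (hΩ : IsOpen Ω) (hu : IsTame u) :
    ∃ M : ℝ, (∀ᵐ x ∂volume.restrict Ω, ‖u x‖ ≤ M) ∧ ∀ᵐ x ∂volume.restrict Ω, ‖symGrad u x‖ ≤ M := by
  obtain ⟨G, hG, M, h1, h2⟩ := hu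
  refine ⟨max M (‖symPart d‖ * M), h1.mono fun x hx => hx.trans (le_max_left _ _), ?_⟩
  filter_upwards [hG.symGrad_ae_eq hΩ, h2] with x hx hGx
  rw [hx]
  exact (((symPart d).le_opNorm _).trans (mul_le_mul_of_nonneg_left hGx (norm_nonneg _))).trans
    (le_max_right _ _)

theorem IsTame.symGrad_add (hΩ : IsOpen Ω) {u v : VF Ω} (hu : IsTame u) (hv : IsTame v) :
    symGrad (u + v) = symGrad u + symGrad v := by
  obtain ⟨G, hG, -⟩ := hu
  obtain ⟨H, hH, -⟩ := hv
  refine AEEqFun.ext ?_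
  filter_upwards [(hG.add hH).symGrad_ae_eq hΩ, hG.symGrad_ae_eq hΩ, hH.symGrad_ae_eq hΩ,
    AEEqFun.coeFn_add G H, AEEqFun.coeFn_add (symGrad u) (symGrad v)] with x h1 h2 h3 h4 h5
  rw [h1, h4, h5, Pi.add_apply, Pi.add_apply, map_add, h2, h3]

theorem IsTame.symGrad_smul (hΩ : IsOpen Ω) {u : VF Ω} (hu : IsTame u) (c : ℝ) :
    symGrad (c • u) = c • symGrad u := by
  obtain ⟨G, hG, -⟩ := hu
  refine AEEqFun.ext ?_
  filter_upwards [(hG.smul c).symGrad_ae_eq hΩ, hG.symGrad_ae_eq hΩ, AEEqFun.coeFn_smul c G,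
    AEEqFun.coeFn_smul c (symGrad u)] with x h1 h2 h4 h5
  rw [h1, h4, h5, Pi.smul_apply, Pi.smul_apply, map_smul, h2]

theorem isTame_of_isContPwPoly (hΩ : IsBoundedLipschitzDomain Ω)
    {𝒯 : Geometry.SimplicialComplex ℝ (Pt d)} (h𝒯 : IsTriangulation Ω 𝒯) {m : ℕ} {v : VF Ω}
    (hv : IsContPwPoly 𝒯 m v) (hv0 : MemW110 v) : IsTame v := by
  obtain ⟨G, hG⟩ := hv0.exists_hasZeroExtGrad
  obtain ⟨M₁, h1⟩ := hv.exists_ae_bound hΩ.isBounded hΩ.isOpen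
  obtain ⟨M₂, h2⟩ := hv.exists_ae_bound_grad h𝒯 hΩ.isOpen hG.hasWeakGrad
  exact ⟨G, hG, max M₁ M₂, h1.mono fun x hx => hx.trans (le_max_left _ _),
    h2.mono fun x hx => hx.trans (le_max_right _ _)⟩

end Tame

/-! ### Time-dependent exponents and fields -/

section Time

variable {d : ℕ} {Ω : Set (Pt d)} {T : ℝ}

theorem restrict_cylinder (T : ℝ) (Ω : Set (Pt d)) :
    volume.restrict (cylinder T Ω) = (volume.restrict (Ioo 0 T)).prod (volume.restrict Ω) := by
  rw [Measure.prod_restrict]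
  rfl

/-- The slices of a bounded exponent are bounded exponents, with the same bound. -/
theorem IsBoundedExponent.exists_slice_bound {p : ℝ × Pt d → ℝ}
    (hp : IsBoundedExponent (volume.restrict (cylinder T Ω)) p) :
    ∃ C : ℝ, ∀ᵐ t ∂volume.restrict (Ioo 0 T),
      IsBoundedExponent (volume.restrict Ω) (fun x => p (t, x)) ∧
        ∀ᵐ x ∂volume.restrict Ω, 1 ≤ p (t, x) ∧ p (t, x) ≤ C := by
  obtain ⟨C, hC⟩ := hp.bounded
  obtain ⟨p', hp', hm⟩ := hp.aemeasurable
  have h1 := hp.one_le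
  rw [restrict_cylinder] at hm h1 hC
  refine ⟨C, ?_⟩
  filter_upwards [Measure.ae_ae_of_ae_prod hm, Measure.ae_ae_of_ae_prod h1,
    Measure.ae_ae_of_ae_prod hC] with t ht1 ht2 ht3
  refine ⟨⟨?_, ht2, C, ht3⟩, ht2.and ht3⟩
  refine AEMeasurable.congr ?_ (EventuallyEq.symm ht1)
  exact (hp'.comp measurable_prodMk_left).aemeasurable

theorem contDiff_slice {φ : ℝ × Pt d → ℝ} (hφ : ContDiff ℝ ∞ φ) (t : ℝ) :
    ContDiff ℝ ∞ fun x => φ (t, x) :=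
  hφ.comp (contDiff_const.prodMk contDiff_id)

theorem hasCompactSupport_slice {φ : ℝ × Pt d → ℝ} (hφ : HasCompactSupport φ) (t : ℝ) :
    HasCompactSupport fun x => φ (t, x) := by
  refine HasCompactSupport.of_support_subset_isCompact (hφ.isCompact.image continuous_snd)
    fun x hx => ⟨(t, x), subset_tsupport φ hx, rfl⟩

theorem fderiv_slice {φ : ℝ × Pt d → ℝ} (hφ : ContDiff ℝ ∞ φ) (t : ℝ) (x v : Pt d) :
    fderiv ℝ (fun x => φ (t, x)) x v = fderiv ℝ φ (t, x) (0, v) := by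
  have h : HasFDerivAt (fun x => φ (t, x)) _ x :=
    (hφ.differentiable (by simp) (t, x)).hasFDerivAt.comp x
      ((hasFDerivAt_const t x).prodMk (hasFDerivAt_id x))
  rw [h.fderiv]
  rfl

theorem integrable_cylinder_snd_mul (hΩ : Bornology.IsBounded Ω) {f : Pt d → ℝ}
    (hf : Integrable f (volume.restrict Ω)) {ψ : ℝ × Pt d → ℝ} (hψ : Continuous ψ)
    (hψc : HasCompactSupport ψ) :
    IntegrableOn (fun y : ℝ × Pt d => f y.2 * ψ y) (Ioo 0 T ×ˢ Ω) (volume.prod volume) := by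
  have : IsFiniteMeasure (volume.restrict Ω) :=
    ⟨by rw [Measure.restrict_apply_univ]; exact hΩ.measure_lt_top⟩
  obtain ⟨C, hC⟩ := hψ.bounded_above_of_compact_support hψc
  rw [IntegrableOn, ← Measure.prod_restrict]
  exact (hf.comp_snd _).mul_bdd hψ.aestronglyMeasurable (ae_of_all _ hC)

/-- Fields that do not depend on time belong to the variable Bochner--Lebesgue space. -/
theorem IsTame.mem_bochnerSpace (hΩ : IsBoundedLipschitzDomain Ω) {q p : ℝ × Pt d → ℝ}
    (hq : IsBoundedExponent (volume.restrict (cylinder T Ω)) q)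
    (hp : IsBoundedExponent (volume.restrict (cylinder T Ω)) p) {z : VF Ω} (hz : IsTame z) :
    (fun y : ℝ × Pt d => z y.2) ∈ bochnerSpace T Ω q p ∧
      ∀ t, slice Ω (fun y : ℝ × Pt d => z y.2) t = z := by
  have : IsFiniteMeasure (volume.restrict Ω) :=
    ⟨by rw [Measure.restrict_apply_univ]; exact hΩ.isBounded.measure_lt_top⟩
  have : IsFiniteMeasure (volume.restrict (cylinder T Ω)) := by
    rw [restrict_cylinder]; infer_instance
  have hslice : ∀ t, slice Ω (fun y : ℝ × Pt d => z y.2) t = z := by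
    intro t
    rw [slice, dif_pos z.aestronglyMeasurable]
    exact AEEqFun.mk_coeFn z
  have hsnd : ∀ {P : Pt d → Prop}, (∀ᵐ x ∂volume.restrict Ω, P x) →
      ∀ᵐ y : ℝ × Pt d ∂volume.restrict (cylinder T Ω), P y.2 := by
    intro P hP
    rw [restrict_cylinder]
    exact Measure.quasiMeasurePreserving_snd.ae hP
  have hz' := hz
  obtain ⟨G, hG, M, h1, h2⟩ := hz
  refine ⟨⟨hq.memVarLp (z.stronglyMeasurable.comp_measurable
    measurable_snd).aestronglyMeasurable (hsnd h1), ⟨fun y => symPart d (G y.2),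
    hp.memVarLp (M := ‖symPart d‖ * M) ((symPart d).continuous.comp_stronglyMeasurable
      (G.stronglyMeasurable.comp_measurable measurable_snd)).aestronglyMeasurable ?_, ?_⟩, ?_⟩,
    hslice⟩
  · filter_upwards [hsnd h2] with y hy
    exact ((symPart d).le_opNorm _).trans (mul_le_mul_of_nonneg_left hy (norm_nonneg _))
  · intro φ hφ hφc _ i j
    have hφd : ∀ v : Pt d, Continuous fun y : ℝ × Pt d => fderiv ℝ φ y (0, v) := fun v =>
      (hφ.continuous_fderiv (by simp)).clm_apply continuous_const
    have hφdc : ∀ v : Pt d, HasCompactSupport fun y : ℝ × Pt d => fderiv ℝ φ y (0, v) := fun v =>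
      hφc.fderiv_apply ℝ _
    have hGi : ∀ ij, Integrable (fun x => G x ij) (volume.restrict Ω) := fun ij =>
      Integrable.euclidean_apply hG.2.1 ij
    have hzi : ∀ i, Integrable (fun x => z x i) (volume.restrict Ω) := fun i =>
      Integrable.euclidean_apply hG.1 i
    have hcyl : volume.restrict (cylinder T Ω)
        = (volume.prod volume).restrict (Ioo 0 T ×ˢ Ω) := rfl
    have i1 : ∀ ij, IntegrableOn (fun y : ℝ × Pt d => G y.2 ij * φ y) (Ioo 0 T ×ˢ Ω)
        (volume.prod volume) := fun ij =>
      integrable_cylinder_snd_mul hΩ.isBounded (hGi ij) hφ.continuous hφc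
    have i2 : ∀ i j, IntegrableOn (fun y : ℝ × Pt d => z y.2 i * fderiv ℝ φ y (0, unitVec j))
        (Ioo 0 T ×ˢ Ω) (volume.prod volume) := fun i j =>
      integrable_cylinder_snd_mul hΩ.isBounded (hzi i) (hφd _) (hφdc _)
    -- By Fubini it is enough to use the spatial formula at each time. The zero extension version
    -- accepts every slice of `φ`, so the supports of the slices need no attention.
    have key : ∀ i j, ∫ y in Ioo 0 T ×ˢ Ω, G y.2 (i, j) * φ y ∂(volume.prod volume)
        = - ∫ y in Ioo 0 T ×ˢ Ω, z y.2 i * fderiv ℝ φ y (0, unitVec j) ∂(volume.prod volume) := by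
      intro i j
      rw [setIntegral_prod _ (i1 (i, j)), setIntegral_prod _ (i2 i j), ← integral_neg]
      refine integral_congr_ae (ae_of_all _ fun t => ?_)
      have h := hG.2.2 _ (contDiff_slice hφ t) (hasCompactSupport_slice hφc t) i j
      simp only [fderiv_slice hφ] at h
      exact h
    rw [hcyl, integral_add (i2 i j) (i2 j i)]
    have e1 : ∫ y in Ioo 0 T ×ˢ Ω, symPart d (G y.2) (i, j) * φ y ∂(volume.prod volume)
        = ∫ y in Ioo 0 T ×ˢ Ω, (1 / 2 : ℝ) * (G y.2 (i, j) * φ y + G y.2 (j, i) * φ y)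
          ∂(volume.prod volume) :=
      integral_congr_ae (ae_of_all _ fun y => by simp only [symPart_apply]; ring)
    rw [e1, integral_const_mul, integral_add (i1 _) (i1 _), key, key]
    ring
  · obtain ⟨_, hqs⟩ := hq.exists_slice_bound
    obtain ⟨_, hps⟩ := hp.exists_slice_bound
    filter_upwards [hqs, hps] with t ht1 ht2
    rw [hslice t]
    exact hz'.mem_symSobolev₀ hΩ ht1.1 ht2.1

/-- The exceptional set of times comes from the exponents alone and is therefore common to all
fields. -/
theorem IsTame.ae_mem_sliceSpace (hΩ : IsBoundedLipschitzDomain Ω) {q p : ℝ × Pt d → ℝ}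
    (hq : IsBoundedExponent (volume.restrict (cylinder T Ω)) q)
    (hp : IsBoundedExponent (volume.restrict (cylinder T Ω)) p) :
    ∀ᵐ t ∂volume.restrict (Ioo 0 T), ∀ z : VF Ω, IsTame z → z ∈ sliceSpace Ω q p t := by
  obtain ⟨_, hqs⟩ := hq.exists_slice_bound
  obtain ⟨_, hps⟩ := hp.exists_slice_bound
  filter_upwards [hqs, hps] with t ht1 ht2 z hz
  exact hz.mem_symSobolev₀ hΩ ht1.1 ht2.1

/-- A fixed field, regarded as constant in time, lies in the variable Bochner–Lebesgue space and has
itself as slice at every time. -/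
theorem IsMeasurableFamily.aemeasurable (hΩ : IsBoundedLipschitzDomain Ω) {q p : ℝ × Pt d → ℝ}
    (hq : IsBoundedExponent (volume.restrict (cylinder T Ω)) q)
    (hp : IsBoundedExponent (volume.restrict (cylinder T Ω)) p) {A : ℝ → VF Ω → VF Ω → ℝ}
    (hA : IsMeasurableFamily T Ω q p A) {u z : VF Ω} (hu : IsTame u) (hz : IsTame z) :
    AEMeasurable (fun t => A t u z) (volume.restrict (Ioo 0 T)) := by
  obtain ⟨hu1, hu2⟩ := hu.mem_bochnerSpace hΩ hq hp
  obtain ⟨hz1, hz2⟩ := hz.mem_bochnerSpace hΩ hq hp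
  have h := hA _ hu1 _ hz1
  simpa only [hu2, hz2] using h

/-- Bounds for `A(t)` that are uniform in time and on bounded sets. -/
theorem HasGrowth.exists_bound (hΩ : IsBoundedLipschitzDomain Ω) {q p : ℝ × Pt d → ℝ}
    (hq : IsBoundedExponent (volume.restrict (cylinder T Ω)) q)
    (hp : IsBoundedExponent (volume.restrict (cylinder T Ω)) p) {A : ℝ → VF Ω → VF Ω → ℝ}
    {𝔹 : ℝ≥0 → ℝ≥0} (h𝔹 : Monotone 𝔹) (hA : HasGrowth T Ω q p A 𝔹) (M : ℝ) (R : ℝ≥0) :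
    ∃ B : ℝ, ∀ u z : VF Ω, IsTame u → IsTame z → l2Norm u ≤ R →
      (∀ᵐ x ∂volume.restrict Ω, ‖u x‖ ≤ M) → (∀ᵐ x ∂volume.restrict Ω, ‖symGrad u x‖ ≤ M) →
      (∀ᵐ x ∂volume.restrict Ω, ‖z x‖ ≤ M) → (∀ᵐ x ∂volume.restrict Ω, ‖symGrad z x‖ ≤ M) →
      ∀ᵐ t ∂volume.restrict (Ioo 0 T), ‖A t u z‖ ≤ B := by
  have : IsFiniteMeasure (volume.restrict Ω) :=
    ⟨by rw [Measure.restrict_apply_univ]; exact hΩ.isBounded.measure_lt_top⟩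
  obtain ⟨C₁, hqs⟩ := hq.exists_slice_bound
  obtain ⟨C₂, hps⟩ := hp.exists_slice_bound
  set b₁ := max 1 M ^ C₁ * (volume.restrict Ω).real univ
  set b₂ := max 1 M ^ C₂ * (volume.restrict Ω).real univ
  refine ⟨𝔹 R * (1 + b₁ + b₂ + b₁ + b₂), fun u z hu hz hR h1 h2 h3 h4 => ?_⟩
  filter_upwards [hA, hqs, hps, IsTame.ae_mem_sliceSpace hΩ hq hp] with t ht hqt hpt hmem
  refine (ht u (hmem u hu) z (hmem z hz)).trans ?_
  refine mul_le_mul (by exact_mod_cast h𝔹 hR) ?_ (by positivity) (by positivity)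
  gcongr
  · exact modular_toReal_le_of_bound hqt.2 h1
  · exact modular_toReal_le_of_bound hpt.2 h2
  · exact modular_toReal_le_of_bound hqt.2 h3
  · exact modular_toReal_le_of_bound hpt.2 h4

/-! ### The right-hand side -/

theorem integrable_inner_snd {ι : Type*} [Fintype ι] {f : ℝ × Pt d → EuclideanSpace ℝ ι}
    (hf : Integrable f (volume.restrict (cylinder T Ω)))
    {z : Pt d →ₘ[volume.restrict Ω] EuclideanSpace ℝ ι}
    {M : ℝ} (hz : ∀ᵐ x ∂volume.restrict Ω, ‖z x‖ ≤ M) :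
    Integrable (fun y : ℝ × Pt d => inner ℝ (f y) (z y.2))
      ((volume.restrict (Ioo 0 T)).prod (volume.restrict Ω)) := by
  rw [restrict_cylinder] at hf
  have hzm : AEStronglyMeasurable (fun y : ℝ × Pt d => z y.2)
      ((volume.restrict (Ioo 0 T)).prod (volume.restrict Ω)) :=
    (z.stronglyMeasurable.comp_measurable measurable_snd).aestronglyMeasurable
  refine (hf.norm.mul_const M).mono' (hf.aestronglyMeasurable.inner hzm) ?_
  have h := (Measure.quasiMeasurePreserving_snd (μ := volume.restrict (Ioo 0 T))).ae hz
  filter_upwards [h] with y hy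
  exact (norm_inner_le_norm _ _).trans (mul_le_mul_of_nonneg_left hy (norm_nonneg _))

/-- Pointwise `|u| ≤ 1 + |u|^p` when `p ≥ 1`. Integrability of the data is all that is needed,
because the fields they are paired with are bounded and have bounded symmetric gradients. -/
theorem integrable_of_memVarLp {α F : Type*} [MeasurableSpace α] [NormedAddCommGroup F]
    {μ : Measure α} [IsFiniteMeasure μ] {p : α → ℝ} (hp : ∀ᵐ x ∂μ, 1 ≤ p x) {u : α → F}
    (hu : MemVarLp μ p u) : Integrable u μ := by
  refine ⟨hu.1, ?_⟩
  have h : ∫⁻ x, ‖u x‖ₑ ∂μ ≤ ∫⁻ x, (1 + ENNReal.ofReal (‖u x‖ ^ p x)) ∂μ := by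
    refine lintegral_mono_ae (hp.mono fun x hx => ?_)
    rw [← ofReal_norm, ← ENNReal.ofReal_one, ← ENNReal.ofReal_add zero_le_one (by positivity)]
    refine ENNReal.ofReal_le_ofReal ?_
    rcases le_total ‖u x‖ 1 with h1 | h1
    · linarith [Real.rpow_nonneg (norm_nonneg (u x)) (p x)]
    · linarith [Real.self_le_rpow_of_one_le h1 hx]
  refine h.trans_lt ?_
  rw [lintegral_add_left measurable_const, lintegral_const, one_mul]
  exact ENNReal.add_lt_top.2 ⟨measure_lt_top μ univ, hu.2⟩

theorem integrable_rhsPairing (hΩ : IsBoundedLipschitzDomain Ω) {f : ℝ × Pt d → Pt d}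
    (hf : Integrable f (volume.restrict (cylinder T Ω))) {F : ℝ × Pt d → Mat d}
    (hF : Integrable F (volume.restrict (cylinder T Ω))) {z : VF Ω} (hz : IsTame z) :
    Integrable (fun t => rhsPairing f F t z) (volume.restrict (Ioo 0 T)) := by
  obtain ⟨M, h1, h2⟩ := hz.exists_bound hΩ.isOpen
  exact (integrable_inner_snd hf h1).integral_prod_left.add
    (integrable_inner_snd hF h2).integral_prod_left

/-- Splitting the integrals requires integrable time slices of the data products, which Fubini
provides only for almost every `t`. -/
theorem rhsPairing_add (hΩ : IsBoundedLipschitzDomain Ω) {f : ℝ × Pt d → Pt d}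
    (hf : Integrable f (volume.restrict (cylinder T Ω))) {F : ℝ × Pt d → Mat d}
    (hF : Integrable F (volume.restrict (cylinder T Ω))) {z w : VF Ω} (hz : IsTame z)
    (hw : IsTame w) : ∀ᵐ t ∂volume.restrict (Ioo 0 T),
      rhsPairing f F t (z + w) = rhsPairing f F t z + rhsPairing f F t w := by
  obtain ⟨M, h1, h2⟩ := hz.exists_bound hΩ.isOpen
  obtain ⟨N, h3, h4⟩ := hw.exists_bound hΩ.isOpen
  filter_upwards [(integrable_inner_snd hf h1).prod_right_ae,
    (integrable_inner_snd hF h2).prod_right_ae, (integrable_inner_snd hf h3).prod_right_ae,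
    (integrable_inner_snd hF h4).prod_right_ae] with t t1 t2 t3 t4
  have e1 : ∫ x in Ω, inner ℝ (f (t, x)) ((z + w) x)
      = (∫ x in Ω, inner ℝ (f (t, x)) (z x)) + ∫ x in Ω, inner ℝ (f (t, x)) (w x) := by
    rw [← integral_add t1 t3]
    refine integral_congr_ae ((AEEqFun.coeFn_add z w).mono fun x hx => ?_)
    simp only [hx, Pi.add_apply, inner_add_right]
  have e2 : ∫ x in Ω, inner ℝ (F (t, x)) (symGrad (z + w) x)
      = (∫ x in Ω, inner ℝ (F (t, x)) (symGrad z x))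
        + ∫ x in Ω, inner ℝ (F (t, x)) (symGrad w x) := by
    rw [← integral_add t2 t4, hz.symGrad_add hΩ.isOpen hw]
    refine integral_congr_ae ((AEEqFun.coeFn_add (symGrad z) (symGrad w)).mono fun x hx => ?_)
    simp only [hx, Pi.add_apply, inner_add_right]
  simp only [rhsPairing, e1, e2]
  ring

theorem rhsPairing_smul (hΩ : IsOpen Ω) (f : ℝ × Pt d → Pt d) (F : ℝ × Pt d → Mat d) {z : VF Ω}
    (hz : IsTame z) (c t : ℝ) : rhsPairing f F t (c • z) = c * rhsPairing f F t z := by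
  have e1 : ∫ x in Ω, inner ℝ (f (t, x)) ((c • z) x)
      = c * ∫ x in Ω, inner ℝ (f (t, x)) (z x) := by
    rw [← integral_const_mul]
    refine integral_congr_ae ((AEEqFun.coeFn_smul c z).mono fun x hx => ?_)
    simp only [hx, Pi.smul_apply, inner_smul_right]
  have e2 : ∫ x in Ω, inner ℝ (F (t, x)) (symGrad (c • z) x)
      = c * ∫ x in Ω, inner ℝ (F (t, x)) (symGrad z x) := by
    rw [← integral_const_mul, hz.symGrad_smul hΩ]
    refine integral_congr_ae ((AEEqFun.coeFn_smul c (symGrad z)).mono fun x hx => ?_)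
    simp only [hx, Pi.smul_apply, inner_smul_right]
  simp only [rhsPairing, e1, e2, mul_add]

end Time

/-! ### The Galerkin space with the `L²` inner product -/

section Galerkin

variable {d : ℕ} {Ω : Set (Pt d)} {T : ℝ}

/-- Solvability of an implicit Euler step in finite dimension. -/
theorem exists_solution_of_semicoercive {E : Type*} [NormedAddCommGroup E] [InnerProductSpace ℝ E]
    [FiniteDimensional ℝ E] {τ c₁ c₂ : ℝ} (hτ : 0 < τ) (hτc : c₁ * τ < 1) {𝒜 : E → E →ₗ[ℝ] ℝ}
    (h𝒜 : ∀ z, Continuous fun u => 𝒜 u z) (hc₂ : 0 ≤ c₂)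
    (hcoer : ∀ u, - c₁ * ‖u‖ ^ 2 - c₂ ≤ 𝒜 u u) (ρ : E →ₗ[ℝ] ℝ) (w : E) :
    ∃ u, ∀ z, τ⁻¹ * inner ℝ (u - w) z + 𝒜 u z = ρ z := by
  let Φ : E → E →ₗ[ℝ] ℝ := fun u => τ⁻¹ • (innerₛₗ ℝ (u - w) : E →ₗ[ℝ] ℝ) + 𝒜 u - ρ
  have hΦ : ∀ u z, Φ u z = τ⁻¹ * inner ℝ (u - w) z + 𝒜 u z - ρ z := fun u z => rfl
  have ha : 0 < τ⁻¹ - c₁ := by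
    have : c₁ < τ⁻¹ := by rwa [← one_div, lt_div_iff₀ hτ]
    exact sub_pos.2 this
  set a : ℝ := τ⁻¹ - c₁ with hadef
  set b : ℝ := τ⁻¹ * ‖w‖ + ‖ρ.toContinuousLinearMap‖ with hbdef
  have hb : 0 ≤ b := by positivity
  -- With this radius `a R = b + c₂ + a`, so `a R² - b R - c₂ = c₂ (R - 1) + a R > 0`.
  set R : ℝ := (b + c₂) / a + 1 with hRdef
  have hR1 : 1 ≤ R := by
    have : 0 ≤ (b + c₂) / a := by positivity
    linarith
  have haR : a * R = b + c₂ + a := by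
    rw [hRdef]
    field_simp
  have hcont : ∀ z, Continuous fun u => Φ u z := fun z => by
    simp only [hΦ]
    exact ((continuous_const.mul ((continuous_id.sub continuous_const).inner
      continuous_const)).add (h𝒜 z)).sub continuous_const
  obtain ⟨u, hu⟩ := exists_forall_eq_zero Φ hcont (R := R) (by linarith) fun u huR => by
    rw [hΦ, inner_sub_left, real_inner_self_eq_norm_sq]
    have h1 := hcoer u
    have h2 : ρ u ≤ ‖ρ.toContinuousLinearMap‖ * ‖u‖ :=
      (le_abs_self _).trans (ρ.toContinuousLinearMap.le_opNorm u)
    have h3 : τ⁻¹ * inner ℝ w u ≤ τ⁻¹ * (‖w‖ * ‖u‖) :=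
      mul_le_mul_of_nonneg_left (real_inner_le_norm _ _) (by positivity)
    rw [huR] at h1 h2 h3 ⊢
    have h4 : 0 < a * R ^ 2 - b * R - c₂ := by
      have h5 : a * R ^ 2 = R * (b + c₂ + a) := by rw [← haR]; ring
      rw [h5]
      nlinarith [mul_nonneg hc₂ (sub_nonneg.2 hR1), mul_pos ha (by linarith : 0 < R)]
    have h6 : a * R ^ 2 = τ⁻¹ * R ^ 2 - c₁ * R ^ 2 := by rw [hadef]; ring
    have h7 : b * R = τ⁻¹ * (‖w‖ * R) + ‖ρ.toContinuousLinearMap‖ * R := by rw [hbdef]; ring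
    rw [mul_sub]
    linarith
  exact ⟨u, fun z => sub_eq_zero.1 (hu z)⟩

/-- On a finite dimensional space of bounded functions, the supremum norm is controlled. -/
theorem exists_sup_bound {α E F : Type*} [MeasurableSpace α] {μ : Measure α}
    [NormedAddCommGroup F] [NormedSpace ℝ F] [NormedAddCommGroup E] [NormedSpace ℝ E]
    [FiniteDimensional ℝ E] (S : E →ₗ[ℝ] (α →ₘ[μ] F))
    (hS : ∀ u, ∃ M : ℝ, ∀ᵐ x ∂μ, ‖S u x‖ ≤ M) :
    ∃ C : ℝ, ∀ u, ∀ᵐ x ∂μ, ‖S u x‖ ≤ C * ‖u‖ := by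
  have hmem : ∀ u, S u ∈ Lp F ⊤ μ := fun u => by
    obtain ⟨M, hM⟩ := hS u
    exact Lp.mem_Lp_iff_memLp.2 (memLp_top_of_bound (S u).aestronglyMeasurable M hM)
  -- A linear map from a finite dimensional space into `L^∞` is bounded, and its operator norm is
  -- the constant.
  let S' : E →ₗ[ℝ] Lp F ⊤ μ :=
    { toFun := fun u => ⟨S u, hmem u⟩
      map_add' := fun u v => Subtype.ext (S.map_add u v)
      map_smul' := fun c u => Subtype.ext (S.map_smul c u) }
  refine ⟨‖S'.toContinuousLinearMap‖, fun u => ?_⟩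
  have h1 : ‖S' u‖ ≤ ‖S'.toContinuousLinearMap‖ * ‖u‖ := S'.toContinuousLinearMap.le_opNorm u
  have h2 : eLpNormEssSup (S u) μ ≠ ⊤ := by
    have := (Lp.mem_Lp_iff_memLp.1 (hmem u)).2.ne
    rwa [eLpNorm_exponent_top] at this
  filter_upwards [ae_le_eLpNormEssSup (f := S u) (μ := μ)] with x hx
  refine le_trans ?_ h1
  have h3 := ENNReal.toReal_mono h2 hx
  rw [toReal_enorm] at h3
  refine h3.trans_eq ?_
  rw [Lp.norm_def, eLpNorm_exponent_top]
  rfl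

/-- On a finite dimensional space of fields, the supremum norms of the fields and of their symmetric gradients are
controlled by any norm. -/
theorem exists_sup_bound_symGrad {E : Type*} [NormedAddCommGroup E] [NormedSpace ℝ E]
    [FiniteDimensional ℝ E] (hΩ : IsOpen Ω) (ι : E →ₗ[ℝ] VF Ω) (htame : ∀ u, IsTame (ι u)) :
    ∃ C : ℝ, ∀ (u : E) (R : ℝ), ‖u‖ ≤ R →
      (∀ᵐ x ∂volume.restrict Ω, ‖ι u x‖ ≤ C * R) ∧
        ∀ᵐ x ∂volume.restrict Ω, ‖symGrad (ι u) x‖ ≤ C * R := by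
  obtain ⟨C₁, hC₁⟩ := exists_sup_bound ι fun u =>
    let ⟨M, hM, _⟩ := (htame u).exists_bound hΩ
    ⟨M, hM⟩
  -- `symGrad` is defined by choice, but it is linear along fields of the range of `ι`, which are
  -- tame.
  let S : E →ₗ[ℝ] MF Ω :=
    { toFun := fun u => symGrad (ι u)
      map_add' := fun u v => by
        rw [map_add, (htame u).symGrad_add hΩ (htame v)]
      map_smul' := fun a u => by
        rw [map_smul, (htame u).symGrad_smul hΩ, RingHom.id_apply] }
  obtain ⟨C₂, hC₂⟩ := exists_sup_bound S fun u =>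
    let ⟨M, _, hM⟩ := (htame u).exists_bound hΩ
    ⟨M, hM⟩
  set C := max C₁ C₂
  refine ⟨|C|, ?_⟩
  intro u R hR
  refine ⟨(hC₁ u).mono fun x hx => hx.trans ?_, (hC₂ u).mono fun x hx => hx.trans ?_⟩
  · exact mul_le_mul ((le_max_left _ _).trans (le_abs_self C)) hR (norm_nonneg _) (abs_nonneg _)
  · exact mul_le_mul ((le_max_right _ _).trans (le_abs_self C)) hR (norm_nonneg _) (abs_nonneg _)

/-- One step of the implicit scheme can be solved in a finite dimensional space of fields. -/
theorem exists_scheme_step_of_linearMap (hΩ : IsBoundedLipschitzDomain Ω) {q p : ℝ × Pt d → ℝ}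
    (hq : IsBoundedExponent (volume.restrict (cylinder T Ω)) q)
    (hp : IsBoundedExponent (volume.restrict (cylinder T Ω)) p) {A : ℝ → VF Ω → VF Ω → ℝ}
    (hA : IsOperatorFamily T Ω q p A) (hA_demicont : IsDemicontinuous T Ω q p A)
    (hA_meas : IsMeasurableFamily T Ω q p A) {𝔹 : ℝ≥0 → ℝ≥0} (h𝔹 : Monotone 𝔹)
    (hA_growth : HasGrowth T Ω q p A 𝔹) {c₀ c₁ c₂ : ℝ} (hc₀ : 0 < c₀) (hc₂ : 0 ≤ c₂)
    (hA_coer : IsSemicoercive T Ω q p A c₀ c₁ c₂) {f : ℝ × Pt d → Pt d}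
    (hf : Integrable f (volume.restrict (cylinder T Ω))) {F : ℝ × Pt d → Mat d}
    (hF : Integrable F (volume.restrict (cylinder T Ω)))
    {E : Type*} [NormedAddCommGroup E] [InnerProductSpace ℝ E] [FiniteDimensional ℝ E]
    (ι : E →ₗ[ℝ] VF Ω) (htame : ∀ u, IsTame (ι u)) (hnorm : ∀ u, (l2Norm (ι u) : ℝ) = ‖u‖)
    {J : Set ℝ} (hJ : J ⊆ Ioc 0 T) (hJ0 : volume J ≠ 0) {τ : ℝ} (hτ : 0 < τ) (hτc : c₁ * τ < 1)
    (w : E) :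
    ∃ v : E, ∀ z : E, IntegrableOn (fun t => A t (ι v) (ι z)) J ∧
      IntegrableOn (fun t => rhsPairing f F t (ι z)) J ∧
      τ⁻¹ * inner ℝ (v - w) z + (⨍ t in J, A t (ι v) (ι z)) = ⨍ t in J, rhsPairing f F t (ι z) := by
  have hΩf : IsFiniteMeasure (volume.restrict Ω) :=
    ⟨by rw [Measure.restrict_apply_univ]; exact hΩ.isBounded.measure_lt_top⟩
  have hJtop : volume J ≠ ⊤ := ((measure_mono hJ).trans_lt measure_Ioc_lt_top).ne
  have hJf : IsFiniteMeasure (volume.restrict J) :=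
    ⟨by rw [Measure.restrict_apply_univ]; exact hJtop.lt_top⟩
  -- The interval may contain the endpoint `T`, which is a null set.
  have hJle : volume.restrict J ≤ volume.restrict (Ioo 0 T) := by
    rw [Measure.restrict_congr_set (Ioo_ae_eq_Ioc (μ := volume) (a := (0 : ℝ)) (b := T))]
    exact Measure.restrict_mono hJ le_rfl
  have hJac : ∀ {P : ℝ → Prop}, (∀ᵐ t ∂volume.restrict (Ioo 0 T), P t) →
      ∀ᵐ t ∂volume.restrict J, P t := fun h => ae_mono hJle h
  set c : ℝ := (volume.real J)⁻¹
  have hcpos : 0 < c := inv_pos.2 (ENNReal.toReal_pos hJ0 hJtop)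
  have hslice := hJac (IsTame.ae_mem_sliceSpace hΩ hq hp)
  obtain ⟨C, hCu⟩ := exists_sup_bound_symGrad hΩ.isOpen ι htame
  -- The bound is uniform over a ball of fields, so it serves as the majorant along convergent
  -- sequences; the null set of times may depend on `u`.
  have hbound : ∀ (R : ℝ≥0) (z : E), ∃ B : ℝ, ∀ u : E, ‖u‖ ≤ R →
      ∀ᵐ t ∂volume.restrict J, ‖A t (ι u) (ι z)‖ ≤ B := by
    intro R z
    obtain ⟨B, hB⟩ := hA_growth.exists_bound hΩ hq hp h𝔹 (C * max (R : ℝ) ‖z‖) R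
    refine ⟨B, fun u hu => ?_⟩
    refine hJac (P := fun t => ‖A t (ι u) (ι z)‖ ≤ B) ?_
    refine hB _ _ (htame u) (htame z) ?_ ?_ ?_ ?_ ?_
    · exact_mod_cast (hnorm u).trans_le hu
    · exact (hCu u _ (hu.trans (le_max_left _ _))).1
    · exact (hCu u _ (hu.trans (le_max_left _ _))).2
    · exact (hCu z _ (le_max_right _ _)).1
    · exact (hCu z _ (le_max_right _ _)).2
  have hmeas : ∀ u z : E, AEStronglyMeasurable
      (fun t => A t (ι u) (ι z)) (volume.restrict J) := fun u z =>
    ((hA_meas.aemeasurable hΩ hq hp (htame u) (htame z)).mono_measure hJle).aestronglyMeasurable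
  have hint : ∀ u z : E,
      IntegrableOn (fun t => A t (ι u) (ι z)) J := fun u z => by
    obtain ⟨B, hB⟩ := hbound ‖u‖₊ z
    exact Integrable.of_bound (hmeas u z) B (hB u le_rfl)
  have hrint : ∀ z : E, IntegrableOn (fun t => rhsPairing f F t (ι z)) J :=
    fun z => (integrable_rhsPairing hΩ hf hF (htame z)).mono_measure hJle
  obtain ⟨ρ, hρ⟩ : ∃ ρ : E →ₗ[ℝ] ℝ,
      ∀ z, ρ z = c * ∫ t in J, rhsPairing f F t (ι z) := ⟨
    { toFun := fun z => c * ∫ t in J, rhsPairing f F t (ι z)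
      map_add' := fun z z' => by
        rw [← mul_add, ← integral_add (hrint z) (hrint z')]
        congr 1
        refine integral_congr_ae (hJac ?_)
        rw [map_add]
        exact rhsPairing_add hΩ hf hF (htame z) (htame z')
      map_smul' := fun a z => by
        simp only [map_smul, rhsPairing_smul hΩ.isOpen f F (htame z), integral_const_mul,
          RingHom.id_apply, smul_eq_mul]
        ring }, fun z => rfl⟩
  have hdual := hJac hA
  obtain ⟨𝒜, h𝒜⟩ : ∃ 𝒜 : E → E →ₗ[ℝ] ℝ,
      ∀ u z, 𝒜 u z = c * ∫ t in J, A t (ι u) (ι z) := ⟨fun u =>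
    { toFun := fun z => c * ∫ t in J, A t (ι u) (ι z)
      map_add' := fun z z' => by
        rw [← mul_add, ← integral_add (hint u z) (hint u z')]
        congr 1
        refine integral_congr_ae ?_
        filter_upwards [hdual, hslice] with t h1 h2
        rw [map_add]
        exact (h1 _ (h2 _ (htame u))).map_add _ (h2 _ (htame z)) _ (h2 _ (htame z'))
      map_smul' := fun a z => by
        have e : ∫ t in J, A t (ι u) (ι (a • z))
            = ∫ t in J, a * A t (ι u) (ι z) := by
          refine integral_congr_ae ?_
          filter_upwards [hdual, hslice] with t h1 h2
          rw [map_smul]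
          exact (h1 _ (h2 _ (htame u))).map_smul a _ (h2 _ (htame z))
        rw [e, integral_const_mul, RingHom.id_apply, smul_eq_mul]
        ring }, fun u z => rfl⟩
  -- Convergence in the finite dimensional space is uniform convergence of fields and symmetric
  -- gradients, hence convergence in the slice space at almost every time. Demi-continuity then
  -- gives pointwise convergence of the integrands, and dominated convergence finishes.
  have h𝒜cont : ∀ z, Continuous fun u => 𝒜 u z := by
    intro z
    simp only [h𝒜]
    refine continuous_const.mul (continuous_iff_seqContinuous.2 fun uj u hu => ?_)
    obtain ⟨R, hR⟩ := hu.norm.bddAbove_range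
    have hR' : ∀ j, ‖uj j‖ ≤ R.toNNReal := fun j =>
      (hR (mem_range_self j)).trans (Real.le_coe_toNNReal R)
    obtain ⟨B, hB⟩ := hbound R.toNNReal z
    refine tendsto_integral_of_dominated_convergence (fun _ => B) (fun j => hmeas (uj j) z)
      (integrable_const B) (fun j => hB _ (hR' j)) ?_
    obtain ⟨_, hqs⟩ := hq.exists_slice_bound
    obtain ⟨_, hps⟩ := hp.exists_slice_bound
    have ha : Tendsto (fun j => C * ‖uj j - u‖) atTop (𝓝 0) := by
      have h1 := (tendsto_iff_norm_sub_tendsto_zero.1 hu).const_mul C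
      rwa [mul_zero] at h1
    filter_upwards [hJac hA_demicont, hslice, hJac hqs, hJac hps] with t h1 h2 h3 h4
    refine h1 (fun j => ι (uj j)) _ (h2 _ (htame u)) (fun j => h2 _ (htame _)) ?_ _
      (h2 _ (htame z))
    have e : ∀ j, ι (uj j) - ι u = ι (uj j - u) := fun j =>
      (map_sub _ _ _).symm
    simp only [e, sliceNorm, sobNorm]
    have l1 := h3.1.tendsto_luxNorm_of_bound ha
      (fun j => (ι (uj j - u)).aestronglyMeasurable) fun j => (hCu (uj j - u) _ le_rfl).1
    have l2 := h4.1.tendsto_luxNorm_of_bound ha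
      (fun j => (symGrad (ι (uj j - u))).aestronglyMeasurable)
      fun j => (hCu (uj j - u) _ le_rfl).2
    simpa using l1.add l2
  have h𝒜coer : ∀ u, - c₁ * ‖u‖ ^ 2 - c₂ ≤ 𝒜 u u := by
    intro u
    have h1 : ∫ _ in J, (- c₁ * ‖u‖ ^ 2 - c₂) ≤ ∫ t in J, A t (ι u) (ι u) := by
      refine integral_mono_ae (integrable_const _) (hint u u) ?_
      filter_upwards [hJac hA_coer, hslice] with t h2 h3
      have h4 := h2 _ (h3 _ (htame u))
      rw [hnorm] at h4
      -- The modular term is nonnegative and is discarded: solvability needs only a lower bound that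
      -- is quadratic in the `L²` norm.
      have h5 : 0 ≤ c₀ * (modular (volume.restrict Ω) (fun x => p (t, x))
        (symGrad (ι u))).toReal := by positivity
      change - c₁ * ‖u‖ ^ 2 - c₂ ≤ _
      linarith
    rw [setIntegral_const, smul_eq_mul] at h1
    have h2 := mul_le_mul_of_nonneg_left h1 hcpos.le
    rw [← mul_assoc, inv_mul_cancel₀ (inv_pos.1 hcpos).ne', one_mul] at h2
    rw [h𝒜]
    exact h2
  obtain ⟨u, hu⟩ := exists_solution_of_semicoercive hτ hτc h𝒜cont hc₂ h𝒜coer ρ w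
  refine ⟨u, fun z => ⟨hint u z, hrint z, ?_⟩⟩
  have h1 := hu z
  rw [h𝒜, hρ] at h1
  rw [setAverage_eq, setAverage_eq, smul_eq_mul, smul_eq_mul]
  exact h1

/-- Square integrable fields as fields on `Ω`. -/
noncomputable def lpToVF (Ω : Set (Pt d)) : Lp (Pt d) 2 (volume.restrict Ω) →ₗ[ℝ] VF Ω where
  toFun f := f.1
  map_add' _ _ := rfl
  map_smul' _ _ := rfl

/-- The space `W` with the `L²` inner product. -/
noncomputable abbrev l2Space (W : Submodule ℝ (VF Ω)) :
    Submodule ℝ (Lp (Pt d) 2 (volume.restrict Ω)) :=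
  W.comap (lpToVF Ω)

/-- The field on `Ω` which corresponds to an element of `l2Space W`. -/
noncomputable def toField (W : Submodule ℝ (VF Ω)) : l2Space W →ₗ[ℝ] VF Ω :=
  lpToVF Ω ∘ₗ (l2Space W).subtype

theorem toField_mem {W : Submodule ℝ (VF Ω)} (u : l2Space W) : toField W u ∈ W := u.2

/-- Tame fields are bounded on a domain of finite measure, hence square integrable, so no field of
`W` is lost in passing to `L²`. -/
theorem exists_toField_eq (hΩ : IsBoundedLipschitzDomain Ω) {W : Submodule ℝ (VF Ω)} {z : VF Ω}
    (hz : z ∈ W) (hzt : IsTame z) : ∃ u : l2Space W, toField W u = z := by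
  have : IsFiniteMeasure (volume.restrict Ω) :=
    ⟨by rw [Measure.restrict_apply_univ]; exact hΩ.isBounded.measure_lt_top⟩
  obtain ⟨M, hM, -⟩ := hzt.exists_bound hΩ.isOpen
  exact ⟨⟨⟨z, Lp.mem_Lp_iff_memLp.2 (MemLp.of_bound z.aestronglyMeasurable M hM)⟩, hz⟩, rfl⟩

theorem finiteDimensional_l2Space (W : Submodule ℝ (VF Ω)) [FiniteDimensional ℝ W] :
    FiniteDimensional ℝ (l2Space W) := by
  refine FiniteDimensional.of_injective (V₂ := W) ((toField W).codRestrict W toField_mem) fun u v huv => ?_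
  have h : toField W u = toField W v := congrArg (Subtype.val : W → VF Ω) huv
  exact Subtype.ext (Subtype.ext h)

theorem coe_l2Norm_toField {W : Submodule ℝ (VF Ω)} (u : l2Space W) :
    (l2Norm (toField W u) : ℝ) = ‖u‖ := rfl

theorem l2Inner_smul_left (c : ℝ) (u z : VF Ω) : l2Inner (c • u) z = c * l2Inner u z := by
  rw [l2Inner, l2Inner, ← integral_const_mul]
  refine integral_congr_ae ((AEEqFun.coeFn_smul c u).mono fun x hx => ?_)
  simp only [hx, Pi.smul_apply, real_inner_smul_left]

theorem l2Inner_toField {W : Submodule ℝ (VF Ω)} (u v : l2Space W) :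
    l2Inner (toField W u) (toField W v) = inner ℝ u v := by
  rw [Submodule.coe_inner, L2.inner_def]
  rfl

/-- One step of the implicit scheme can be solved. -/
theorem exists_scheme_step (hΩ : IsBoundedLipschitzDomain Ω) {q p : ℝ × Pt d → ℝ}
    (hq : IsBoundedExponent (volume.restrict (cylinder T Ω)) q)
    (hp : IsBoundedExponent (volume.restrict (cylinder T Ω)) p) {A : ℝ → VF Ω → VF Ω → ℝ}
    (hA : IsOperatorFamily T Ω q p A) (hA_demicont : IsDemicontinuous T Ω q p A)
    (hA_meas : IsMeasurableFamily T Ω q p A) {𝔹 : ℝ≥0 → ℝ≥0} (h𝔹 : Monotone 𝔹)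
    (hA_growth : HasGrowth T Ω q p A 𝔹) {c₀ c₁ c₂ : ℝ} (hc₀ : 0 < c₀) (hc₂ : 0 ≤ c₂)
    (hA_coer : IsSemicoercive T Ω q p A c₀ c₁ c₂) {f : ℝ × Pt d → Pt d}
    (hf : Integrable f (volume.restrict (cylinder T Ω))) {F : ℝ × Pt d → Mat d}
    (hF : Integrable F (volume.restrict (cylinder T Ω))) {W : Submodule ℝ (VF Ω)}
    [FiniteDimensional ℝ W] (hW : ∀ z ∈ W, IsTame z) {J : Set ℝ} (hJ : J ⊆ Ioc 0 T)
    (hJ0 : volume J ≠ 0) {τ : ℝ} (hτ : 0 < τ) (hτc : c₁ * τ < 1) {w : VF Ω} (hw : w ∈ W) :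
    ∃ v ∈ W, ∀ z ∈ W, IntegrableOn (fun t => A t v z) J ∧
      IntegrableOn (fun t => rhsPairing f F t z) J ∧
      l2Inner (τ⁻¹ • (v - w)) z + (⨍ t in J, A t v z) = ⨍ t in J, rhsPairing f F t z := by
  have hE := finiteDimensional_l2Space W
  obtain ⟨w', rfl⟩ := exists_toField_eq hΩ hw (hW w hw)
  obtain ⟨u, hu⟩ := exists_scheme_step_of_linearMap hΩ hq hp hA hA_demicont hA_meas h𝔹 hA_growth hc₀
    hc₂ hA_coer hf hF (toField W) (fun u => hW _ (toField_mem u)) coe_l2Norm_toField hJ hJ0 hτ hτc w'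
  refine ⟨toField W u, toField_mem u, fun z hz => ?_⟩
  obtain ⟨z', rfl⟩ := exists_toField_eq hΩ hz (hW z hz)
  obtain ⟨h1, h2, h3⟩ := hu z'
  refine ⟨h1, h2, ?_⟩
  rw [l2Inner_smul_left, ← map_sub, l2Inner_toField]
  exact h3

end Galerkin

/-- For real functions the essential supremum is an almost everywhere upper bound because the
exponent is bounded; a nonzero measure supplies a point at which to compare. -/
theorem IsBoundedExponent.one_le_essSup {α : Type*} [MeasurableSpace α] {μ : Measure α}
    (hμ : μ ≠ 0) {p : α → ℝ} (hp : IsBoundedExponent μ p) : 1 ≤ essSup p μ := by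
  obtain ⟨C, hC⟩ := hp.bounded
  have h1 : ∀ᵐ x ∂μ, p x ≤ essSup p μ := ae_le_essSup ⟨C, hC⟩
  have : (ae μ).NeBot := ae_neBot.2 hμ
  obtain ⟨x, hx1, hx2⟩ := (hp.one_le.and h1).exists
  exact hx1.trans hx2

end RotheGalerkin

/-! ### Assembly of the time steps -/

theorem proposition6p3 {d : ℕ} (hd : 2 ≤ d) {Ω : Set (Pt d)} (hΩ : IsBoundedLipschitzDomain Ω)
    {T : ℝ} (hT : 0 < T)
    -- the exponents
    (p : ℝ × Pt d → ℝ) (hp : IsBoundedExponent (volume.restrict (cylinder T Ω)) p)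
    (pMinus : ℝ) (hpMinus : pMinus = essInf p (volume.restrict (cylinder T Ω)))
    (hpMinus_two : 2 ≤ pMinus)
    (ε : ℝ) (hε_pos : 0 < ε) (hε_le : ε ≤ 2 / d * pMinus)
    (pn qn : ℕ → ℝ × Pt d → ℝ)
    (hpn : ∀ n, IsBoundedExponent (volume.restrict (cylinder T Ω)) (pn n))
    (hpn_ge : ∀ n, ∀ᵐ y ∂volume.restrict (cylinder T Ω), pMinus ≤ pn n y)
    (hqn : ∀ n y, qn n y = pn n y * ((d + 2) / d) - ε)
    -- the triangulations and the finite element spaces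
    (m l : ℕ) (hm : 1 ≤ m)
    (𝒯 : ℕ → Geometry.SimplicialComplex ℝ (Pt d)) (h𝒯 : ∀ n, IsTriangulation Ω (𝒯 n))
    (V : ℕ → Submodule ℝ (VF Ω)) (hV : ∀ n, ∀ v ∈ V n, IsContPwPoly (𝒯 n) m v)
    (Q : ℕ → Submodule ℝ (SF Ω)) (hQ : ∀ n, ∀ η ∈ Q n, IsPwPoly (𝒯 n) l η)
    -- the initial data and the right-hand sides
    (v₀ : ℕ → VF Ω) (hv₀ : ∀ n, v₀ n ∈ discDivFree (V n) (Q n))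
    (f : ℕ → ℝ × Pt d → Pt d)
    (hf : ∀ n, MemLp (f n) (ENNReal.ofReal (pMinus / (pMinus - 1)))
      (volume.restrict (cylinder T Ω)))
    (F : ℕ → ℝ × Pt d → Mat d)
    (hF : ∀ n, MemVarLp (volume.restrict (cylinder T Ω)) (fun y => pn n y / (pn n y - 1)) (F n))
    (hF_symm : ∀ n, ∀ᵐ y ∂volume.restrict (cylinder T Ω), ∀ i j, F n y (i, j) = F n y (j, i))
    -- the operators
    (A : ℕ → ℝ → VF Ω → VF Ω → ℝ)
    (hA : ∀ n, IsOperatorFamily T Ω (qn n) (pn n) (A n))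
    (hA_demicont : ∀ n, IsDemicontinuous T Ω (qn n) (pn n) (A n))
    (hA_meas : ∀ n, IsMeasurableFamily T Ω (qn n) (pn n) (A n))
    (𝔹 : ℝ≥0 → ℝ≥0) (h𝔹 : Monotone 𝔹)
    (hA_growth : ∀ n, HasGrowth T Ω (qn n) (pn n) (A n) 𝔹)
    (c₀ c₁ c₂ : ℝ) (hc₀ : 0 < c₀) (hc₁ : 0 ≤ c₁) (hc₂ : 0 ≤ c₂)
    (hA_coer : ∀ n, IsSemicoercive T Ω (qn n) (pn n) (A n) c₀ c₁ c₂) :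
    -- `4 c₁ τ < 1` is `τ < 1 / (4 c₁)`, with `1 / 0 = ∞`
    ∀ K n : ℕ, 1 ≤ K → 4 * c₁ * stepSize T K < 1 →
      discDivFree (V n) (Q n) ⊆ uPlus T Ω (qn n) (pn n) ∧
      ∃ v : ℕ → VF Ω, v 0 = v₀ n ∧
        (∀ k, 1 ≤ k → k ≤ K → v k ∈ discDivFree (V n) (Q n)) ∧
        SolvesScheme T K (discDivFree (V n) (Q n)) (A n) (f n) (F n) v := by

  intro K n hK hτc
  set τ := stepSize T K
  have hKpos : (0 : ℝ) < K := by exact_mod_cast hK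
  have hτ : 0 < τ := div_pos hT hKpos
  have hdpos : (0 : ℝ) < d := by exact_mod_cast (by omega : 0 < d)
  have hΩf : IsFiniteMeasure (volume.restrict Ω) :=
    ⟨by rw [Measure.restrict_apply_univ]; exact hΩ.isBounded.measure_lt_top⟩
  have hcylf : IsFiniteMeasure (volume.restrict (cylinder T Ω)) := by
    rw [restrict_cylinder]; infer_instance
  have hcyl0 : volume.restrict (cylinder T Ω) ≠ 0 := by
    rw [Ne, Measure.restrict_eq_zero]
    exact ((isOpen_Ioo.prod hΩ.isOpen).measure_pos volume
      ((nonempty_Ioo.2 hT).prod hΩ.isConnected.nonempty)).ne'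
  have hqn_exp : IsBoundedExponent (volume.restrict (cylinder T Ω)) (qn n) := by
    have e : qn n = fun y => pn n y * ((d + 2) / d) - ε := funext (hqn n)
    obtain ⟨C, hC⟩ := (hpn n).bounded
    refine ⟨?_, ?_, C * ((d + 2) / d), ?_⟩
    · rw [e]
      exact ((hpn n).aemeasurable.mul_const _).sub_const _
    · filter_upwards [hpn_ge n] with y hy
      rw [hqn]
      -- Writing `q = p + (2 / d) p - ε`, the bounds `ε ≤ (2 / d) p⁻` and `p ≥ p⁻` give `q ≥ p ≥ 2`.
      have h1 : (d + 2 : ℝ) / d = 1 + 2 / d := by field_simp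
      have h2 : 2 / (d : ℝ) * pMinus ≤ 2 / d * pn n y := by gcongr
      rw [h1]
      nlinarith
    · filter_upwards [hC] with y hy
      rw [hqn]
      have : pn n y * ((d + 2) / d) ≤ C * ((d + 2) / d) := by gcongr
      linarith
  have htame : ∀ z ∈ discDivFree (V n) (Q n), IsTame z := fun z hz =>
    isTame_of_isContPwPoly hΩ (h𝒯 n) (hV n z hz.1) hz.2.1
  refine ⟨fun z hz => (htame z hz).mem_symSobolev₀ hΩ
    (isBoundedExponent_const _ (hqn_exp.one_le_essSup hcyl0))
    (isBoundedExponent_const _ ((hpn n).one_le_essSup hcyl0)), ?_⟩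
  -- The initial datum witnesses that the set of discretely divergence-free fields is nonempty.
  obtain ⟨W, hW⟩ := exists_submodule_discDivFree (h𝒯 n) hΩ.isOpen (hQ n) ⟨v₀ n, hv₀ n⟩
  have hWmem : ∀ z, z ∈ W ↔ z ∈ discDivFree (V n) (Q n) := fun z => by rw [← hW]; rfl
  have hVfin := finiteDimensional_of_isContPwPoly (h𝒯 n) hΩ.isOpen (hV n)
  have hWfin : FiniteDimensional ℝ W :=
    Submodule.finiteDimensional_of_le (S₂ := V n) fun z hz => ((hWmem z).1 hz).1
  have hf_int : Integrable (f n) (volume.restrict (cylinder T Ω)) := by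
    refine (hf n).integrable ?_
    rw [← ENNReal.ofReal_one]
    refine ENNReal.ofReal_le_ofReal ?_
    rw [le_div_iff₀ (by linarith)]
    linarith
  have hF_int : Integrable (F n) (volume.restrict (cylinder T Ω)) := by
    refine integrable_of_memVarLp ?_ (hF n)
    filter_upwards [hpn_ge n] with y hy
    rw [le_div_iff₀ (by linarith)]
    linarith
  -- Stated for every index, with no requirement beyond `K`, so that the choice of a successor is a
  -- total function and can be iterated. The step from `k` to `k + 1` lives on the interval with
  -- index `k + 1`.
  have hstep : ∀ (k : ℕ) (w : W), ∃ v : W, k + 1 ≤ K → ∀ z ∈ W,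
      IntegrableOn (fun t => A n t v z) (timeInterval T K (k + 1)) ∧
      IntegrableOn (fun t => rhsPairing (f n) (F n) t z) (timeInterval T K (k + 1)) ∧
      l2Inner (τ⁻¹ • ((v : VF Ω) - (w : VF Ω))) z + (⨍ t in timeInterval T K (k + 1), A n t v z) =
        ⨍ t in timeInterval T K (k + 1), rhsPairing (f n) (F n) t z := by
    intro k w
    by_cases hk : k + 1 ≤ K
    · have hI : timeInterval T K (k + 1) = Ioc (k * τ) ((k + 1) * τ) := by
        simp only [timeInterval, Nat.cast_add, Nat.cast_one, add_sub_cancel_right]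
        rfl
      have hsub : timeInterval T K (k + 1) ⊆ Ioc 0 T := by
        rw [hI]
        refine Ioc_subset_Ioc (by positivity) ?_
        have h1 : (k + 1 : ℝ) ≤ K := by exact_mod_cast hk
        calc (k + 1) * τ ≤ K * τ := by gcongr
          _ = T := mul_div_cancel₀ T hKpos.ne'
      have hvol : volume (timeInterval T K (k + 1)) ≠ 0 := by
        rw [hI, Real.volume_Ioc]
        have h1 : (k + 1) * τ - k * τ = τ := by ring
        rw [h1]
        exact (ENNReal.ofReal_pos.2 hτ).ne'
      -- Since `c₁ τ ≥ 0`, the condition `4 c₁ τ < 1` implies the bound `c₁ τ < 1` used by a single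
      -- step.
      obtain ⟨v, hv, h⟩ := exists_scheme_step hΩ hqn_exp (hpn n) (hA n) (hA_demicont n) (hA_meas n)
        h𝔹 (hA_growth n) hc₀ hc₂ (hA_coer n) hf_int hF_int
        (fun z hz => htame z ((hWmem z).1 hz)) hsub hvol hτ (by nlinarith) w.2
      exact ⟨⟨v, hv⟩, fun _ => h⟩
    · exact ⟨0, fun h => (hk h).elim⟩
  choose next hnext using hstep
  let v : ℕ → W := fun k => Nat.rec ⟨v₀ n, (hWmem _).2 (hv₀ n)⟩ next k
  let v' : ℕ → VF Ω := fun k => (v k).1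
  refine ⟨v', rfl, fun k _ _ => (hWmem _).1 (v k).2, fun k hk1 hkK z hz => ?_⟩
  obtain ⟨k, rfl⟩ : ∃ j, k = j + 1 := ⟨k - 1, by omega⟩
  exact hnext k (v k) hkK z ((hWmem z).2 hz)
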